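/- A dissociation set in a finite simple graph $G$ is a set of vertices inducing a subgraph with maximum degree at most one; a maximum dissociation set is one of maximum cardinality, and $m(G)$ denotes the number of maximum dissociation sets of $G$. A potted graph is a connected graph containing exactly one cycle, such that exactly one vertex of this cycle has degree larger than $2$. Let $\mathcal P(n,k)$ be the set of potted graphs of order $n$ whose cycle has order $k$. Let $P_r$ and $C_r$ be the path and the cycle of order $r$. For vertex-disjoint trees $T_1,\dots,T_r$ let $G_w(T_1,\dots,T_r)$ be a tree obtained from $T_1\cup\dots\cup T_r$ by identifying $r$ leaves, one from each $T_i$, into a single vertex $w$ (so $G_w(T_1)$ is $T_1$ with $w$ one of its leaves). Let $C_k+_e G_w(T_1,\dots,T_r)$ be obtained from the disjoint union of $C_k$ and $G_w(T_1,\dots,T_r)$ by adding an edge between $w$ and a vertex of $C_k$, and let $C_k\odot G_w(T_1,\dots,T_r)$ be obtained from it by identifying $w$ with a vertex of $C_k$. Define the following families of graphs (up to isomorphism), where $l\ge 0$ is arbitrary and, in $\mathcal G_2,\mathcal G_6,\mathcal G_7,\mathcal G_9$, each of $T_1,\dots,T_l$ is $P_4$ or $K_{1,3}$: - $\mathcal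 G_1=\{C_k+_e G_w(P_3,P_4,\dots,P_4)\}$ with $l$ copies of $P_4$; - $\mathcal G_2=\{C_k+_e G_w(P_2,P_3,T_1,\dots,T_l)\}$; - $\mathcal G_6=\{C_k\odot G_w(P_3,T_1,\dots,T_l)\}$; - $\mathcal G_7=\{C_k\odot G_w(P_2,P_2,T_1,\dots,T_l)\}$; - $\mathcal G_8=\{C_k\odot G_w(P_4,\dots,P_4)\}$ with at least one copy of $P_4$; - $\mathcal G_9=\{C_k\odot G_w(P_2,T_1,\dots,T_l)\}$. Put $$x_1=k\cdot 3^{(n-k-1)/3-1}+\tfrac13(k+1),\qquad x_2=(k+1)\cdot 3^{(n-k-1)/3-1}+1,$$ $$x_3=k\cdot 3^{(n-k)/3-1}+\tfrac13(k+1)\left[\tfrac13(n-k)+1\right]+1,\qquad x_4=(k+1)\cdot 3^{(n-k)/3-1}+\tfrac13(n+k-1).$$ **Theorem 1.2.** Let $n,k$ be positive integers with $n\ge k+3$ and $k\equiv 2\pmod 3$, and let $G\in\mathcal P(n,k)$. Then $$m(G)\le\begin{cases}\max\{x_1,x_2\}, & n\equiv 0\pmod 3,\\ (k+1)\cdot 3^{(n-k-2)/3-1},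 & n\equiv 1\pmod 3,\\ \max\{x_3,x_4\}, & n\equiv 2\pmod 3.\end{cases}$$ Moreover, equality holds if and only if one of the following holds: 1. $n\equiv 0\pmod 3$, and either $G\in\mathcal G_2$ and $x_1=\max\{x_1,x_2\}$, or $G\in\mathcal G_9$ and $x_2=\max\{x_1,x_2\}$; 2. $n\equiv 1\pmod 3$ and $G\in\mathcal G_6\cup\mathcal G_7$; 3. $n\equiv 2\pmod 3$, and either $G\in\mathcal G_1$ and $x_3=\max\{x_3,x_4\}$, or $G\in\mathcal G_8$ and $x_4=\max\{x_3,x_4\}$. -/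

import Mathlib

namespace Potted

universe u

/-- `S` is a dissociation set of `G`: every vertex of `S` has degree at most one in `G[S]`. -/
def IsDissociationSet {V : Type u} [Finite V] (G : SimpleGraph V) (S : Finset V) : Prop :=
  ∀ v ∈ S, {w | w ∈ S ∧ G.Adj v w}.ncard ≤ 1

/-- A dissociation set of maximum cardinality. -/
def IsMaximumDissociationSet {V : Type u} [Finite V] (G : SimpleGraph V) (S : Finset V) : Prop :=
  IsDissociationSet G S ∧ ∀ T : Finset V, IsDissociationSet G T → T.card ≤ S.card

/-- `m(G)`: the number of maximum dissociation sets of `G`. -/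
noncomputable def numMaxDissociationSets {V : Type u} [Finite V] (G : SimpleGraph V) : ℕ :=
  {S : Finset V | IsMaximumDissociationSet G S}.ncard

/-- The subgraph `C` of `G` is a cycle of order `k` (necessarily `k ≥ 3`). -/
def IsCycleSubgraph {V : Type u} {G : SimpleGraph V} (C : G.Subgraph) (k : ℕ) : Prop :=
  ∃ (v : V) (p : G.Walk v v), p.IsCycle ∧ p.length = k ∧ p.toSubgraph = C

/-- `G` is a potted graph whose cycle has order `k`: `G` is connected, it contains exactly one
cycle, this cycle has order `k`, and exactly one vertex of the cycle has degree larger than `2`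
in `G`. -/
def IsPottedGraph {V : Type u} [Finite V] (G : SimpleGraph V) (k : ℕ) : Prop :=
  G.Connected ∧ ∃ C : G.Subgraph, IsCycleSubgraph C k ∧
    (∀ (C' : G.Subgraph) (l : ℕ), IsCycleSubgraph C' l → C' = C) ∧
    ∃! w : V, w ∈ C.verts ∧ 2 < (G.neighborSet w).ncard

/-- A graph with a distinguished vertex. -/
structure PointedGraph where
  /-- the vertices -/
  Vert : Type
  /-- the graph -/
  graph : SimpleGraph Vert
  /-- the distinguished vertex -/
  base : Vert

/-- The path of order two, with a leaf distinguished. -/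
def P2 : PointedGraph := ⟨Fin 2, SimpleGraph.pathGraph 2, 0⟩

/-- The path of order three, with a leaf distinguished. -/
def P3 : PointedGraph := ⟨Fin 3, SimpleGraph.pathGraph 3, 0⟩

/-- The path of order four, with a leaf distinguished. -/
def P4 : PointedGraph := ⟨Fin 4, SimpleGraph.pathGraph 4, 0⟩

/-- The star `K_{1,3}`, with a leaf distinguished. -/
def K13 : PointedGraph :=
  ⟨Fin 1 ⊕ Fin 3, completeBipartiteGraph (Fin 1) (Fin 3), Sum.inr 0⟩

/-- The adjacency relation of the graph obtained from the disjoint union of the `T i` by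
identifying all the distinguished vertices: `none` is the identified vertex and `some ⟨i, x⟩` is
the vertex `x` of `T i`, for `x` other than the distinguished one. -/
inductive GlueAdj {ι : Type} (T : ι → PointedGraph) :
    Option (Σ i, {x : (T i).Vert // x ≠ (T i).base}) →
      Option (Σ i, {x : (T i).Vert // x ≠ (T i).base}) → Prop
  | inner (i : ι) (x y : {x : (T i).Vert // x ≠ (T i).base})
      (h : (T i).graph.Adj x.1 y.1) : GlueAdj T (some ⟨i, x⟩) (some ⟨i, y⟩)
  | fromBase (i : ι) (x : {x : (T i).Vert // x ≠ (T i).base})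
      (h : (T i).graph.Adj (T i).base x.1) : GlueAdj T none (some ⟨i, x⟩)
  | toBase (i : ι) (x : {x : (T i).Vert // x ≠ (T i).base})
      (h : (T i).graph.Adj x.1 (T i).base) : GlueAdj T (some ⟨i, x⟩) none

/-- The graph obtained from the disjoint union of the pointed graphs `T i` by identifying all
their distinguished vertices, pointed at the identified vertex. -/
def glue {ι : Type} (T : ι → PointedGraph) : PointedGraph where
  Vert := Option (Σ i, {x : (T i).Vert // x ≠ (T i).base})
  graph :=
    { Adj := GlueAdj T
      symm := ⟨fun _ _ h => match h with
        | .inner i x y h => .inner i y x h.symm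
        | .fromBase i x h => .toBase i x h.symm
        | .toBase i x h => .fromBase i x h.symm⟩
      loopless := ⟨fun _ h => match h with
        | .inner i x _ h => (T i).graph.loopless.irrefl x.1 h⟩ }
  base := none

/-- `G_w(T₁, …, T_r)`, pointed at the identified vertex `w`. -/
def glueList (L : List PointedGraph) : PointedGraph :=
  glue fun i : Fin L.length => L.get i

/-- `G` is (isomorphic to) `C_k +_e T`: the disjoint union of the cycle `C_k` and `T` with an edge
added between a vertex of `C_k` and the distinguished vertex of `T`. -/
def IsCycleJoin {V : Type u} (G : SimpleGraph V) (k : ℕ) (T : PointedGraph) : Prop :=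
  ∃ c : Fin k, Nonempty (G ≃g
    (SimpleGraph.sum (SimpleGraph.cycleGraph k) T.graph ⊔
      SimpleGraph.edge (Sum.inl c) (Sum.inr T.base)))

/-- `G` is (isomorphic to) `C_k ⊙ T`: the graph obtained from the disjoint union of the cycle
`C_k` and `T` by identifying a vertex of `C_k` and the distinguished vertex of `T`. -/
def IsCycleGlue {V : Type u} (G : SimpleGraph V) (k : ℕ) (T : PointedGraph) : Prop :=
  ∃ c : Fin k, Nonempty (G ≃g (glueList [⟨Fin k, SimpleGraph.cycleGraph k, c⟩, T]).graph)

/-- A (possibly empty) list each of whose entries is `P_4` or `K_{1,3}`. -/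
def IsP4K13List (L : List PointedGraph) : Prop := ∀ T ∈ L, T = P4 ∨ T = K13

/-- `𝒢₁`: the graphs `C_k +_e G_w(P₃, P₄, …, P₄)` with `l ≥ 0` copies of `P₄`. For `l = 0` the
tree is `P₃` and `w` is a leaf of it. -/
def InG1 {V : Type u} (G : SimpleGraph V) (k : ℕ) : Prop :=
  ∃ l : ℕ, IsCycleJoin G k (glueList (P3 :: List.replicate l P4))

/-- `𝒢₂`: the graphs `C_k +_e G_w(P₂, P₃, T₁, …, T_l)` with `l ≥ 0` and each `T_i` one of `P₄`,
`K_{1,3}`. -/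
def InG2 {V : Type u} (G : SimpleGraph V) (k : ℕ) : Prop :=
  ∃ L : List PointedGraph, IsP4K13List L ∧ IsCycleJoin G k (glueList (P2 :: P3 :: L))

/-- `𝒢₆`: the graphs `C_k ⊙ G_w(P₃, T₁, …, T_l)` with each `T_i` one of `P₄`, `K_{1,3}`. -/
def InG6 {V : Type u} (G : SimpleGraph V) (k : ℕ) : Prop :=
  ∃ L : List PointedGraph, IsP4K13List L ∧ IsCycleGlue G k (glueList (P3 :: L))

/-- `𝒢₇`: the graphs `C_k ⊙ G_w(P₂, P₂, T₁, …, T_l)` with each `T_i` one of `P₄`, `K_{1,3}`. -/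
def InG7 {V : Type u} (G : SimpleGraph V) (k : ℕ) : Prop :=
  ∃ L : List PointedGraph, IsP4K13List L ∧ IsCycleGlue G k (glueList (P2 :: P2 :: L))

/-- `𝒢₈`: the graphs `C_k ⊙ G_w(P₄, …, P₄)` with at least one copy of `P₄`. -/
def InG8 {V : Type u} (G : SimpleGraph V) (k : ℕ) : Prop :=
  ∃ l : ℕ, 1 ≤ l ∧ IsCycleGlue G k (glueList (List.replicate l P4))

/-- `𝒢₉`: the graphs `C_k ⊙ G_w(P₂, T₁, …, T_l)` with each `T_i` one of `P₄`, `K_{1,3}`. -/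
def InG9 {V : Type u} (G : SimpleGraph V) (k : ℕ) : Prop :=
  ∃ L : List PointedGraph, IsP4K13List L ∧ IsCycleGlue G k (glueList (P2 :: L))

/-- `x₁ = k · 3^((n-k-1)/3-1) + (k+1)/3`. -/
def x1 (n k : ℕ) : ℚ := k * (3 : ℚ) ^ (((n : ℤ) - k - 1) / 3 - 1) + (k + 1) / 3

/-- `x₂ = (k+1) · 3^((n-k-1)/3-1) + 1`. -/
def x2 (n k : ℕ) : ℚ := (k + 1) * (3 : ℚ) ^ (((n : ℤ) - k - 1) / 3 - 1) + 1

/-- `x₃ = k · 3^((n-k)/3-1) + (k+1)/3 · [(n-k)/3+1] + 1`. -/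
def x3 (n k : ℕ) : ℚ :=
  k * (3 : ℚ) ^ (((n : ℤ) - k) / 3 - 1) + (k + 1) / 3 * (((n : ℚ) - k) / 3 + 1) + 1

/-- `x₄ = (k+1) · 3^((n-k)/3-1) + (n+k-1)/3`. -/
def x4 (n k : ℕ) : ℚ :=
  (k + 1) * (3 : ℚ) ^ (((n : ℤ) - k) / 3 - 1) + ((n : ℚ) + k - 1) / 3

end Potted

/-!
Let `r` be the vertex of the cycle of degree larger than two. Cutting at `r` separates the cycle
from a rooted tree `T`, and `m(G)` is a linear function of a few counts of `T`, which record how its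
maximum dissociation sets meet the root. Attaching a branch at the root of a tree changes these
counts by explicit bilinear rules, and induction along these rules bounds them by powers of `3`. The
growth comes from branches of order three, each of which triples the number of choices: the extremal
trees consist of such branches at a common root and at most two further, smaller ones. In the cases
with a maximum of two values, `T` is itself of this form or has a single branch of this form, and
neither kind of tree beats the other for all `n` and `k`.
-/

namespace Potted

universe u v

/-! ### Rooted trees and their counts -/

/-- Finite rooted trees. Every such tree arises from a single vertex by repeatedly attaching
branches: `join t s` is the tree `t` with `s` as an additional branch at the root. -/
inductive BranchTree
  | single : BranchTree
  | join : BranchTree → BranchTree → BranchTree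

namespace BranchTree

/-- The number of vertices. -/
def order : BranchTree → ℕ
  | single => 1
  | join t s => order t + order s

/-- The branches at the root, as rooted trees. -/
def branches : BranchTree → Multiset BranchTree
  | single => 0
  | join t s => s ::ₘ branches t

/-- The rooted tree with given branches. The branches form a list because `join` remembers the
order in which they are attached. -/
def ofBranches : List BranchTree → BranchTree
  | [] => single
  | s :: l => join (ofBranches l) s

theorem exists_eq_ofBranches (t : BranchTree) : ∃ l, t = ofBranches l := by
  induction t with
  | single => exact ⟨[], rfl⟩
  | join t s iht _ =>
    obtain ⟨l, rfl⟩ := iht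
    exact ⟨s :: l, rfl⟩

theorem branches_ofBranches (l : List BranchTree) : (ofBranches l).branches = l := by
  induction l with
  | nil => rfl
  | cons s l ih => rw [ofBranches, branches, ih, Multiset.cons_coe]

theorem branches_eq_zero_iff {t : BranchTree} : t.branches = 0 ↔ t = single := by
  cases t <;> simp [branches]

/-- The path of order two. -/
def edge : BranchTree := join single single

/-- The path of order three, rooted at an end: the branch at `w` of a `P₄` glued at `w`. -/
def pathEnd : BranchTree := join single edge

/-- The path of order three, rooted at its centre: the branch at `w` of a `K_{1,3}` glued at `w`. -/
def pathMid : BranchTree := join edge single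

/-- The branches of `t` are those in `B`, `e` copies of `pathEnd` and `p` copies of `pathMid`. All
the extremal trees have this form, with few branches in `B`. -/
def IsBouquet (B : Multiset BranchTree) (e p : ℕ) (t : BranchTree) : Prop :=
  t.branches = B + (Multiset.replicate e pathEnd + Multiset.replicate p pathMid)

/-- The standard tree satisfying `IsBouquet B e p`. -/
def bouquet (B : List BranchTree) (e p : ℕ) : BranchTree :=
  ofBranches (B ++ (List.replicate e pathEnd ++ List.replicate p pathMid))

theorem isBouquet_bouquet (B : List BranchTree) (e p : ℕ) : IsBouquet B e p (bouquet B e p) := by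
  simp only [IsBouquet, bouquet, branches_ofBranches, ← Multiset.coe_add, Multiset.coe_replicate]

section IsBouquet

variable {B : Multiset BranchTree} {e p : ℕ} {t : BranchTree}

theorem isBouquet_single : IsBouquet 0 0 0 single := by
  simp [IsBouquet, branches]

theorem IsBouquet.join (h : IsBouquet B e p t) (s : BranchTree) :
    IsBouquet (s ::ₘ B) e p (join t s) := by
  rw [IsBouquet, branches, h, Multiset.cons_add]

theorem IsBouquet.join_pathEnd (h : IsBouquet B e p t) :
    IsBouquet B (e + 1) p (t.join pathEnd) := by
  rw [IsBouquet, branches, h, Multiset.replicate_succ, Multiset.cons_add, Multiset.add_cons]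

theorem IsBouquet.join_pathMid (h : IsBouquet B e p t) :
    IsBouquet B e (p + 1) (t.join pathMid) := by
  rw [IsBouquet, branches, h, Multiset.replicate_succ, Multiset.add_cons, Multiset.add_cons]

theorem IsBouquet.eq_edge (h : IsBouquet {single} 0 0 t) : t = edge := by
  cases t with
  | single => simp [IsBouquet, branches] at h
  | join t s =>
    have h : s ::ₘ t.branches = single ::ₘ 0 := by simpa [IsBouquet, branches] using h
    have ht : t.branches = 0 := Multiset.card_eq_zero.1 (by simpa using congrArg Multiset.card h)
    rw [ht, Multiset.cons_inj_left] at h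
    rw [h, branches_eq_zero_iff.1 ht, edge]

end IsBouquet

end BranchTree

/-- How a rooted tree sees its root, in terms of its maximum dissociation sets:

* `optional b c d`: maximum sets may avoid the root; `b` of them do, in `c` the root is isolated and
  in `d` it has degree one;
* `forced o c d`: all maximum sets contain the root, isolated in `c ≥ 1` and of degree one in `d` of
  them, and `o` sets of size one less avoid it;
* `matched o e d`: the root has degree one in all `d` maximum sets; of the sets of size one less,
  `o` avoid the root and `e` contain it as an isolated vertex. -/
inductive RootCounts
  | optional : ℕ → ℕ → ℕ → RootCounts
  | forced : ℕ → ℕ → ℕ → RootCounts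
  | matched : ℕ → ℕ → ℕ → RootCounts

namespace RootCounts

/-- The counts after attaching a branch at the root. A set containing the root is isolated there,
or matched to the branch, only if the branch avoids, or has as an isolated vertex, its own root. -/
def join : RootCounts → RootCounts → RootCounts
  | forced o₁ c₁ d₁, optional b₂ c₂ d₂ =>
    forced (o₁ * (b₂ + c₂ + d₂)) (c₁ * b₂) (d₁ * b₂ + c₁ * c₂)
  | forced o₁ c₁ _, forced o₂ c₂ d₂ => matched (o₁ * (c₂ + d₂)) (c₁ * o₂) (c₁ * c₂)
  | forced o₁ c₁ d₁, matched o₂ e₂ d₂ => optional (o₁ * d₂) (c₁ * o₂) (d₁ * o₂ + c₁ * e₂)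
  | matched o₁ e₁ d₁, optional b₂ c₂ d₂ => matched (o₁ * (b₂ + c₂ + d₂)) (e₁ * b₂) (d₁ * b₂)
  | matched o₁ e₁ d₁, forced o₂ c₂ d₂ => optional (o₁ * (c₂ + d₂)) 0 (d₁ * o₂ + e₁ * c₂)
  | matched o₁ _ d₁, matched o₂ _ d₂ => optional (o₁ * d₂) 0 (d₁ * o₂)
  | optional b₁ c₁ d₁, optional b₂ c₂ d₂ =>
    optional (b₁ * (b₂ + c₂ + d₂)) (c₁ * b₂) (d₁ * b₂ + c₁ * c₂)
  | optional b₁ c₁ _, forced _ c₂ d₂ => optional (b₁ * (c₂ + d₂)) 0 (c₁ * c₂)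
  | optional b₁ _ _, matched _ _ d₂ => optional (b₁ * d₂) 0 0

end RootCounts

/-- The counts of a rooted tree. -/
def BranchTree.counts : BranchTree → RootCounts
  | single => .forced 1 1 0
  | join t s => t.counts.join s.counts

/-- `3 ^ ⌊j / 3⌋`, the scale of all the counts. -/
def threePow (j : ℕ) : ℕ := 3 ^ (j / 3)

/-- The amount by which the largest number of maximum dissociation sets of a tree of order `j + 3`
exceeds `threePow j`. -/
def excess (j : ℕ) : ℕ := if j % 3 = 0 then j / 3 + 2 else if j % 3 = 1 then 1 else 0

/-- The indicator of the multiples of three. -/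
def threeInd (j : ℕ) : ℕ := if j % 3 = 0 then 1 else 0

section Arithmetic

variable {i j s : ℕ}

theorem threePow_pos (j : ℕ) : 0 < threePow j := by
  unfold threePow
  positivity

theorem threePow_eq (h : j / 3 = s) : threePow j = 3 ^ s := by
  rw [threePow, h]

theorem threePow_zero : threePow 0 = 1 := rfl

theorem threePow_three_mul (q : ℕ) : threePow (3 * q) = 3 ^ q :=
  threePow_eq (by lia)

theorem threePow_three_mul_add (q j : ℕ) : threePow (3 * q + j) = 3 ^ q * threePow j := by
  rw [threePow_eq (s := q + j / 3) (by lia), pow_add, threePow]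

theorem threePow_add_three (j : ℕ) : threePow (j + 3) = 3 * threePow j := by
  simpa [add_comm] using threePow_three_mul_add 1 j

theorem threePow_mono : Monotone threePow := fun _ _ h =>
  Nat.pow_le_pow_right (by lia) (Nat.div_le_div_right h)

theorem threePow_lt (h : i / 3 < j / 3) : threePow i < threePow j :=
  Nat.pow_lt_pow_right (by lia) h

theorem threePow_mul_le (i j : ℕ) : threePow i * threePow j ≤ threePow (i + j) := by
  rw [threePow, threePow, ← pow_add]
  exact Nat.pow_le_pow_right (by lia) (by lia)

theorem threePow_mul_three_le (i j : ℕ) :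
    threePow i * (3 * threePow j) ≤ threePow (i + j + 3) := by
  rw [threePow_add_three, mul_left_comm]
  exact Nat.mul_le_mul_left 3 (threePow_mul_le i j)

theorem two_mul_succ_le_three_pow (q : ℕ) : 2 * q + 1 ≤ 3 ^ q := by
  induction q with
  | zero => simp
  | succ q ih => rw [pow_succ]; lia

theorem excess_three_mul (q : ℕ) : excess (3 * q) = q + 2 := by
  simp [excess]

theorem excess_of_mod_one (h : j % 3 = 1) : excess j = 1 := by
  simp [excess, h]

theorem excess_of_mod_two (h : j % 3 = 2) : excess j = 0 := by
  simp [excess, h]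

theorem threeInd_three_mul (q : ℕ) : threeInd (3 * q) = 1 := by
  simp [threeInd]

theorem threeInd_of_ne (h : j % 3 ≠ 0) : threeInd j = 0 := by
  simp [threeInd, h]

theorem threeInd_le_one (j : ℕ) : threeInd j ≤ 1 := by
  unfold threeInd; split <;> lia

theorem threeInd_add_three (j : ℕ) : threeInd (j + 3) = threeInd j := by
  simp [threeInd]

theorem threeInd_le_excess (j : ℕ) : threeInd j ≤ excess j := by
  unfold threeInd excess; split_ifs <;> lia

theorem threeInd_mul_le_excess (i j : ℕ) : threeInd i * threeInd j ≤ excess (i + j + 3) := by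
  unfold threeInd excess; split_ifs <;> lia

theorem excess_add_threeInd_le (j : ℕ) : excess j + threeInd j ≤ excess (j + 3) := by
  unfold threeInd excess; split_ifs <;> lia

theorem excess_le_three_mul_add (q j : ℕ) : excess j ≤ excess (3 * q + j) := by
  unfold excess; split_ifs <;> lia

theorem excess_le_threePow (h : j ≠ 0) : excess j ≤ threePow j := by
  have := two_mul_succ_le_three_pow (j / 3)
  unfold excess threePow
  split_ifs <;> lia

theorem threePow_add_threeInd_le (j : ℕ) :
    threePow j + threeInd j ≤ threePow (j + 1) + excess (j + 1) := by
  have hmono := threePow_mono (Nat.le_succ j)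
  unfold threeInd excess
  split_ifs <;> lia

end Arithmetic

open BranchTree

theorem eq_and_eq_of_mul_le_mul {a b A B : ℕ} (ha : a ≤ A) (hb : b ≤ B) (ha₀ : 0 < a)
    (hb₀ : 0 < b) (h : A * B ≤ a * b) : a = A ∧ b = B :=
  (mul_eq_mul_iff_eq_and_eq_of_pos ha hb ha₀ (hb₀.trans_le hb)).1
    ((Nat.mul_le_mul ha hb).antisymm h)

/-- The inductive bounds for a tree `t` of order `j + 3` with counts `optional b c d`, together with
the shape of `t` where `b` attains its maximum. -/
structure OptionalBounds (t : BranchTree) (j b c d : ℕ) : Prop where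
  pos : 0 < b
  avoiding_le : b ≤ threePow j
  add_isolated_le : b + c ≤ threePow j + threeInd j
  total_le : b + c + d ≤ threePow j + excess j
  of_eq_zero : j = 0 →
    (t = pathEnd ∧ b = 1 ∧ c = 1 ∧ d = 1) ∨ (t = pathMid ∧ b = 1 ∧ c = 0 ∧ d = 2)
  shape_of_mod_zero : b = threePow j → j % 3 = 0 →
    ((∃ e p, IsBouquet {single, single} e p t) ∧ c = 0) ∨
    (∃ e p, IsBouquet {edge} e p t ∧ j = 3 * (e + p) ∧ c = 1 ∧ d = 1 + e)
  shape_of_mod_one : b = threePow j → j % 3 = 1 → 0 < d →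
    ∃ e p, IsBouquet {single, edge} e p t

/-- The inductive bounds for a tree `t` of order `j + 2` with counts `matched o e d`. -/
structure MatchedBounds (t : BranchTree) (j o e d : ℕ) : Prop where
  avoiding_pos : 0 < o
  matched_pos : 0 < d
  isolated_le : e ≤ threePow j
  total_le : o + e + d ≤ threePow j + excess j
  shape : (∃ f p, IsBouquet {single} f p t ∧ j = 3 * (f + p) ∧ o = 3 ^ (f + p) ∧ e = 1 ∧ d = 1) ∨
    o + d ≤ threePow j

/-- The inductive bounds for a tree `t` of order `i + 4` with counts `forced o c d`, unless all the
branches of `t` are paths of order three. -/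
structure GenericForcedBounds (t : BranchTree) (i o c d : ℕ) : Prop where
  avoiding_pos : 0 < o
  isolated_pos : 0 < c
  isolated_le : c ≤ threePow i
  max_le : c + d ≤ threePow i + 1
  avoiding_add_le : o + c ≤ 3 * threePow i
  avoiding_le : o ≤ 2 * threePow i ∨ o + 2 * c ≤ 3 * threePow i
  total_le : o + 2 * c + d ≤ 3 * threePow i + excess (i + 3)
  shape :
    (∃ a b c' d', t = join single a ∧ OptionalBounds a i b c' d' ∧ i ≠ 0 ∧ o = b + c' + d' ∧
      c = b ∧ d = c') ∨
    (o + 2 * c ≤ 3 * threePow i ∧ o + 2 * c + d ≤ 3 * threePow i + 1 ∧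
      (i % 3 = 2 → o + 2 * c + d ≤ 3 * threePow i))

/-- The inductive bounds for a tree `t` of order `j + 1` with counts `forced o c d`. In the case
`paths`, the tree may be a single vertex. -/
inductive ForcedBounds (t : BranchTree) (j o c d : ℕ) : Prop where
  | paths (p : ℕ) (h : IsBouquet 0 d p t) (hj : j = 3 * (d + p)) (ho : o = 3 ^ (d + p))
      (hc : c = 1)
  | general (i : ℕ) (hj : j = i + 3) (h : GenericForcedBounds t i o c d)

namespace OptionalBounds

variable {t : BranchTree} {j b c d : ℕ}

theorem add_isolated_le_succ (h : OptionalBounds t j b c d) : b + c ≤ threePow j + 1 :=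
  h.add_isolated_le.trans (Nat.add_le_add_left (threeInd_le_one j) _)

theorem total_le_two_mul (h : OptionalBounds t j b c d) (hj : j ≠ 0) :
    b + c + d ≤ 2 * threePow j := by
  have := h.total_le
  have := excess_le_threePow hj
  lia

theorem counts_of_zero (h : OptionalBounds t 0 b c d) : b = 1 ∧ c + d = 2 ∧ c ≤ 1 := by
  rcases h.of_eq_zero rfl with ⟨-, hb, hc, hd⟩ | ⟨-, hb, hc, hd⟩ <;> lia

theorem total_le_three_mul (h : OptionalBounds t j b c d) : b + c + d ≤ 3 * threePow j := by
  by_cases hj : j = 0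
  · subst hj
    have := h.counts_of_zero
    rw [threePow_zero]
    lia
  · exact (h.total_le_two_mul hj).trans (Nat.mul_le_mul_right _ (by lia))

theorem isBouquet_join (h : OptionalBounds t 0 b c d) {B : Multiset BranchTree} {e p : ℕ}
    {s : BranchTree} (hs : IsBouquet B e p s) :
    ∃ q, IsBouquet B (e + c) q (s.join t) ∧ e + c + q = e + p + 1 := by
  rcases h.of_eq_zero rfl with ⟨rfl, -, rfl, -⟩ | ⟨rfl, -, rfl, -⟩
  · exact ⟨p, hs.join_pathEnd, by ring⟩
  · exact ⟨p + 1, hs.join_pathMid, by ring⟩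

end OptionalBounds

namespace MatchedBounds

variable {t : BranchTree} {j o e d : ℕ}

theorem star_or_add_le (h : MatchedBounds t j o e d) :
    (∃ q, j = 3 * q ∧ o = 3 ^ q ∧ e = 1 ∧ d = 1) ∨ o + d ≤ threePow j :=
  h.shape.imp_left fun ⟨f, p, _, hj, ho, he, hd⟩ => ⟨f + p, hj, ho, he, hd⟩

theorem avoiding_le (h : MatchedBounds t j o e d) : o ≤ threePow j := by
  rcases h.star_or_add_le with ⟨q, rfl, rfl, -⟩ | h
  · rw [threePow_three_mul]
  · lia

theorem matched_le (h : MatchedBounds t j o e d) : d ≤ threePow j := by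
  rcases h.star_or_add_le with ⟨q, rfl, -, -, rfl⟩ | h
  · exact threePow_pos _
  · lia

theorem isBouquet_of_avoiding_eq (h : MatchedBounds t j o e d) (ho : o = threePow j) :
    j % 3 = 0 ∧ ∃ f p, IsBouquet {single} f p t := by
  rcases h.shape with ⟨f, p, ht, rfl, -⟩ | hle
  · exact ⟨by lia, f, p, ht⟩
  · have := h.matched_pos
    lia

theorem eq_edge_of_matched_eq (h : MatchedBounds t j o e d) (hd : d = threePow j) :
    t = edge ∧ j = 0 ∧ o = 1 ∧ e = 1 ∧ d = 1 := by
  rcases h.shape with ⟨f, p, ht, rfl, rfl, rfl, rfl⟩ | hle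
  · have := two_mul_succ_le_three_pow (f + p)
    rw [threePow_three_mul] at hd
    obtain ⟨rfl, rfl⟩ : f = 0 ∧ p = 0 := by lia
    exact ⟨ht.eq_edge, rfl, rfl, rfl, rfl⟩
  · have := h.avoiding_pos
    lia

end MatchedBounds

namespace ForcedBounds

variable {t : BranchTree} {j o c d : ℕ}

theorem avoiding_pos (h : ForcedBounds t j o c d) : 0 < o := by
  cases h with
  | paths p h hj ho hc => rw [ho]; positivity
  | general i hj h => exact h.avoiding_pos

theorem isolated_pos (h : ForcedBounds t j o c d) : 0 < c := by
  cases h with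
  | paths p h hj ho hc => lia
  | general i hj h => exact h.isolated_pos

theorem avoiding_le (h : ForcedBounds t j o c d) : o ≤ threePow j := by
  cases h with
  | paths p h hj ho hc => rw [hj, ho, threePow_three_mul]
  | general i hj h =>
    have := h.avoiding_add_le
    rw [hj, threePow_add_three]
    lia

theorem single_or (h : ForcedBounds t j o c d) :
    (t = single ∧ j = 0 ∧ o = 1 ∧ c = 1 ∧ d = 0) ∨
      ∃ i, j = i + 3 ∧ c ≤ threePow i ∧ c + d ≤ threePow i + 1 := by
  cases h with
  | paths p h hj ho hc =>
    obtain hq | ⟨q, hq⟩ : d + p = 0 ∨ ∃ q, d + p = q + 1 := by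
      cases d + p <;> simp
    · obtain ⟨rfl, rfl⟩ : d = 0 ∧ p = 0 := by lia
      exact .inl ⟨branches_eq_zero_iff.1 (by simpa [IsBouquet] using h), hj, ho, hc, rfl⟩
    · have := two_mul_succ_le_three_pow q
      exact .inr ⟨3 * q, by lia, by rw [hc]; exact threePow_pos _, by
        rw [threePow_three_mul]; lia⟩
  | general i hj h => exact .inr ⟨i, hj, h.isolated_le, h.max_le⟩

theorem max_le (h : ForcedBounds t j o c d) : c + d ≤ threePow j := by
  rcases h.single_or with ⟨-, rfl, -, rfl, rfl⟩ | ⟨i, rfl, -, hcd⟩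
  · rfl
  · have := threePow_pos i
    rw [threePow_add_three]
    lia

theorem eq_single_of_max_eq (h : ForcedBounds t j o c d) (hm : c + d = threePow j) :
    t = single ∧ j = 0 ∧ o = 1 ∧ c = 1 ∧ d = 0 := by
  rcases h.single_or with h | ⟨i, rfl, -, hcd⟩
  · exact h
  · have := threePow_pos i
    rw [threePow_add_three] at hm
    lia

theorem isBouquet_of_avoiding_eq (h : ForcedBounds t j o c d) (ho : o = threePow j) :
    ∃ p, IsBouquet 0 d p t ∧ j = 3 * (d + p) ∧ c = 1 := by
  cases h with
  | paths p h hj _ hc => exact ⟨p, h, hj, hc⟩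
  | general i hj h =>
    have := h.avoiding_add_le
    have := h.isolated_pos
    rw [hj, threePow_add_three] at ho
    lia

end ForcedBounds

theorem forcedBounds_single : ForcedBounds single 0 1 1 0 :=
  .paths 0 isBouquet_single rfl rfl rfl

theorem star_star_total_le {x q : ℕ} (p : ℕ) (hx : x ≤ q) :
    3 ^ q + (1 + x) * 3 ^ p + 1 ≤ 3 ^ (q + p) + q + p + 2 := by
  have hq := two_mul_succ_le_three_pow q
  have hp := two_mul_succ_le_three_pow p
  rw [pow_add]
  generalize 3 ^ q = a at *
  generalize 3 ^ p = b at *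
  obtain ⟨b, rfl⟩ := Nat.exists_eq_add_of_le' (by lia : 1 ≤ b)
  obtain ⟨a, rfl⟩ := Nat.exists_eq_add_of_le' hq
  nlinarith [Nat.zero_le (a * b), Nat.mul_le_mul_right b hx]

section ForcedMatched

variable {s t : BranchTree} {i j o₁ c d o₂ e d' : ℕ}

theorem paths_matched_total_le {x q : ℕ} (hx : x ≤ q) (h : MatchedBounds t j o₂ e d') :
    3 ^ q * d' + (1 + x) * o₂ + e ≤ threePow (3 * q + j) + excess (3 * q + j) := by
  have hexc := excess_le_three_mul_add q j
  have htot := h.total_le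
  rcases h.star_or_add_le with ⟨p, rfl, rfl, rfl, rfl⟩ | hle
  · have := star_star_total_le p hx
    rw [← mul_add, threePow_three_mul, excess_three_mul]
    lia
  · have hq := two_mul_succ_le_three_pow q
    rw [threePow_three_mul_add]
    generalize 3 ^ q = a at *
    obtain ⟨a, rfl⟩ := Nat.exists_eq_add_of_le' (by lia : 1 ≤ a)
    nlinarith

theorem GenericForcedBounds.star_total_le (h : GenericForcedBounds s i o₁ c d) (p : ℕ) :
    o₁ + (c + d) * 3 ^ p + c ≤ threePow (i + 3 + 3 * p) + excess (i + 3 + 3 * p) := by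
  have htot := h.total_le
  have hmax := h.max_le
  have hexc := excess_le_three_mul_add p (i + 3)
  have hp := two_mul_succ_le_three_pow p
  have := threePow_pos i
  rw [add_comm (i + 3), threePow_three_mul_add, threePow_add_three]
  generalize 3 ^ p = a at *
  obtain ⟨a, rfl⟩ := Nat.exists_eq_add_of_le' (by lia : 1 ≤ a)
  nlinarith

theorem GenericForcedBounds.matched_total_le (h₁ : GenericForcedBounds s i o₁ c d)
    (h₂ : MatchedBounds t j o₂ e d') (hle : o₂ + d' ≤ threePow j) :
    o₁ * d' + (c + d) * o₂ + c * e ≤ 3 * threePow i * threePow j := by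
  have he := h₂.isolated_le
  have hmax := h₁.max_le
  have hc := h₁.isolated_le
  have hi := threePow_pos i
  have hoc := h₁.avoiding_le
  generalize threePow i = C at *
  generalize threePow j = D at *
  rcases hoc with ho | ho
  · have := Nat.mul_le_mul_right d' ho
    nlinarith
  · have hod : (o₁ + 2 * c) * d' ≤ 3 * C * d' := Nat.mul_le_mul_right _ ho
    nlinarith

theorem ForcedBounds.matched_total_le (h₁ : ForcedBounds s i o₁ c d)
    (h₂ : MatchedBounds t j o₂ e d') :
    o₁ * d' + (c + d) * o₂ + c * e ≤ threePow (i + j) + excess (i + j) := by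
  cases h₁ with
  | paths p h hj ho hc =>
    subst hj ho hc
    simpa only [one_mul] using paths_matched_total_le (Nat.le_add_right d p) h₂
  | general n hj h =>
    subst hj
    rcases h₂.star_or_add_le with ⟨p, rfl, rfl, rfl, rfl⟩ | hle
    · simpa only [mul_one] using h.star_total_le p
    · refine (h.matched_total_le h₂ hle).trans ?_
      rw [← threePow_add_three]
      exact (threePow_mul_le _ _).trans (Nat.le_add_right _ _)

theorem ForcedBounds.join_matched_add_isolated_le (h₁ : ForcedBounds s i o₁ c d)
    (h₂ : MatchedBounds t j o₂ e d') :
    o₁ * d' + c * o₂ ≤ threePow (i + j) + threeInd (i + j) := by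
  cases h₁ with
  | paths p h hj ho hc =>
    subst hj ho hc
    generalize d + p = q
    have hq : 0 < 3 ^ q := by positivity
    rcases h₂.star_or_add_le with ⟨p, rfl, rfl, rfl, rfl⟩ | hle
    · have hp : 0 < 3 ^ p := by positivity
      rw [← mul_add, threePow_three_mul, threeInd_three_mul, pow_add]
      nlinarith
    · rw [threePow_three_mul_add]
      nlinarith
  | general n hj h =>
    subst hj
    refine le_trans ?_ ((threePow_mul_le _ _).trans (Nat.le_add_right _ _))
    rw [threePow_add_three]
    have hoc := h.avoiding_add_le
    have ho₂ := h₂.avoiding_le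
    have hd := h₂.matched_le
    nlinarith

theorem ForcedBounds.join_matched_shape (h₁ : ForcedBounds s i o₁ c d)
    (h₂ : MatchedBounds t j o₂ e d') (heq : o₁ * d' = threePow (i + j)) :
    ∃ p, IsBouquet {edge} d p (s.join t) ∧ i + j = 3 * (d + p) ∧ c * o₂ = 1 ∧
      d * o₂ + c * e = 1 + d := by
  obtain ⟨ho, hd⟩ := eq_and_eq_of_mul_le_mul h₁.avoiding_le h₂.matched_le h₁.avoiding_pos
    h₂.matched_pos ((threePow_mul_le i j).trans heq.ge)
  obtain ⟨p, hs, rfl, rfl⟩ := h₁.isBouquet_of_avoiding_eq ho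
  obtain ⟨rfl, rfl, rfl, rfl, rfl⟩ := h₂.eq_edge_of_matched_eq hd
  exact ⟨p, hs.join edge, rfl, rfl, by ring⟩

theorem ForcedBounds.join_matched (h₁ : ForcedBounds s i o₁ c d)
    (h₂ : MatchedBounds t j o₂ e d') :
    OptionalBounds (s.join t) (i + j) (o₁ * d') (c * o₂) (d * o₂ + c * e) where
  pos := Nat.mul_pos h₁.avoiding_pos h₂.matched_pos
  avoiding_le := (Nat.mul_le_mul h₁.avoiding_le h₂.matched_le).trans (threePow_mul_le i j)
  add_isolated_le := h₁.join_matched_add_isolated_le h₂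
  total_le := le_of_eq_of_le (by ring) (h₁.matched_total_le h₂)
  of_eq_zero h := by
    obtain ⟨rfl, rfl⟩ : i = 0 ∧ j = 0 := by lia
    obtain ⟨rfl, -, rfl, rfl, rfl⟩ :=
      h₂.eq_edge_of_matched_eq (le_antisymm h₂.matched_le h₂.matched_pos)
    rcases h₁.single_or with ⟨rfl, -, rfl, rfl, rfl⟩ | ⟨n, hn, -⟩
    · exact .inl ⟨rfl, rfl, rfl, rfl⟩
    · lia
  shape_of_mod_zero heq _ := by
    obtain ⟨p, h, hij, hc, hd⟩ := h₁.join_matched_shape h₂ heq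
    exact .inr ⟨d, p, h, hij, hc, hd⟩
  shape_of_mod_one heq hmod := by
    obtain ⟨p, -, hij, -⟩ := h₁.join_matched_shape h₂ heq
    lia

end ForcedMatched

section MatchedForced

variable {s t : BranchTree} {i j o₁ e d o₂ c d' : ℕ}

theorem MatchedBounds.join_forced_shape (h₁ : MatchedBounds s i o₁ e d)
    (h₂ : ForcedBounds t j o₂ c d') (heq : o₁ * (c + d') = threePow (i + j)) :
    (i + j) % 3 = 0 ∧ ∃ f p, IsBouquet {single, single} f p (s.join t) := by
  obtain ⟨ho, hm⟩ := eq_and_eq_of_mul_le_mul h₁.avoiding_le h₂.max_le h₁.avoiding_pos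
    (Nat.add_pos_left h₂.isolated_pos _) ((threePow_mul_le i j).trans heq.ge)
  obtain ⟨rfl, rfl, -⟩ := h₂.eq_single_of_max_eq hm
  obtain ⟨hi, f, p, hs⟩ := h₁.isBouquet_of_avoiding_eq ho
  exact ⟨hi, f, p, hs.join single⟩

theorem MatchedBounds.join_forced (h₁ : MatchedBounds s i o₁ e d)
    (h₂ : ForcedBounds t j o₂ c d') :
    OptionalBounds (s.join t) (i + j) (o₁ * (c + d')) 0 (d * o₂ + e * c) := by
  have hle : o₁ * (c + d') ≤ threePow (i + j) :=
    (Nat.mul_le_mul h₁.avoiding_le h₂.max_le).trans (threePow_mul_le i j)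
  exact
  { pos := Nat.mul_pos h₁.avoiding_pos (Nat.add_pos_left h₂.isolated_pos _)
    avoiding_le := hle
    add_isolated_le := hle.trans (Nat.le_add_right _ _)
    total_le := by
      rw [add_comm i j]
      exact le_of_eq_of_le (by ring) (h₂.matched_total_le h₁)
    of_eq_zero := fun h => by
      obtain ⟨rfl, rfl⟩ : i = 0 ∧ j = 0 := by lia
      obtain ⟨rfl, -, rfl, rfl, rfl⟩ :=
        h₁.eq_edge_of_matched_eq (le_antisymm h₁.matched_le h₁.matched_pos)
      rcases h₂.single_or with ⟨rfl, -, rfl, rfl, rfl⟩ | ⟨n, hn, -⟩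
      · exact .inr ⟨rfl, rfl, rfl, rfl⟩
      · lia
    shape_of_mod_zero := fun heq _ => .inl ⟨(h₁.join_forced_shape h₂ heq).2, rfl⟩
    shape_of_mod_one := fun heq hmod => by
      have := (h₁.join_forced_shape h₂ heq).1
      lia }

end MatchedForced

section MatchedMatched

variable {s t : BranchTree} {i j o₁ e₁ d₁ o₂ e₂ d₂ : ℕ}

theorem MatchedBounds.join_matched_total_le (h₁ : MatchedBounds s i o₁ e₁ d₁)
    (h₂ : MatchedBounds t j o₂ e₂ d₂) :
    o₁ * d₂ + d₁ * o₂ ≤ threePow (i + j + 1) + excess (i + j + 1) := by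
  have hle : threePow i * threePow j ≤ threePow (i + j + 1) :=
    (threePow_mul_le i j).trans (threePow_mono (Nat.le_succ _))
  have ho₁ := h₁.avoiding_le
  have hd₁ := h₁.matched_le
  have ho₂ := h₂.avoiding_le
  have hd₂ := h₂.matched_le
  rcases h₁.star_or_add_le with ⟨p, rfl, rfl, -, rfl⟩ | h
  · rcases h₂.star_or_add_le with ⟨q, rfl, rfl, -, rfl⟩ | h
    · have hp : 0 < 3 ^ p := by positivity
      have hq : 0 < 3 ^ q := by positivity
      rw [excess_of_mod_one (by lia)]
      rw [threePow_three_mul, threePow_three_mul] at *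
      nlinarith
    · nlinarith
  · nlinarith

theorem MatchedBounds.join_matched_shape (h₁ : MatchedBounds s i o₁ e₁ d₁)
    (h₂ : MatchedBounds t j o₂ e₂ d₂) (heq : o₁ * d₂ = threePow (i + j + 1)) :
    (i + j) % 3 = 0 ∧ ∃ f p, IsBouquet {single, edge} f p (s.join t) := by
  obtain ⟨ho, hd⟩ := eq_and_eq_of_mul_le_mul h₁.avoiding_le h₂.matched_le h₁.avoiding_pos
    h₂.matched_pos ((threePow_mul_le i j).trans ((threePow_mono (Nat.le_succ _)).trans heq.ge))
  obtain ⟨rfl, rfl, -⟩ := h₂.eq_edge_of_matched_eq hd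
  obtain ⟨hi, f, p, hs⟩ := h₁.isBouquet_of_avoiding_eq ho
  refine ⟨hi, f, p, ?_⟩
  rw [Multiset.pair_comm]
  exact hs.join edge

theorem MatchedBounds.join_matched (h₁ : MatchedBounds s i o₁ e₁ d₁)
    (h₂ : MatchedBounds t j o₂ e₂ d₂) :
    OptionalBounds (s.join t) (i + j + 1) (o₁ * d₂) 0 (d₁ * o₂) := by
  have hle : o₁ * d₂ ≤ threePow (i + j + 1) :=
    (Nat.mul_le_mul h₁.avoiding_le h₂.matched_le).trans
      ((threePow_mul_le i j).trans (threePow_mono (Nat.le_succ _)))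
  exact
  { pos := Nat.mul_pos h₁.avoiding_pos h₂.matched_pos
    avoiding_le := hle
    add_isolated_le := hle.trans (Nat.le_add_right _ _)
    total_le := h₁.join_matched_total_le h₂
    of_eq_zero := by lia
    shape_of_mod_zero := fun heq _ => by
      have := (h₁.join_matched_shape h₂ heq).1
      lia
    shape_of_mod_one := fun heq _ _ => (h₁.join_matched_shape h₂ heq).2 }

end MatchedMatched

theorem mul_add_mul_add_mul_le {b₁ c₁ b₂ c₂ A B : ℕ} (h₁ : b₁ + c₁ ≤ A) (h₂ : b₂ + c₂ ≤ B) :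
    c₁ * c₂ + b₁ * B + A * b₂ ≤ A * B + b₁ * b₂ := by
  obtain ⟨u, rfl⟩ := Nat.exists_eq_add_of_le h₁
  obtain ⟨v, rfl⟩ := Nat.exists_eq_add_of_le h₂
  nlinarith

namespace OptionalBounds

section JoinMatched

variable {s t : BranchTree} {i j b c d o e d' : ℕ}

theorem join_matched (h₁ : OptionalBounds s i b c d) (h₂ : MatchedBounds t j o e d') :
    OptionalBounds (s.join t) (i + j + 2) (b * d') 0 0 := by
  have hle : b * d' ≤ threePow (i + j) :=
    (Nat.mul_le_mul h₁.avoiding_le h₂.matched_le).trans (threePow_mul_le i j)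
  have hle' := hle.trans (threePow_mono (Nat.le_add_right _ 2))
  exact
  { pos := Nat.mul_pos h₁.pos h₂.matched_pos
    avoiding_le := hle'
    add_isolated_le := hle'.trans (Nat.le_add_right _ _)
    total_le := hle'.trans (Nat.le_add_right _ _)
    of_eq_zero := by lia
    shape_of_mod_zero := fun heq hmod =>
      absurd (hle.trans_lt (threePow_lt (by lia))) heq.not_lt
    shape_of_mod_one := by lia }

end JoinMatched

section JoinForced

variable {s t : BranchTree} {i j b c d o c' d' : ℕ}

theorem join_forced_total_le (h₁ : OptionalBounds s i b c d) (h₂ : ForcedBounds t j o c' d') :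
    b * (c' + d') + c * c' ≤ threePow (i + j + 1) + excess (i + j + 1) := by
  rcases h₂.single_or with ⟨-, rfl, -, rfl, rfl⟩ | ⟨n, rfl, hc', hcd'⟩
  · simpa only [add_zero, mul_one] using
      h₁.add_isolated_le.trans (threePow_add_threeInd_le i)
  · have hn := threePow_pos n
    have hi := threePow_pos i
    calc b * (c' + d') + c * c' ≤ threePow i * (3 * threePow n) := by
          have hb := h₁.avoiding_le
          have hbc := Nat.mul_le_mul_right (threePow n) h₁.add_isolated_le_succ
          nlinarith
      _ ≤ threePow (i + n + 3) := threePow_mul_three_le i n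
      _ ≤ threePow (i + (n + 3) + 1) := threePow_mono (by lia)
      _ ≤ _ := Nat.le_add_right _ _

theorem join_forced (h₁ : OptionalBounds s i b c d) (h₂ : ForcedBounds t j o c' d') :
    OptionalBounds (s.join t) (i + j + 1) (b * (c' + d')) 0 (c * c') := by
  have hm : 0 < c' + d' := Nat.add_pos_left h₂.isolated_pos _
  have hle : b * (c' + d') ≤ threePow (i + j) :=
    (Nat.mul_le_mul h₁.avoiding_le h₂.max_le).trans (threePow_mul_le i j)
  have hle' := hle.trans (threePow_mono (Nat.le_add_right _ 1))
  exact
  { pos := Nat.mul_pos h₁.pos hm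
    avoiding_le := hle'
    add_isolated_le := hle'.trans (Nat.le_add_right _ _)
    total_le := h₁.join_forced_total_le h₂
    of_eq_zero := by lia
    shape_of_mod_zero := fun heq hmod =>
      absurd (hle.trans_lt (threePow_lt (by lia))) heq.not_lt
    shape_of_mod_one := fun heq hmod hd => by
      obtain ⟨hb, hcd⟩ := eq_and_eq_of_mul_le_mul h₁.avoiding_le h₂.max_le h₁.pos hm
        ((threePow_mul_le i j).trans ((threePow_mono (Nat.le_succ _)).trans heq.ge))
      obtain ⟨rfl, rfl, -⟩ := h₂.eq_single_of_max_eq hcd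
      rcases h₁.shape_of_mod_zero hb (by lia) with ⟨-, rfl⟩ | ⟨e, p, hs, -⟩
      · lia
      · exact ⟨e, p, hs.join single⟩ }

end JoinForced

section JoinOptional

variable {s t : BranchTree} {i j b₁ c₁ d₁ b₂ c₂ d₂ : ℕ}

theorem join_optional_add_isolated_le (h₁ : OptionalBounds s i b₁ c₁ d₁)
    (h₂ : OptionalBounds t j b₂ c₂ d₂) :
    b₁ * (b₂ + c₂ + d₂) + c₁ * b₂ ≤ threePow (i + j + 3) + threeInd (i + j + 3) := by
  by_cases hj : j = 0
  · subst hj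
    obtain ⟨rfl, h, -⟩ := h₂.counts_of_zero
    have := h₁.add_isolated_le
    have := h₁.avoiding_le
    rw [add_zero, threePow_add_three, threeInd_add_three, add_assoc 1 c₂ d₂, h]
    lia
  · refine le_trans ?_ ((threePow_mul_three_le i j).trans (Nat.le_add_right _ _))
    have := threePow_pos i
    have := h₁.add_isolated_le_succ
    have := h₁.avoiding_le
    have := h₂.total_le_two_mul hj
    have := h₂.avoiding_le
    nlinarith

theorem join_optional_total_le_of_ne_zero (h₁ : OptionalBounds s i b₁ c₁ d₁)
    (h₂ : OptionalBounds t j b₂ c₂ d₂) (hi : i ≠ 0) (hj : j ≠ 0) :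
    b₁ * (b₂ + c₂ + d₂) + c₁ * b₂ + (d₁ * b₂ + c₁ * c₂) ≤
      threePow i * (3 * threePow j) + threeInd i * threeInd j := by
  have hcc := mul_add_mul_add_mul_le h₁.add_isolated_le h₂.add_isolated_le
  have hb₁ := h₁.avoiding_le
  have hb₂ := h₂.avoiding_le
  have hm₁ := h₁.total_le
  have hm₂ := h₂.total_le
  have hi := excess_le_threePow hi
  have hj := excess_le_threePow hj
  obtain ⟨x₁, hx₁⟩ := Nat.exists_eq_add_of_le (threeInd_le_excess i)
  obtain ⟨x₂, hx₂⟩ := Nat.exists_eq_add_of_le (threeInd_le_excess j)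
  rw [hx₁] at hm₁ hi
  rw [hx₂] at hm₂ hj
  nlinarith

theorem join_optional_total_le (h₁ : OptionalBounds s i b₁ c₁ d₁)
    (h₂ : OptionalBounds t j b₂ c₂ d₂) :
    b₁ * (b₂ + c₂ + d₂) + c₁ * b₂ + (d₁ * b₂ + c₁ * c₂) ≤
      threePow (i + j + 3) + excess (i + j + 3) := by
  by_cases hj : j = 0
  · subst hj
    obtain ⟨rfl, h, h'⟩ := h₂.counts_of_zero
    have := excess_add_threeInd_le i
    have := Nat.mul_le_mul_left c₁ h'
    have := h₁.total_le
    have := h₁.add_isolated_le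
    have := h₁.avoiding_le
    rw [add_zero, threePow_add_three, add_assoc 1 c₂ d₂, h]
    lia
  by_cases hi : i = 0
  · subst hi
    obtain ⟨rfl, h, h'⟩ := h₁.counts_of_zero
    have := excess_add_threeInd_le j
    have := h₂.total_le
    have := h₂.add_isolated_le
    have := h₂.avoiding_le
    rw [zero_add, threePow_add_three]
    nlinarith
  · exact (h₁.join_optional_total_le_of_ne_zero h₂ hi hj).trans
      (Nat.add_le_add (threePow_mul_three_le i j) (threeInd_mul_le_excess i j))

theorem join_optional_eq (h₁ : OptionalBounds s i b₁ c₁ d₁) (h₂ : OptionalBounds t j b₂ c₂ d₂)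
    (heq : b₁ * (b₂ + c₂ + d₂) = threePow (i + j + 3)) : b₁ = threePow i ∧ j = 0 := by
  have hm : 0 < b₂ + c₂ + d₂ := Nat.add_pos_left (Nat.add_pos_left h₂.pos _) _
  obtain ⟨hb, hm⟩ := eq_and_eq_of_mul_le_mul h₁.avoiding_le h₂.total_le_three_mul h₁.pos hm
    ((threePow_mul_three_le i j).trans heq.ge)
  refine ⟨hb, by_contra fun hj => ?_⟩
  have := h₂.total_le_two_mul hj
  have := threePow_pos j
  lia

theorem join_optional_shape_of_mod_zero (h₁ : OptionalBounds s i b₁ c₁ d₁)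
    (h₂ : OptionalBounds t j b₂ c₂ d₂) (heq : b₁ * (b₂ + c₂ + d₂) = threePow (i + j + 3))
    (hmod : (i + j + 3) % 3 = 0) :
    ((∃ e p, IsBouquet {single, single} e p (s.join t)) ∧ c₁ * b₂ = 0) ∨
    ∃ e p, IsBouquet {edge} e p (s.join t) ∧ i + j + 3 = 3 * (e + p) ∧ c₁ * b₂ = 1 ∧
      d₁ * b₂ + c₁ * c₂ = 1 + e := by
  obtain ⟨hb, rfl⟩ := h₁.join_optional_eq h₂ heq
  obtain ⟨rfl, -⟩ := h₂.counts_of_zero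
  rcases h₁.shape_of_mod_zero hb (by lia) with ⟨⟨e, p, hs⟩, rfl⟩ | ⟨e, p, hs, hi, rfl, rfl⟩
  · obtain ⟨q, hq, -⟩ := h₂.isBouquet_join hs
    exact .inl ⟨⟨_, _, hq⟩, by simp⟩
  · obtain ⟨q, hq, hsum⟩ := h₂.isBouquet_join hs
    exact .inr ⟨_, _, hq, by lia, by simp, by ring⟩

theorem join_optional_shape_of_mod_one (h₁ : OptionalBounds s i b₁ c₁ d₁)
    (h₂ : OptionalBounds t j b₂ c₂ d₂) (heq : b₁ * (b₂ + c₂ + d₂) = threePow (i + j + 3))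
    (hmod : (i + j + 3) % 3 = 1) (hd : 0 < d₁ * b₂ + c₁ * c₂) :
    ∃ e p, IsBouquet {single, edge} e p (s.join t) := by
  obtain ⟨hb, rfl⟩ := h₁.join_optional_eq h₂ heq
  obtain ⟨rfl, -⟩ := h₂.counts_of_zero
  obtain rfl : c₁ = 0 := by
    have := h₁.add_isolated_le
    rw [threeInd_of_ne (by lia)] at this
    lia
  obtain ⟨e, p, hs⟩ := h₁.shape_of_mod_one hb (by lia) (by simpa using hd)
  obtain ⟨q, hq, -⟩ := h₂.isBouquet_join hs
  exact ⟨_, _, hq⟩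

theorem join_optional (h₁ : OptionalBounds s i b₁ c₁ d₁) (h₂ : OptionalBounds t j b₂ c₂ d₂) :
    OptionalBounds (s.join t) (i + j + 3) (b₁ * (b₂ + c₂ + d₂)) (c₁ * b₂)
      (d₁ * b₂ + c₁ * c₂) where
  pos := Nat.mul_pos h₁.pos (Nat.add_pos_left (Nat.add_pos_left h₂.pos _) _)
  avoiding_le :=
    (Nat.mul_le_mul h₁.avoiding_le h₂.total_le_three_mul).trans (threePow_mul_three_le i j)
  add_isolated_le := h₁.join_optional_add_isolated_le h₂
  total_le := h₁.join_optional_total_le h₂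
  of_eq_zero := by lia
  shape_of_mod_zero := h₁.join_optional_shape_of_mod_zero h₂
  shape_of_mod_one := h₁.join_optional_shape_of_mod_one h₂

end JoinOptional

end OptionalBounds

section ForcedForced

variable {s t : BranchTree} {i j o₁ c₁ d₁ o₂ c₂ d₂ : ℕ}

theorem GenericForcedBounds.join_paths_total_le (h : GenericForcedBounds s i o₁ c₁ d₁) {x p : ℕ}
    (hx : x ≤ p) :
    o₁ * (1 + x) + c₁ * 3 ^ p + c₁ ≤ threePow (i + 3 + 3 * p) + excess (i + 3 + 3 * p) := by
  have hp := two_mul_succ_le_three_pow p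
  have hc := h.isolated_le
  rw [add_comm (i + 3), threePow_three_mul_add, threePow_add_three]
  by_cases hp₀ : p = 0
  · subst hp₀
    obtain rfl : x = 0 := by lia
    have := h.total_le
    rw [mul_zero, zero_add]
    lia
  · refine le_trans ?_ (Nat.le_add_right _ _)
    have ha : 2 * (x + 1) ≤ 3 ^ p + 1 := by lia
    have ha' : 3 ≤ 3 ^ p := by lia
    generalize 3 ^ p = a at *
    rcases h.avoiding_le with ho | ho
    · have := Nat.mul_le_mul_right (a + 1) ho
      nlinarith
    · have := Nat.mul_le_mul_right (a + 1) ho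
      nlinarith

theorem GenericForcedBounds.join_generic_total_le (h₁ : GenericForcedBounds s i o₁ c₁ d₁)
    (h₂ : GenericForcedBounds t j o₂ c₂ d₂) :
    o₁ * (c₂ + d₂) + c₁ * o₂ + c₁ * c₂ ≤ 3 * threePow i * (3 * threePow j) := by
  have hc₁ := h₁.isolated_le
  have hm₂ := h₂.max_le
  have hoc₂ := h₂.avoiding_add_le
  have hj := threePow_pos j
  rcases h₁.avoiding_le with ho | ho
  · have := Nat.mul_le_mul_right (threePow j) ho
    nlinarith
  · have := Nat.mul_le_mul_right (threePow j) ho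
    nlinarith

theorem ForcedBounds.join_forced_total_le (h₁ : ForcedBounds s i o₁ c₁ d₁)
    (h₂ : ForcedBounds t j o₂ c₂ d₂) :
    o₁ * (c₂ + d₂) + c₁ * o₂ + c₁ * c₂ ≤ threePow (i + j) + excess (i + j) := by
  cases h₁ with
  | paths p₁ h₁ hi ho₁ hc₁ =>
    subst hi ho₁ hc₁
    cases h₂ with
    | paths p₂ h₂ hj ho₂ hc₂ =>
      subst hj ho₂ hc₂
      have := star_star_total_le (d₁ + p₁) (Nat.le_add_right d₂ p₂)
      rw [← mul_add, threePow_three_mul, excess_three_mul, add_comm (d₁ + p₁) (d₂ + p₂)]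
      lia
    | general n hj h₂ =>
      subst hj
      rw [add_comm (3 * _)]
      exact le_of_eq_of_le (by ring) (h₂.star_total_le (d₁ + p₁))
  | general m hi h₁ =>
    subst hi
    cases h₂ with
    | paths p₂ h₂ hj ho₂ hc₂ =>
      subst hj ho₂ hc₂
      simpa only [mul_one] using h₁.join_paths_total_le (Nat.le_add_right d₂ p₂)
    | general n hj h₂ =>
      subst hj
      refine (h₁.join_generic_total_le h₂).trans ?_
      rw [← threePow_add_three, ← threePow_add_three]
      exact (threePow_mul_le _ _).trans (Nat.le_add_right _ _)

theorem ForcedBounds.join_forced_shape (h₁ : ForcedBounds s i o₁ c₁ d₁)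
    (h₂ : ForcedBounds t j o₂ c₂ d₂) :
    (∃ f p, IsBouquet {single} f p (s.join t) ∧ i + j = 3 * (f + p) ∧
      o₁ * (c₂ + d₂) = 3 ^ (f + p) ∧ c₁ * o₂ = 1 ∧ c₁ * c₂ = 1) ∨
    o₁ * (c₂ + d₂) + c₁ * c₂ ≤ threePow (i + j) := by
  rcases h₂.single_or with ⟨rfl, rfl, rfl, rfl, rfl⟩ | ⟨n, rfl, hc₂, hm₂⟩
  · cases h₁ with
    | paths p h₁ hi ho₁ hc₁ =>
      subst hi ho₁ hc₁
      exact .inl ⟨d₁, p, h₁.join single, rfl, by ring, rfl, rfl⟩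
    | general m hi h₁ =>
      have := h₁.avoiding_add_le
      rw [hi, add_zero, threePow_add_three]
      lia
  · right
    have hn := threePow_pos n
    refine le_trans ?_ (threePow_mul_le i (n + 3))
    rw [threePow_add_three]
    rcases h₁.single_or with ⟨-, rfl, rfl, rfl, rfl⟩ | ⟨m, rfl, hc₁, -⟩
    · rw [threePow_zero]
      lia
    · have hm := threePow_pos m
      have ho₁ := h₁.avoiding_le
      rw [threePow_add_three] at ho₁ ⊢
      nlinarith

theorem ForcedBounds.join_forced (h₁ : ForcedBounds s i o₁ c₁ d₁)
    (h₂ : ForcedBounds t j o₂ c₂ d₂) :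
    MatchedBounds (s.join t) (i + j) (o₁ * (c₂ + d₂)) (c₁ * o₂) (c₁ * c₂) where
  avoiding_pos := Nat.mul_pos h₁.avoiding_pos (Nat.add_pos_left h₂.isolated_pos _)
  matched_pos := Nat.mul_pos h₁.isolated_pos h₂.isolated_pos
  isolated_le := (Nat.mul_le_mul ((Nat.le_add_right _ _).trans h₁.max_le) h₂.avoiding_le).trans
    (threePow_mul_le i j)
  total_le := h₁.join_forced_total_le h₂
  shape := h₁.join_forced_shape h₂

end ForcedForced

section MatchedOptional

variable {s t : BranchTree} {i j o e d b c d' : ℕ}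

theorem MatchedBounds.join_optional_zero (h₁ : MatchedBounds s i o e d)
    (h₂ : OptionalBounds t 0 b c d') :
    MatchedBounds (s.join t) (i + 3) (o * (b + c + d')) (e * b) (d * b) := by
  obtain ⟨rfl, h, -⟩ := h₂.counts_of_zero
  have ho := h₁.avoiding_pos
  have hd := h₁.matched_pos
  have he := h₁.isolated_le
  have htot := h₁.total_le
  have hexc := excess_add_threeInd_le i
  rw [add_assoc 1 c d', h, mul_one, mul_one]
  refine ⟨by lia, hd, by rw [threePow_add_three]; lia, ?_, ?_⟩
  · rw [threePow_add_three]
    rcases h₁.star_or_add_le with ⟨q, rfl, rfl, rfl, rfl⟩ | hle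
    · rw [threeInd_three_mul] at hexc
      rw [threePow_three_mul] at *
      lia
    · lia
  · rcases h₁.shape with ⟨f, p, hs, rfl, rfl, rfl, rfl⟩ | hle
    · obtain ⟨q, hq, hsum⟩ := h₂.isBouquet_join hs
      exact .inl ⟨_, _, hq, by lia, by rw [hsum, pow_succ], rfl, rfl⟩
    · rw [threePow_add_three]
      exact .inr (by lia)

theorem MatchedBounds.join_optional_total_le (h₁ : MatchedBounds s i o e d)
    (h₂ : OptionalBounds t j b c d') (hj : j ≠ 0) :
    o * (b + c + d') + e * b + d * b ≤ threePow (i + j + 3) + excess (i + j + 3) := by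
  have hm := h₂.total_le_two_mul hj
  have hb := h₂.avoiding_le
  by_cases hi : i = 0
  · subst hi
    have hm' := h₂.total_le
    have hexc := excess_add_threeInd_le j
    have he := h₁.isolated_le
    have hd := h₁.matched_le
    have ho := h₁.avoiding_le
    rw [threePow_zero] at *
    rw [zero_add, threePow_add_three]
    nlinarith
  · refine le_trans ?_ ((threePow_mul_three_le i j).trans (Nat.le_add_right _ _))
    have he := h₁.isolated_le
    rcases h₁.star_or_add_le with ⟨q, rfl, rfl, rfl, rfl⟩ | hle
    · have hq := two_mul_succ_le_three_pow q
      rw [threePow_three_mul] at *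
      have : 3 ≤ 3 ^ q := by lia
      nlinarith
    · have := Nat.mul_le_mul_right (threePow j) he
      nlinarith

theorem MatchedBounds.join_optional_of_ne_zero (h₁ : MatchedBounds s i o e d)
    (h₂ : OptionalBounds t j b c d') (hj : j ≠ 0) :
    MatchedBounds (s.join t) (i + j + 3) (o * (b + c + d')) (e * b) (d * b) where
  avoiding_pos := Nat.mul_pos h₁.avoiding_pos (Nat.add_pos_left (Nat.add_pos_left h₂.pos _) _)
  matched_pos := Nat.mul_pos h₁.matched_pos h₂.pos
  isolated_le := (Nat.mul_le_mul h₁.isolated_le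
    (h₂.avoiding_le.trans (Nat.le_mul_of_pos_left _ three_pos))).trans (threePow_mul_three_le i j)
  total_le := h₁.join_optional_total_le h₂ hj
  shape := by
    refine .inr (le_trans ?_ (threePow_mul_three_le i j))
    have ho := h₁.avoiding_le
    have hd := h₁.matched_le
    have hm := h₂.total_le_two_mul hj
    have hb := h₂.avoiding_le
    nlinarith

theorem MatchedBounds.join_optional (h₁ : MatchedBounds s i o e d)
    (h₂ : OptionalBounds t j b c d') :
    MatchedBounds (s.join t) (i + j + 3) (o * (b + c + d')) (e * b) (d * b) := by
  by_cases hj : j = 0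
  · subst hj
    exact h₁.join_optional_zero h₂
  · exact h₁.join_optional_of_ne_zero h₂ hj

end MatchedOptional

namespace GenericForcedBounds

variable {t : BranchTree} {i o c d : ℕ}

theorem of_three_mul (ho : 0 < o) (hc : 0 < c) (hc' : c ≤ threePow i)
    (hcd : c + d ≤ threePow i + 1) (hoc : o + 2 * c ≤ 3 * threePow i)
    (htot : o + 2 * c + d ≤ 3 * threePow i + 1)
    (htot' : i % 3 = 2 → o + 2 * c + d ≤ 3 * threePow i) : GenericForcedBounds t i o c d := by
  refine ⟨ho, hc, hc', hcd, by lia, .inr hoc, ?_, .inr ⟨hoc, htot, htot'⟩⟩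
  unfold excess
  split_ifs <;> lia

theorem of_le {B : ℕ} (ho : 0 < o) (hc : 0 < c) (hB : B ≤ threePow i) (hcd : c + d ≤ B)
    (htot : o + 2 * c + d ≤ 3 * B) : GenericForcedBounds t i o c d :=
  of_three_mul ho hc (by lia) (by lia) (by lia) (by lia) fun _ => by lia

end GenericForcedBounds

theorem OptionalBounds.generic_join_single {t : BranchTree} {j b c d : ℕ}
    (h : OptionalBounds t j b c d) (hj : j ≠ 0) :
    GenericForcedBounds (single.join t) j (b + c + d) b c where
  avoiding_pos := Nat.add_pos_left (Nat.add_pos_left h.pos _) _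
  isolated_pos := h.pos
  isolated_le := h.avoiding_le
  max_le := h.add_isolated_le_succ
  avoiding_add_le := by
    have := h.total_le_two_mul hj
    have := h.avoiding_le
    lia
  avoiding_le := .inl (h.total_le_two_mul hj)
  total_le := by
    have := h.avoiding_le
    have := h.add_isolated_le
    have := h.total_le
    have := excess_add_threeInd_le j
    lia
  shape := .inl ⟨t, b, c, d, rfl, h, hj, rfl, rfl, rfl⟩

section JoinOptional

variable {s t : BranchTree} {i j b₁ c₁ d₁ b₂ c₂ d₂ o c d : ℕ}

theorem OptionalBounds.two_branches_total_le (h₁ : OptionalBounds s i b₁ c₁ d₁)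
    (h₂ : OptionalBounds t j b₂ c₂ d₂) (hi : i ≠ 0) :
    (b₁ + c₁ + d₁) * (b₂ + c₂ + d₂) + 2 * (b₁ * b₂) + (c₁ * b₂ + b₁ * c₂) ≤
      3 * (3 * (threePow i * threePow j)) + 1 := by
  have hm := Nat.mul_le_mul (h₁.total_le_two_mul hi) h₂.total_le_three_mul
  have hbc := Nat.mul_le_mul h₁.avoiding_le h₂.add_isolated_le_succ
  have hcb := Nat.mul_le_mul h₁.add_isolated_le_succ h₂.avoiding_le
  have hadd : threePow i + threePow j ≤ threePow i * threePow j + 1 := by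
    obtain ⟨x, hx⟩ := Nat.exists_eq_add_of_le' (threePow_pos i)
    obtain ⟨y, hy⟩ := Nat.exists_eq_add_of_le' (threePow_pos j)
    rw [hx, hy]
    linarith [Nat.zero_le (x * y)]
  linarith

theorem OptionalBounds.two_branches_total_le_of_mod_two (h₁ : OptionalBounds s i b₁ c₁ d₁)
    (h₂ : OptionalBounds t j b₂ c₂ d₂) (hi : i ≠ 0) (hmod : (i + j) % 3 = 2) :
    (b₁ + c₁ + d₁) * (b₂ + c₂ + d₂) + 2 * (b₁ * b₂) + (c₁ * b₂ + b₁ * c₂) ≤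
      3 * (3 * (threePow i * threePow j)) := by
  have hm₁ := h₁.total_le_two_mul hi
  have hm : (b₁ + c₁ + d₁) * (b₂ + c₂ + d₂) ≤ 4 * (threePow i * threePow j) := by
    obtain hi | hj | hj : i % 3 = 2 ∨ j % 3 = 2 ∨ j ≠ 0 := by lia
    · have := h₁.total_le
      rw [excess_of_mod_two hi, add_zero] at this
      linarith [Nat.mul_le_mul this h₂.total_le_three_mul, Nat.zero_le (threePow i * threePow j)]
    · have := h₂.total_le
      rw [excess_of_mod_two hj, add_zero] at this
      linarith [Nat.mul_le_mul hm₁ this, Nat.zero_le (threePow i * threePow j)]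
    · linarith [Nat.mul_le_mul hm₁ (h₂.total_le_two_mul hj)]
  have hbc := Nat.mul_le_mul h₁.avoiding_le h₂.add_isolated_le_succ
  have hcb := Nat.mul_le_mul h₁.add_isolated_le_succ h₂.avoiding_le
  have hi := Nat.mul_le_mul_left (threePow i) (threePow_pos j)
  have hj := Nat.mul_le_mul_right (threePow j) (threePow_pos i)
  linarith

theorem OptionalBounds.generic_join_paths {q x : ℕ} (h : OptionalBounds t j b₂ c₂ d₂)
    (hj : j ≠ 0) (hq : q ≠ 0) (hx : x ≤ q) :
    GenericForcedBounds s (3 * q + j) (3 ^ q * (b₂ + c₂ + d₂)) b₂ (x * b₂ + c₂) := by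
  have hb := h.pos
  have hb' := h.avoiding_le
  have hbc := h.add_isolated_le_succ
  have hm := h.total_le_two_mul hj
  have hq' := two_mul_succ_le_three_pow q
  have hq₃ : 3 ≤ 3 ^ q := by lia
  refine .of_three_mul (Nat.mul_pos (by lia) (by lia)) hb ?_ ?_ ?_ ?_ fun hmod => ?_ <;>
    rw [threePow_three_mul_add]
  · nlinarith
  · nlinarith
  · nlinarith
  · nlinarith
  · have hm' := h.total_le
    rw [excess_of_mod_two (by lia), add_zero] at hm'
    nlinarith

theorem GenericForcedBounds.join_optional (h₁ : GenericForcedBounds s i o c d)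
    (h₂ : OptionalBounds t j b₂ c₂ d₂) :
    GenericForcedBounds (s.join t) (i + j + 3) (o * (b₂ + c₂ + d₂)) (c * b₂)
      (d * b₂ + c * c₂) := by
  have hb := h₂.avoiding_le
  have hle : 3 * (threePow i * threePow j) ≤ threePow (i + j + 3) :=
    le_of_eq_of_le (by ring) (threePow_mul_three_le i j)
  have ho : 0 < o * (b₂ + c₂ + d₂) :=
    Nat.mul_pos h₁.avoiding_pos (Nat.add_pos_left (Nat.add_pos_left h₂.pos _) _)
  have hc : 0 < c * b₂ := Nat.mul_pos h₁.isolated_pos h₂.pos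
  have hcd : c * b₂ + (d * b₂ + c * c₂) ≤ 3 * (threePow i * threePow j) := by
    have := h₁.isolated_le
    have := h₁.max_le
    have := h₂.add_isolated_le_succ
    have := threePow_pos i
    have := threePow_pos j
    nlinarith
  rcases h₁.shape with ⟨a, b, c', d', -, ha, hi, rfl, rfl, rfl⟩ | ⟨hoc, htot, -⟩
  · have htot := ha.two_branches_total_le h₂ hi
    have htot' := ha.two_branches_total_le_of_mod_two h₂ hi
    have hm := Nat.mul_le_mul (ha.total_le_two_mul hi) h₂.total_le_three_mul
    have hbb := Nat.mul_le_mul ha.avoiding_le hb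
    exact .of_three_mul ho hc (by lia) (by lia) (by linarith) (by lia)
      fun hmod => by have := htot' (by lia); lia
  · have hc₁ := h₁.isolated_pos
    have hm := Nat.mul_le_mul_left (o + c) h₂.total_le_three_mul
    have hcd' := Nat.mul_le_mul_left (c + d) hb
    have hoc' : (3 * o + 4 * c + d) * threePow j ≤ 9 * threePow i * threePow j :=
      Nat.mul_le_mul_right _ (by lia)
    exact .of_le ho hc hle hcd (by linarith [Nat.zero_le (c * d₂)])

theorem ForcedBounds.join_optional (h₁ : ForcedBounds s i o c d)
    (h₂ : OptionalBounds t j b₂ c₂ d₂) :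
    ForcedBounds (s.join t) (i + j + 3) (o * (b₂ + c₂ + d₂)) (c * b₂) (d * b₂ + c * c₂) := by
  cases h₁ with
  | paths p h hi ho hc =>
    subst hi ho hc
    by_cases hj : j = 0
    · subst hj
      obtain ⟨rfl, h0, -⟩ := h₂.counts_of_zero
      obtain ⟨q, hq, hsum⟩ := h₂.isBouquet_join h
      simp only [mul_one, one_mul]
      exact .paths q hq (by lia) (by rw [add_assoc 1, h0, hsum, pow_succ]) rfl
    · by_cases hq : d + p = 0
      · obtain ⟨rfl, rfl⟩ : d = 0 ∧ p = 0 := by lia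
        obtain rfl : s = single := branches_eq_zero_iff.1 (by simpa [IsBouquet] using h)
        simpa using ForcedBounds.general j rfl (h₂.generic_join_single hj)
      · simp only [one_mul]
        exact .general _ rfl (h₂.generic_join_paths hj hq (Nat.le_add_right d p))
  | general n hi h =>
    subst hi
    exact .general _ (by lia) (h.join_optional h₂)

end JoinOptional

/-- The inductive bounds for the counts of a tree. -/
def BranchTree.Bounds (t : BranchTree) : Prop :=
  match t.counts with
  | .optional b c d => ∃ j, t.order = j + 3 ∧ OptionalBounds t j b c d
  | .forced o c d => ∃ j, t.order = j + 1 ∧ ForcedBounds t j o c d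
  | .matched o e d => ∃ j, t.order = j + 2 ∧ MatchedBounds t j o e d

theorem BranchTree.bounds (t : BranchTree) : t.Bounds := by
  induction t with
  | single => exact ⟨0, rfl, forcedBounds_single⟩
  | join s t ihs iht =>
    unfold BranchTree.Bounds at *
    simp only [BranchTree.counts, BranchTree.order]
    cases hs : s.counts <;> cases ht : t.counts <;> rw [hs] at ihs <;> rw [ht] at iht <;>
    obtain ⟨i, hi, ihs⟩ := ihs <;> obtain ⟨j, hj, iht⟩ := iht <;>
    rw [hi, hj]
    · exact ⟨_, by ring, ihs.join_optional iht⟩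
    · exact ⟨_, by ring, ihs.join_forced iht⟩
    · exact ⟨_, by ring, ihs.join_matched iht⟩
    · exact ⟨_, by ring, ihs.join_optional iht⟩
    · exact ⟨_, by ring, ihs.join_forced iht⟩
    · exact ⟨_, by ring, ihs.join_matched iht⟩
    · exact ⟨_, by ring, ihs.join_optional iht⟩
    · exact ⟨_, by ring, ihs.join_forced iht⟩
    · exact ⟨_, by ring, ihs.join_matched iht⟩

/-! ### Bounds for potted graphs -/

/-- The number of maximum dissociation sets of a potted graph with a cycle of order `3 * t + 2` and
a tree with the given root counts at a vertex of the cycle. -/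
def RootCounts.pottedCount (t : ℕ) : RootCounts → ℕ
  | optional b _ _ => (t + 1) * b
  | forced o c d => (t + 1) * o + (2 * t + 1) * c + d
  | matched o _ d => (t + 1) * o + d

section PottedCount

open RootCounts

variable {T : BranchTree} {i j o b c d e s t N : ℕ}

theorem pottedCount_forced_le (hc : 0 < c) (h₁ : o + 2 * c ≤ N) (h₂ : o + 2 * c + d ≤ N + 1) :
    (forced o c d).pottedCount t ≤ (t + 1) * N := by
  simp only [pottedCount]
  nlinarith

theorem pottedCount_forced_lt (hc : 0 < c) (h : o + 2 * c + d ≤ N) :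
    (forced o c d).pottedCount t < (t + 1) * N := by
  simp only [pottedCount]
  nlinarith

theorem pottedCount_matched_lt (e : ℕ) (ht : 1 ≤ t) (hd : 0 < d) (h : o + d ≤ N) :
    (matched o e d).pottedCount t < (t + 1) * N := by
  simp only [pottedCount]
  nlinarith

theorem GenericForcedBounds.pottedCount_lt_of_mod_two (h : GenericForcedBounds T i o c d)
    (hi : i % 3 = 2) :
    (forced o c d).pottedCount t < (t + 1) * (3 * threePow i) := by
  have hc := h.isolated_pos
  rcases h.shape with ⟨a, b, c', d', -, ha, -, rfl, rfl, rfl⟩ | ⟨-, -, hoc⟩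
  · have htot := Nat.mul_le_mul_left (t + 1) ha.total_le
    have hadd := Nat.mul_le_mul_left (2 * t + 1) ha.add_isolated_le
    rw [excess_of_mod_two hi] at htot
    rw [threeInd_of_ne (by lia)] at hadd
    have hd : 0 ≤ t * d := Nat.zero_le _
    have hP := threePow_pos i
    simp only [pottedCount]
    linarith
  · exact pottedCount_forced_lt hc (hoc hi)

theorem GenericForcedBounds.pottedCount_of_mod_one (h : GenericForcedBounds T i o c d)
    (ht : 1 ≤ t) (hi : i % 3 = 1) :
    ((forced o c d).pottedCount t = (3 * t + 2) * threePow i + (t + 1) ∧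
      ∃ a e p, T = join single a ∧ IsBouquet {single, edge} e p a) ∨
    (forced o c d).pottedCount t < (t + 1) * (3 * threePow i) + 1 ∨
    (forced o c d).pottedCount t < (3 * t + 2) * threePow i + (t + 1) := by
  have hc := h.isolated_pos
  rcases h.shape with ⟨a, b, c', d', hT, ha, -, rfl, rfl, rfl⟩ | ⟨hoc, htot, -⟩
  · have htot := ha.total_le
    have hadd := ha.add_isolated_le
    rw [excess_of_mod_one hi] at htot
    rw [threeInd_of_ne (by lia), add_zero] at hadd
    simp only [pottedCount]
    obtain hlt | ⟨hcP, rfl⟩ : c < threePow i ∨ c = threePow i ∧ d = 0 := by lia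
    · right; right
      have hm := Nat.mul_le_mul_left (t + 1) htot
      have hc' := Nat.mul_lt_mul_of_pos_left hlt (by lia : 0 < 2 * t)
      linarith
    · obtain rfl | hd := Nat.eq_zero_or_pos d'
      · right; right
        rw [hcP]
        lia
      · obtain rfl : d' = 1 := by lia
        obtain ⟨e, p, hb⟩ := ha.shape_of_mod_one hcP hi hd
        exact .inl ⟨by rw [hcP]; ring, a, e, p, hT, hb⟩
  · exact .inr (.inl (Nat.lt_succ_of_le (pottedCount_forced_le hc hoc htot)))

theorem GenericForcedBounds.pottedCount_of_three_mul
    (h : GenericForcedBounds T (3 * s) o c d) (ht : 1 ≤ t) :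
    ((forced o c d).pottedCount t = (t + 1) * (3 ^ s + s + 2) + (2 * t + 1) * 3 ^ s + 1 ∧
      ∃ a, T = join single a ∧ IsBouquet {edge} s 0 a) ∨
    (forced o c d).pottedCount t < (t + 1) * 3 ^ (s + 1) + (2 * t + 1) + (s + 1) ∨
    (forced o c d).pottedCount t < (t + 1) * (3 ^ s + s + 2) + (2 * t + 1) * 3 ^ s + 1 := by
  have hc := h.isolated_pos
  rcases h.shape with ⟨a, b, c', d', hT, ha, -, rfl, rfl, rfl⟩ | ⟨hoc, htot, -⟩
  · have htot := ha.total_le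
    have hadd := ha.add_isolated_le
    have hm := Nat.mul_le_mul_left (t + 1) htot
    have hcP := ha.avoiding_le
    have hshape := ha.shape_of_mod_zero
    rw [threeInd_three_mul] at hadd
    rw [excess_three_mul] at htot hm
    simp only [threePow_three_mul] at hm hcP hadd hshape
    simp only [pottedCount]
    obtain hlt | heq := hcP.lt_or_eq
    · right; right
      have hc' := Nat.mul_lt_mul_of_pos_left hlt (by lia : 0 < 2 * t)
      linarith
    · rcases hshape heq (by lia) with ⟨-, rfl⟩ | ⟨e, p, hb, hs, rfl, rfl⟩
      · right; right
        rw [← heq] at hm ⊢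
        linarith
      · obtain rfl | hp := Nat.eq_zero_or_pos p
        · obtain rfl : e = s := by lia
          exact .inl ⟨by rw [heq]; ring, a, hT, hb⟩
        · right; right
          have := Nat.mul_lt_mul_of_pos_left (by lia : e < s) (by lia : 0 < t + 1)
          rw [heq]
          linarith
  · have := pottedCount_forced_le (t := t) hc hoc htot
    rw [threePow_three_mul] at this
    exact .inr (.inl (by rw [pow_succ']; lia))

theorem BranchTree.pottedCount_le_of_mod_two (T : BranchTree) (ht : 1 ≤ t)
    (hT : T.order = 3 * s + 3) :
    T.counts.pottedCount t ≤ (t + 1) * 3 ^ s ∧ (T.counts.pottedCount t = (t + 1) * 3 ^ s →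
      ∃ e p, IsBouquet {edge} e p T ∨ IsBouquet {single, single} e p T) := by
  have of_lt {w N : ℕ} {P : Prop} (h : w < N) : w ≤ N ∧ (w = N → P) :=
    ⟨h.le, fun h' => absurd h' h.ne⟩
  have hb := T.bounds
  unfold BranchTree.Bounds at hb
  cases hc : T.counts <;> rw [hc] at hb <;> obtain ⟨j, hj, h⟩ := hb
  case optional =>
    obtain rfl : j = 3 * s := by lia
    have hle := h.avoiding_le
    have hshape := h.shape_of_mod_zero
    rw [threePow_three_mul] at hle hshape
    simp only [pottedCount]
    refine ⟨Nat.mul_le_mul_left _ hle, fun heq => ?_⟩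
    rcases hshape (Nat.eq_of_mul_eq_mul_left (by lia) heq) (by lia) with
      ⟨⟨e, p, hb⟩, -⟩ | ⟨e, p, hb, -⟩
    exacts [⟨e, p, .inr hb⟩, ⟨e, p, .inl hb⟩]
  case forced =>
    cases h with
    | paths p _ h => lia
    | general i hi h =>
      have := h.pottedCount_lt_of_mod_two (t := t) (by lia)
      rw [← threePow_add_three, threePow_eq (s := s) (by lia)] at this
      exact of_lt this
  case matched =>
    rcases h.shape with ⟨f, p, -, hj', -⟩ | hle
    · lia
    · rw [threePow_eq (s := s) (by lia)] at hle
      exact of_lt (pottedCount_matched_lt _ ht h.matched_pos hle)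

theorem BranchTree.pottedCount_of_mod_one (T : BranchTree) (ht : 1 ≤ t)
    (hT : T.order = 3 * s + 5) :
    (T.counts.pottedCount t = (t + 1) * 3 ^ (s + 1) + 1 ∧
      ∃ e p, IsBouquet {single} e p T) ∨
    (T.counts.pottedCount t = (3 * t + 2) * 3 ^ s + (t + 1) ∧
      ∃ a e p, T = join single a ∧ IsBouquet {single, edge} e p a) ∨
    T.counts.pottedCount t < (t + 1) * 3 ^ (s + 1) + 1 ∨
    T.counts.pottedCount t < (3 * t + 2) * 3 ^ s + (t + 1) := by
  have hb := T.bounds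
  unfold BranchTree.Bounds at hb
  cases hc : T.counts <;> rw [hc] at hb <;> obtain ⟨j, hj, h⟩ := hb
  case optional b c d =>
    have hle := h.avoiding_le.trans (threePow_mono j.le_succ)
    rw [threePow_eq (s := s + 1) (by lia)] at hle
    exact .inr (.inr (.inl (Nat.lt_succ_of_le (Nat.mul_le_mul_left (t + 1) hle))))
  case forced =>
    cases h with
    | paths p _ h => lia
    | general i hi h =>
      have := h.pottedCount_of_mod_one ht (by lia)
      rw [← threePow_add_three, threePow_eq (s := s + 1) (by lia : (i + 3) / 3 = _),
        threePow_eq (s := s) (by lia)] at this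
      exact .inr (by tauto)
  case matched =>
    rcases h.shape with ⟨f, p, hb, hj', rfl, rfl, rfl⟩ | hle
    · have hs : f + p = s + 1 := by lia
      exact .inl ⟨by rw [hs, pottedCount], f, p, hb⟩
    · rw [threePow_eq (s := s + 1) (by lia)] at hle
      exact .inr (.inr (.inl
        ((pottedCount_matched_lt _ ht h.matched_pos hle).trans (Nat.lt_succ_self _))))

theorem BranchTree.pottedCount_of_mod_zero (T : BranchTree) (ht : 1 ≤ t)
    (hT : T.order = 3 * s + 4) :
    (T.counts.pottedCount t = (t + 1) * 3 ^ (s + 1) + (2 * t + 1) + (s + 1) ∧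
      IsBouquet 0 (s + 1) 0 T) ∨
    (T.counts.pottedCount t = (t + 1) * (3 ^ s + s + 2) + (2 * t + 1) * 3 ^ s + 1 ∧
      ∃ a, T = join single a ∧ IsBouquet {edge} s 0 a) ∨
    T.counts.pottedCount t < (t + 1) * 3 ^ (s + 1) + (2 * t + 1) + (s + 1) ∨
    T.counts.pottedCount t < (t + 1) * (3 ^ s + s + 2) + (2 * t + 1) * 3 ^ s + 1 := by
  have hb := T.bounds
  unfold BranchTree.Bounds at hb
  cases hT' : T.counts <;> rw [hT'] at hb <;> obtain ⟨j, hj, h⟩ := hb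
  case optional =>
    have hle := h.avoiding_le.trans (threePow_mono (by lia : j ≤ j + 2))
    rw [threePow_eq (s := s + 1) (by lia)] at hle
    have := Nat.mul_le_mul_left (t + 1) hle
    simp only [pottedCount]
    lia
  case forced o c d =>
    cases h with
    | paths p hb hj' ho hc =>
      obtain ⟨hs, hle⟩ : d + p = s + 1 ∧ d ≤ s + 1 := by lia
      rw [hs] at ho
      simp only [pottedCount, ho, hc]
      obtain rfl | hlt := hle.eq_or_lt
      · obtain rfl : p = 0 := by lia
        exact .inl ⟨by ring, hb⟩
      · lia
    | general i hi h =>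
      obtain rfl : i = 3 * s := by lia
      exact .inr (by have := h.pottedCount_of_three_mul ht; tauto)
  case matched o e d =>
    rcases h.shape with ⟨f, p, -, hj', -⟩ | hle
    · lia
    · have := threePow_mono (by lia : j ≤ j + 1)
      rw [threePow_eq (s := s + 1) (by lia : (j + 1) / 3 = _)] at this
      have := pottedCount_matched_lt e ht h.matched_pos (hle.trans this)
      lia

end PottedCount

/-! ### Dissociation sets and generating polynomials -/

section Polynomial

open Polynomial

/-- `p` has degree at most `n`, and its coefficient at `n` is `c`, possibly zero. -/
def HasTop (p : ℕ[X]) (n c : ℕ) : Prop := p.natDegree ≤ n ∧ p.coeff n = c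

namespace HasTop

variable {p q : ℕ[X]} {m n c d : ℕ}

theorem mul (hp : HasTop p m c) (hq : HasTop q n d) : HasTop (p * q) (m + n) (c * d) :=
  ⟨natDegree_mul_le_of_le hp.1 hq.1, by rw [coeff_mul_add_eq_of_natDegree_le hp.1 hq.1, hp.2, hq.2]⟩

theorem add (hp : HasTop p n c) (hq : HasTop q n d) : HasTop (p + q) n (c + d) :=
  ⟨natDegree_add_le_of_degree_le hp.1 hq.1, by rw [coeff_add, hp.2, hq.2]⟩

theorem of_lt (hp : HasTop p m c) (h : m < n) : HasTop p n 0 :=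
  ⟨hp.1.trans h.le, coeff_eq_zero_of_natDegree_lt (hp.1.trans_lt h)⟩

theorem congr (hp : HasTop p m c) (h : m = n) (h' : c = d) : HasTop p n d :=
  h ▸ h' ▸ hp

theorem X : HasTop (X : ℕ[X]) 1 1 := ⟨natDegree_X_le, coeff_X_one⟩

theorem one : HasTop 1 0 1 := ⟨natDegree_one.le, coeff_one_zero⟩

theorem zero (n : ℕ) : HasTop (0 : ℕ[X]) n 0 := ⟨by simp, by simp⟩

end HasTop

/-- The generating polynomials, by cardinality, of the dissociation sets of a rooted tree, sorted by
the way in which they contain the root. -/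
structure RootPolys where
  /-- the root is left out -/
  avoiding : ℕ[X]
  /-- the root is isolated -/
  isolated : ℕ[X]
  /-- the root has degree one -/
  matched : ℕ[X]

namespace RootPolys

/-- The generating polynomial of all dissociation sets. -/
noncomputable def total (p : RootPolys) : ℕ[X] := p.avoiding + p.isolated + p.matched

/-- The generating polynomials after attaching a branch at the root. -/
noncomputable def join (p q : RootPolys) : RootPolys where
  avoiding := p.avoiding * q.total
  isolated := p.isolated * q.avoiding
  matched := p.matched * q.avoiding + p.isolated * q.isolated

/-- The leading coefficients of the polynomials are given by the root counts, where `a` is the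
largest size of a dissociation set avoiding the root. -/
def Fits (p : RootPolys) (a : ℕ) : RootCounts → Prop
  | .optional b c d => HasTop p.avoiding a b ∧ HasTop p.isolated a c ∧ HasTop p.matched a d
  | .forced o c d =>
    HasTop p.avoiding a o ∧ HasTop p.isolated (a + 1) c ∧ HasTop p.matched (a + 1) d
  | .matched o e d => HasTop p.avoiding a o ∧ HasTop p.isolated a e ∧ HasTop p.matched (a + 1) d

end RootPolys

/-- The number of vertices that the root contributes to a maximum dissociation set. -/
def RootCounts.rootSize : RootCounts → ℕ
  | optional _ _ _ => 0
  | forced _ _ _ => 1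
  | matched _ _ _ => 1

/-- The number of all maximum dissociation sets. -/
def RootCounts.total : RootCounts → ℕ
  | optional b c d => b + c + d
  | forced _ c d => c + d
  | matched _ _ d => d

namespace RootPolys

variable {p q : RootPolys} {a b : ℕ} {D D' : RootCounts}

theorem Fits.total (h : p.Fits a D) : HasTop p.total (a + D.rootSize) D.total := by
  cases D <;> obtain ⟨ho, hz, hd⟩ := h
  · exact (ho.add hz).add hd
  · exact (((ho.of_lt a.lt_succ_self).add hz).add hd).congr rfl (by rw [zero_add]; rfl)
  · exact (((ho.of_lt a.lt_succ_self).add (hz.of_lt a.lt_succ_self)).add hd).congr rfl (by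
      rw [zero_add, zero_add]; rfl)

theorem Fits.join (hp : p.Fits a D) (hq : q.Fits b D') :
    (p.join q).Fits (a + b + D'.rootSize) (D.join D') := by
  have ht := hq.total
  rw [add_assoc]
  cases D <;> cases D' <;> obtain ⟨ho, hz, hd⟩ := hp <;> obtain ⟨ho', hz', -⟩ := hq <;>
    refine ⟨ho.mul ht, ?_, ?_⟩ <;> simp only [RootCounts.rootSize, RootPolys.join] <;>
    have hiso := hz.mul ho' <;> have hdeg := hd.mul ho' <;> have hnew := hz.mul hz'
  case optional.optional.refine_1 => exact hiso
  case optional.optional.refine_2 => exact hdeg.add hnew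
  case optional.forced.refine_1 => exact hiso.of_lt (by lia)
  case optional.forced.refine_2 => exact ((hdeg.of_lt (by lia)).add hnew).congr rfl (zero_add _)
  case optional.matched.refine_1 => exact hiso.of_lt (by lia)
  case optional.matched.refine_2 => exact (hdeg.of_lt (by lia)).add (hnew.of_lt (by lia))
  case forced.optional.refine_1 => exact hiso.congr (by lia) rfl
  case forced.optional.refine_2 => exact (hdeg.add hnew).congr (by lia) rfl
  case forced.forced.refine_1 => exact hiso.congr (by lia) rfl
  case forced.forced.refine_2 =>
    exact ((hdeg.of_lt (by lia)).add hnew).congr (by lia) (zero_add _)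
  case forced.matched.refine_1 => exact hiso.congr (by lia) rfl
  case forced.matched.refine_2 => exact (hdeg.add hnew).congr (by lia) rfl
  case matched.optional.refine_1 => exact hiso
  case matched.optional.refine_2 =>
    exact (hdeg.congr (by lia) rfl).add (hnew.of_lt (by lia))
  case matched.forced.refine_1 => exact hiso.of_lt (by lia)
  case matched.forced.refine_2 => exact (hdeg.congr (by lia) rfl).add hnew
  case matched.matched.refine_1 => exact hiso.of_lt (by lia)
  case matched.matched.refine_2 =>
    exact (hdeg.congr (by lia) rfl).add (hnew.of_lt (by lia))

end RootPolys

namespace BranchTree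

/-- The generating polynomials of the dissociation sets of a rooted tree. -/
noncomputable def polys : BranchTree → RootPolys
  | single => ⟨1, X, 0⟩
  | join t s => t.polys.join s.polys

theorem fits_single : single.polys.Fits 0 (.forced 1 1 0) :=
  ⟨HasTop.one, HasTop.X, HasTop.zero _⟩

theorem exists_fits (T : BranchTree) : ∃ a, T.polys.Fits a T.counts := by
  induction T with
  | single => exact ⟨0, fits_single⟩
  | join t s iht ihs =>
    obtain ⟨a, ha⟩ := iht
    obtain ⟨b, hb⟩ := ihs
    exact ⟨_, ha.join hb⟩

/-- The path with `n + 1` vertices, rooted at an end. -/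
def path : ℕ → BranchTree
  | 0 => single
  | n + 1 => join single (path n)

variable {n a o d : ℕ}

theorem fits_path_of_forced (h : (path n).polys.Fits a (.forced o 1 d)) :
    (path (n + 1)).polys.Fits (a + 1) (.matched (d + 1) o 1) := by
  have h' := fits_single.join h
  simp only [RootCounts.join, RootCounts.rootSize, one_mul, zero_add, add_comm 1 d] at h'
  exact h'

theorem exists_fits_path (t : ℕ) : ∃ o, (path (3 * t)).polys.Fits (2 * t) (.forced o 1 t) := by
  induction t with
  | zero => exact ⟨1, fits_single⟩
  | succ t ih =>
    obtain ⟨o, h⟩ := ih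
    have h₂ := fits_single.join (fits_single.join (fits_path_of_forced h))
    simp only [RootCounts.join, RootCounts.rootSize, one_mul, zero_mul, zero_add, add_zero] at h₂
    exact ⟨_, h₂⟩

theorem hasTop_path (t : ℕ) : HasTop (path (3 * t)).polys.total (2 * t + 1) (t + 1) := by
  obtain ⟨o, h⟩ := exists_fits_path t
  exact h.total.congr rfl (add_comm 1 t)

theorem hasTop_path_succ (t : ℕ) : HasTop (path (3 * t + 1)).polys.total (2 * t + 2) 1 := by
  obtain ⟨o, h⟩ := exists_fits_path t
  exact (fits_path_of_forced h).total

/-- The polynomial is that of the potted graph formed by `T` and a cycle of order `3 * t + 5`: when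
the root is used, the rest of the cycle loses its two neighbours or one of them. -/
theorem exists_hasTop_potted (T : BranchTree) (t : ℕ) :
    ∃ a, HasTop (T.polys.avoiding * (path (3 * t + 3)).polys.total +
      (T.polys.isolated + T.polys.matched) * (path (3 * t + 1)).polys.total +
      2 * (T.polys.isolated * (X * (path (3 * t)).polys.total))) a
      (T.counts.pottedCount (t + 1)) := by
  obtain ⟨a, h⟩ := T.exists_fits
  have hlong := hasTop_path (t + 1)
  have hmid := hasTop_path_succ t
  have hshort := HasTop.X.mul (hasTop_path t)
  have htwo : HasTop 2 0 2 := one_add_one_eq_two (R := ℕ[X]) ▸ HasTop.one.add HasTop.one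
  refine ⟨a + (2 * t + 3), ?_⟩
  cases hT : T.counts <;> rw [hT] at h <;> obtain ⟨ho, hz, hd⟩ := h
  case optional =>
    exact (((ho.mul hlong).add (((hz.add hd).mul hmid).of_lt (by lia))).add
      ((htwo.mul (hz.mul hshort)).of_lt (by lia))).congr (by lia) (by
        simp only [RootCounts.pottedCount]; ring)
  case forced =>
    exact ((((ho.mul hlong).congr (by lia) rfl).add
      (((hz.add hd).mul hmid).congr (by lia) rfl)).add
      ((htwo.mul (hz.mul hshort)).congr (by lia) rfl)).congr rfl (by
        simp only [RootCounts.pottedCount]; ring)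
  case matched =>
    exact ((((ho.mul hlong).congr (by lia) rfl).add
      ((((hz.of_lt (Nat.lt_add_one _)).add hd).mul hmid).congr (by lia) rfl)).add
      ((htwo.mul (hz.mul hshort)).of_lt (by lia))).congr rfl (by
        simp only [RootCounts.pottedCount]; ring)

end BranchTree

section Attached

variable {V : Type u} {G : SimpleGraph V} {A₁ A₂ : Finset V} {S₁ S₂ N : Set V} {r : V}

/-- `S₁` and `S₂` are disjoint, and the edges between them are those joining `r ∈ S₁` to the
vertices in `N ⊆ S₂`. -/
structure Attached (G : SimpleGraph V) (S₁ S₂ : Set V) (r : V) (N : Set V) : Prop where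
  disjoint : Disjoint S₁ S₂
  root_mem : r ∈ S₁
  subset : N ⊆ S₂
  adj_iff : ∀ x ∈ S₁, ∀ y ∈ S₂, G.Adj x y ↔ x = r ∧ y ∈ N

namespace Attached

theorem root_notMem (h : Attached G S₁ S₂ r N) (h₂ : (A₂ : Set V) ⊆ S₂) : r ∉ A₂ :=
  fun hr => Set.disjoint_left.1 h.disjoint h.root_mem (h₂ hr)

theorem notMem_of_mem (h : Attached G S₁ S₂ r N) (h₁ : (A₁ : Set V) ⊆ S₁) :
    ∀ x ∈ A₁, x ∉ N :=
  fun _ hx hN => Set.disjoint_left.1 h.disjoint (h₁ hx) (h.subset hN)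

theorem adj_root_iff (h : Attached G S₁ S₂ r N) (h₂ : (A₂ : Set V) ⊆ S₂) :
    ∀ y ∈ A₂, G.Adj r y ↔ y ∈ N :=
  fun y hy => (h.adj_iff r h.root_mem y (h₂ hy)).trans (and_iff_right rfl)

end Attached

end Attached

section DissociationSets

variable {V : Type u} [Finite V] {G : SimpleGraph V} {A A₁ A₂ : Finset V} {S S₁ S₂ N : Set V}
  {r : V}

theorem isDissociationSet_iff : IsDissociationSet G A ↔
    ∀ v ∈ A, ∀ x ∈ A, ∀ y ∈ A, G.Adj v x → G.Adj v y → x = y := by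
  refine forall₂_congr fun v _ => ?_
  rw [Set.ncard_le_one (Set.toFinite _)]
  exact ⟨fun h x hx y hy hvx hvy => h x ⟨hx, hvx⟩ y ⟨hy, hvy⟩,
    fun h x hx y hy => h x hx.1 y hy.1 hx.2 hy.2⟩

variable (G) in
/-- `A` is a dissociation set disjoint from `N`. -/
def Avoids (N : Set V) (A : Finset V) : Prop := IsDissociationSet G A ∧ ∀ x ∈ A, x ∉ N

variable (G) in
/-- `A` is a dissociation set meeting `N` in a single vertex, which is isolated in `G[A]`. -/
def Isolates (N : Set V) (A : Finset V) : Prop :=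
  IsDissociationSet G A ∧ ∃ y ∈ A, y ∈ N ∧ (∀ x ∈ A, ¬G.Adj y x) ∧ ∀ x ∈ A, x ∈ N → x = y

theorem isolates_singleton_iff :
    Isolates G {r} A ↔ IsDissociationSet G A ∧ r ∈ A ∧ ∀ x ∈ A, ¬G.Adj r x := by
  simp only [Isolates, Set.mem_singleton_iff]
  grind

variable (G) in
/-- `A` is a dissociation set containing `r` as a vertex of degree one in `G[A]`. -/
def Matches (r : V) (A : Finset V) : Prop := IsDissociationSet G A ∧ r ∈ A ∧ ∃ x ∈ A, G.Adj r x

namespace Attached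

variable [DecidableEq V]

theorem isDissociationSet_union_iff (h : Attached G S₁ S₂ r N) (h₁ : (A₁ : Set V) ⊆ S₁)
    (h₂ : (A₂ : Set V) ⊆ S₂) : IsDissociationSet G (A₁ ∪ A₂) ↔
      IsDissociationSet G A₁ ∧ IsDissociationSet G A₂ ∧
        (r ∈ A₁ → Avoids G N A₂ ∨ (∀ x ∈ A₁, ¬G.Adj r x) ∧ Isolates G N A₂) := by
  have hadj : ∀ x ∈ A₁, ∀ y ∈ A₂, G.Adj x y ↔ x = r ∧ y ∈ N :=
    fun x hx y hy => h.adj_iff x (h₁ hx) y (h₂ hy)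
  have hne : ∀ x ∈ A₁, ∀ y ∈ A₂, x ≠ y := fun x hx y hy => h.disjoint.ne_of_mem (h₁ hx) (h₂ hy)
  have hsymm : ∀ x y, G.Adj x y → G.Adj y x := fun x y h => h.symm
  clear h h₁ h₂
  simp only [isDissociationSet_iff, Avoids, Isolates, Finset.mem_union]
  constructor <;> grind

theorem avoids_union_iff (h : Attached G S₁ S₂ r N) (h₁ : (A₁ : Set V) ⊆ S₁)
    (h₂ : (A₂ : Set V) ⊆ S₂) :
    Avoids G {r} (A₁ ∪ A₂) ↔ Avoids G {r} A₁ ∧ IsDissociationSet G A₂ := by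
  have hr := h.root_notMem h₂
  simp only [Avoids, h.isDissociationSet_union_iff h₁ h₂, Finset.mem_union, Set.mem_singleton_iff]
  grind

theorem isolates_union_iff (h : Attached G S₁ S₂ r N) (h₁ : (A₁ : Set V) ⊆ S₁)
    (h₂ : (A₂ : Set V) ⊆ S₂) :
    Isolates G {r} (A₁ ∪ A₂) ↔ Isolates G {r} A₁ ∧ Avoids G N A₂ := by
  have hr := h.root_notMem h₂
  have hadj := h.adj_root_iff h₂
  simp only [Isolates, Avoids, h.isDissociationSet_union_iff h₁ h₂, Finset.mem_union,
    Set.mem_singleton_iff]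
  grind

theorem matches_union_iff_of_forall_notMem (h : Attached G S₁ S₂ r N) (h₁ : (A₁ : Set V) ⊆ S₁)
    (h₂ : (A₂ : Set V) ⊆ S₂) : Matches G r (A₁ ∪ A₂) ∧ (∀ x ∈ A₁ ∪ A₂, x ∉ N) ↔
      Matches G r A₁ ∧ Avoids G N A₂ := by
  have hr := h.root_notMem h₂
  have hadj := h.adj_root_iff h₂
  have hN := h.notMem_of_mem h₁
  simp only [Matches, Avoids, h.isDissociationSet_union_iff h₁ h₂, Finset.mem_union]
  grind

theorem matches_union_iff_of_exists_mem (h : Attached G S₁ S₂ r N) (h₁ : (A₁ : Set V) ⊆ S₁)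
    (h₂ : (A₂ : Set V) ⊆ S₂) : Matches G r (A₁ ∪ A₂) ∧ ¬(∀ x ∈ A₁ ∪ A₂, x ∉ N) ↔
      Isolates G {r} A₁ ∧ Isolates G N A₂ := by
  have hr := h.root_notMem h₂
  have hadj := h.adj_root_iff h₂
  have hN := h.notMem_of_mem h₁
  simp only [Matches, Avoids, Isolates, h.isDissociationSet_union_iff h₁ h₂, Finset.mem_union,
    Set.mem_singleton_iff]
  grind

end Attached

theorem isMaximumDissociationSet_iff {n : ℕ}
    (hn : ∀ B, IsDissociationSet G B → B.card ≤ n)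
    (hex : ∃ B, IsDissociationSet G B ∧ B.card = n) :
    IsMaximumDissociationSet G A ↔ IsDissociationSet G A ∧ A.card = n := by
  obtain ⟨B, hB, hBn⟩ := hex
  refine and_congr_right fun hA => ⟨fun h => (hn A hA).antisymm (hBn ▸ h B hB), ?_⟩
  rintro rfl
  exact hn

end DissociationSets

section GenPoly

variable {V : Type u} [Fintype V] {S S' S₁ S₂ : Set V} {P P₁ P₂ Q : Finset V → Prop}

open Classical in
/-- The generating polynomial, by cardinality, of the sets `A ⊆ S` with property `P`. -/
noncomputable def genPoly (S : Set V) (P : Finset V → Prop) : ℕ[X] :=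
  ∑ A ∈ Finset.univ.filter fun A : Finset V => (A : Set V) ⊆ S ∧ P A, X ^ A.card

theorem genPoly_congr (h : ∀ A : Finset V, ((A : Set V) ⊆ S ∧ P A) ↔ ((A : Set V) ⊆ S' ∧ Q A)) :
    genPoly S P = genPoly S' Q := by
  classical exact Finset.sum_congr (Finset.filter_congr fun A _ => h A) fun _ _ => rfl

theorem genPoly_add (h : ∀ A, P A ↔ P₁ A ∨ P₂ A) (hd : ∀ A, P₁ A → ¬P₂ A) :
    genPoly S P = genPoly S P₁ + genPoly S P₂ := by
  classical
  have hdisj : Disjoint (α := Finset (Finset V)) {A | (A : Set V) ⊆ S ∧ P₁ A}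
      {A | (A : Set V) ⊆ S ∧ P₂ A} :=
    Finset.disjoint_filter.2 fun A _ h₁ h₂ => hd A h₁.2 h₂.2
  simp only [genPoly, h, and_or_left, Finset.filter_or, Finset.sum_union hdisj]

theorem genPoly_split (P Q : Finset V → Prop) :
    genPoly S P = genPoly S (fun A => P A ∧ Q A) + genPoly S (fun A => P A ∧ ¬Q A) :=
  genPoly_add (fun A => by tauto) fun A h h' => h'.2 h.2

theorem genPoly_union [DecidableEq V] (hd : Disjoint S₁ S₂)
    (h : ∀ A₁ A₂ : Finset V, (A₁ : Set V) ⊆ S₁ → (A₂ : Set V) ⊆ S₂ →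
      (P (A₁ ∪ A₂) ↔ P₁ A₁ ∧ P₂ A₂)) :
    genPoly (S₁ ∪ S₂) P = genPoly S₁ P₁ * genPoly S₂ P₂ := by
  lift S₁ to Finset V using S₁.toFinite
  lift S₂ to Finset V using S₂.toFinite
  rw [Finset.disjoint_coe] at hd
  have hinter {A : Finset V} (hA : A ⊆ S₁ ∪ S₂) : A ∩ S₁ ∪ A ∩ S₂ = A := by grind
  simp only [genPoly, Finset.sum_mul_sum, ← Finset.sum_product']
  refine Finset.sum_nbij' (fun A => (A ∩ S₁, A ∩ S₂)) (fun A => A.1 ∪ A.2) ?_ ?_ ?_ ?_ ?_ <;>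
    simp only [Finset.mem_filter, Finset.mem_univ, true_and, Finset.mem_product, Finset.coe_subset,
      ← Finset.coe_union] at h ⊢
  · grind
  · grind
  · grind
  · rintro ⟨A₁, A₂⟩ hA
    rw [Finset.disjoint_left] at hd
    ext x <;> grind
  · intro A hA
    rw [← pow_add, ← Finset.card_union_of_disjoint (by grind), hinter hA.1]

open Classical in
theorem genPoly_singleton (r : V) (P : Finset V → Prop) :
    genPoly {r} P = (if P ∅ then 1 else 0) + if P {r} then X else 0 := by
  have hsub : ({A | (A : Set V) ⊆ {r}} : Finset (Finset V)) = {∅, {r}} := by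
    ext A
    rw [Finset.mem_filter_univ, ← Finset.coe_singleton, Finset.coe_subset,
      Finset.subset_singleton_iff, Finset.mem_insert, Finset.mem_singleton]
  rw [genPoly, ← Finset.filter_filter, hsub, Finset.sum_filter,
    Finset.sum_pair (Finset.singleton_ne_empty r).symm, Finset.card_empty, Finset.card_singleton,
    pow_zero, pow_one]

end GenPoly

section RootPolys

variable {V : Type u} [Fintype V] {G : SimpleGraph V} {S S₁ S₂ N : Set V} {r c : V}

variable (G) in
/-- The generating polynomials of the rooted graph `G[S]` with root `r`. -/
noncomputable def rootPolys (S : Set V) (r : V) : RootPolys where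
  avoiding := genPoly S (Avoids G {r})
  isolated := genPoly S (Isolates G {r})
  matched := genPoly S (Matches G r)

theorem total_rootPolys (S : Set V) (r : V) :
    (rootPolys G S r).total = genPoly S (IsDissociationSet G) := by
  have hmem : genPoly S (fun A => IsDissociationSet G A ∧ ¬(∀ x ∈ A, x ∉ ({r} : Set V))) =
      genPoly S (Isolates G {r}) + genPoly S (Matches G r) := by
    refine genPoly_add (fun A => ?_) fun A h h' => ?_ <;>
      simp only [isolates_singleton_iff, Matches, Set.mem_singleton_iff] at * <;> grind
  rw [genPoly_split (IsDissociationSet G) fun A => ∀ x ∈ A, x ∉ ({r} : Set V), hmem, ← add_assoc]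
  rfl

theorem rootPolys_singleton (r : V) : rootPolys G {r} r = single.polys := by
  classical
  simp [rootPolys, polys, genPoly_singleton, Avoids, isolates_singleton_iff, Matches,
    isDissociationSet_iff]

namespace Attached

theorem avoiding_union (h : Attached G S₁ S₂ r N) : (rootPolys G (S₁ ∪ S₂) r).avoiding =
    (rootPolys G S₁ r).avoiding * genPoly S₂ (IsDissociationSet G) := by
  classical exact genPoly_union h.disjoint fun _ _ => h.avoids_union_iff

theorem isolated_union (h : Attached G S₁ S₂ r N) : (rootPolys G (S₁ ∪ S₂) r).isolated =
    (rootPolys G S₁ r).isolated * genPoly S₂ (Avoids G N) := by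
  classical exact genPoly_union h.disjoint fun _ _ => h.isolates_union_iff

theorem matched_union (h : Attached G S₁ S₂ r N) : (rootPolys G (S₁ ∪ S₂) r).matched =
    (rootPolys G S₁ r).matched * genPoly S₂ (Avoids G N) +
      (rootPolys G S₁ r).isolated * genPoly S₂ (Isolates G N) := by
  classical
  refine (genPoly_split (Matches G r) fun A => ∀ x ∈ A, x ∉ N).trans (congrArg₂ _ ?_ ?_)
  · exact genPoly_union h.disjoint fun _ _ => h.matches_union_iff_of_forall_notMem
  · exact genPoly_union h.disjoint fun _ _ => h.matches_union_iff_of_exists_mem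

theorem rootPolys_union (h : Attached G S₁ S₂ r {c}) :
    rootPolys G (S₁ ∪ S₂) r = (rootPolys G S₁ r).join (rootPolys G S₂ c) := by
  rw [RootPolys.join, total_rootPolys, ← h.avoiding_union]
  exact congrArg₂ (RootPolys.mk _) h.isolated_union h.matched_union

theorem genPoly_union (h : Attached G S₁ S₂ r N) :
    genPoly (S₁ ∪ S₂) (IsDissociationSet G) =
      (rootPolys G S₁ r).avoiding * genPoly S₂ (IsDissociationSet G) +
      ((rootPolys G S₁ r).isolated + (rootPolys G S₁ r).matched) * genPoly S₂ (Avoids G N) +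
      (rootPolys G S₁ r).isolated * genPoly S₂ (Isolates G N) := by
  rw [← total_rootPolys (S₁ ∪ S₂) r, RootPolys.total, h.avoiding_union, h.isolated_union,
    h.matched_union]
  ring

end Attached

end RootPolys

section Realizes

variable {V : Type u} {G : SimpleGraph V} {t : BranchTree} {S : Set V} {r : V}

/-- The tree `t` describes the graph induced by `G` on `S`, rooted at `r`. -/
def Realizes (G : SimpleGraph V) : BranchTree → Set V → V → Prop
  | single, S, r => S = {r}
  | join t s, S, r => ∃ S₁ S₂ c, Realizes G t S₁ r ∧ Realizes G s S₂ c ∧ S = S₁ ∪ S₂ ∧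
      Attached G S₁ S₂ r {c}

theorem Realizes.rootPolys_eq [Fintype V] (h : Realizes G t S r) :
    rootPolys G S r = t.polys := by
  induction t generalizing S r with
  | single => rw [show S = {r} from h, rootPolys_singleton]
  | join t s iht ihs =>
    obtain ⟨S₁, S₂, c, h₁, h₂, rfl, h⟩ := h
    rw [h.rootPolys_union, iht h₁, ihs h₂, polys]

theorem Realizes.genPoly_eq [Fintype V] (h : Realizes G t S r) :
    genPoly S (IsDissociationSet G) = t.polys.total := by
  rw [← h.rootPolys_eq, total_rootPolys]

end Realizes

section Count

variable {V : Type u} [Fintype V] {G : SimpleGraph V} {n c : ℕ}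

theorem coeff_genPoly_univ (P : Finset V → Prop) (n : ℕ) :
    (genPoly Set.univ P).coeff n = {A | P A ∧ A.card = n}.ncard := by
  classical
  simp only [genPoly, finsetSum_coeff, coeff_X_pow, Finset.sum_boole, Finset.filter_filter,
    Set.subset_univ, true_and, Nat.cast_id]
  rw [← Set.ncard_coe_finset]
  simp only [Finset.coe_filter, Finset.mem_univ, true_and, eq_comm]

theorem numMaxDissociationSets_eq_of_hasTop
    (h : HasTop (genPoly Set.univ (IsDissociationSet G)) n c) (hc : 0 < c) :
    numMaxDissociationSets G = c := by
  have hle : ∀ B, IsDissociationSet G B → B.card ≤ n := fun B hB => by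
    refine (le_natDegree_of_ne_zero ?_).trans h.1
    rw [coeff_genPoly_univ]
    exact Set.ncard_ne_zero_of_mem ⟨hB, rfl⟩
  have hex : ∃ B, IsDissociationSet G B ∧ B.card = n := by
    rw [← h.2, coeff_genPoly_univ] at hc
    exact Set.nonempty_of_ncard_ne_zero hc.ne'
  simp only [numMaxDissociationSets, isMaximumDissociationSet_iff hle hex]
  rw [← h.2, coeff_genPoly_univ]

end Count

section InducedPath

variable {V : Type u} {G : SimpleGraph V} {c : ℕ → V} {a b a' b' m : ℕ} {A : Finset V}

/-- `c a, c (a + 1), …, c b` is an induced path of `G`. -/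
structure InducedPath (G : SimpleGraph V) (c : ℕ → V) (a b : ℕ) : Prop where
  injOn : Set.InjOn c (Set.Icc a b)
  adj_iff : ∀ i ∈ Set.Icc a b, ∀ j ∈ Set.Icc a b, G.Adj (c i) (c j) ↔ i = j + 1 ∨ j = i + 1

namespace InducedPath

theorem mono (h : InducedPath G c a b) (ha : a ≤ a') (hb : b' ≤ b) : InducedPath G c a' b' where
  injOn := h.injOn.mono (Set.Icc_subset_Icc ha hb)
  adj_iff i hi j hj := h.adj_iff i (Set.Icc_subset_Icc ha hb hi) j (Set.Icc_subset_Icc ha hb hj)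

theorem reverse (h : InducedPath G c a b) : InducedPath G (fun i => c (a + b - i)) a b where
  injOn i hi j hj hij := by
    simp only [Set.mem_Icc] at hi hj
    have := h.injOn (by simp only [Set.mem_Icc]; lia) (by simp only [Set.mem_Icc]; lia) hij
    lia
  adj_iff i hi j hj := by
    simp only [Set.mem_Icc] at hi hj
    rw [h.adj_iff _ (by simp only [Set.mem_Icc]; lia) _ (by simp only [Set.mem_Icc]; lia)]
    lia

theorem image_reverse (c : ℕ → V) (a b : ℕ) :
    (fun i => c (a + b - i)) '' Set.Icc a b = c '' Set.Icc a b := by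
  ext x
  simp only [Set.mem_image, Set.mem_Icc]
  exact ⟨fun ⟨i, hi, hx⟩ => ⟨a + b - i, by lia, hx⟩,
    fun ⟨i, hi, hx⟩ => ⟨a + b - i, by lia, by rw [← hx]; congr 1; lia⟩⟩

theorem realizes (h : InducedPath G c a (a + m)) :
    Realizes G (path m) (c '' Set.Icc a (a + m)) (c a) := by
  induction m generalizing a with
  | zero => simp [Realizes, path]
  | succ m ih =>
    have hIcc : Set.Icc a (a + (m + 1)) = {a} ∪ Set.Icc (a + 1) (a + 1 + m) := by ext; grind
    refine ⟨{c a}, _, c (a + 1), rfl, ih (h.mono (by lia) (by lia)),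
      by rw [hIcc, Set.image_union, Set.image_singleton], ?_⟩
    have hmem : a ∈ Set.Icc a (a + (m + 1)) := by simp
    have hsub : Set.Icc (a + 1) (a + 1 + m) ⊆ Set.Icc a (a + (m + 1)) := by grind
    constructor
    · rw [Set.disjoint_singleton_left, h.injOn.mem_image_iff hsub hmem]
      simp
    · rfl
    · exact Set.singleton_subset_iff.2 (Set.mem_image_of_mem c (by simp))
    · rintro _ rfl _ ⟨i, hi, rfl⟩
      rw [h.adj_iff a hmem i (hsub hi), Set.mem_singleton_iff,
        h.injOn.eq_iff (hsub hi) (by simp)]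
      grind

theorem subset_image_succ_iff (h : InducedPath G c a b) (hab : a ≤ b) :
    (A : Set V) ⊆ c '' Set.Icc (a + 1) b ↔ (A : Set V) ⊆ c '' Set.Icc a b ∧ c a ∉ A := by
  have hne : ∀ i, a + 1 ≤ i → i ≤ b → c i ≠ c a := fun i hi hib hc => by
    have := h.injOn ⟨by lia, hib⟩ ⟨le_rfl, hab⟩ hc
    lia
  simp only [Set.subset_def, Set.mem_image, Set.mem_Icc, Finset.mem_coe]
  grind

theorem subset_image_pred_iff (h : InducedPath G c a (b + 1)) (hab : a ≤ b + 1) :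
    (A : Set V) ⊆ c '' Set.Icc a b ↔ (A : Set V) ⊆ c '' Set.Icc a (b + 1) ∧ c (b + 1) ∉ A := by
  have hne : ∀ i, a ≤ i → i ≤ b → c i ≠ c (b + 1) := fun i hi hib hc => by
    have := h.injOn ⟨by lia, by lia⟩ ⟨hab, le_rfl⟩ hc
    lia
  simp only [Set.subset_def, Set.mem_image, Set.mem_Icc, Finset.mem_coe]
  grind

variable [Fintype V]

theorem genPoly_eq (h : InducedPath G c a (a + m)) :
    genPoly (c '' Set.Icc a (a + m)) (IsDissociationSet G) = (path m).polys.total :=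
  h.realizes.genPoly_eq

theorem genPoly_avoids (h : InducedPath G c 1 (m + 4)) :
    genPoly (c '' Set.Icc 1 (m + 4)) (Avoids G {c 1, c (m + 4)}) = (path (m + 1)).polys.total := by
  have hsub : InducedPath G c 2 (2 + (m + 1)) := h.mono (by lia) (by lia)
  rw [← hsub.genPoly_eq, show 2 + (m + 1) = m + 3 by lia]
  refine genPoly_congr fun A => ?_
  rw [(h.mono le_rfl (by lia)).subset_image_succ_iff (b := m + 3) (by lia),
    h.subset_image_pred_iff (by lia)]
  simp only [Avoids, Set.mem_insert_iff, Set.mem_singleton_iff]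
  grind

theorem genPoly_isolates_left (h : InducedPath G c 1 (m + 4)) :
    genPoly (c '' Set.Icc 1 (m + 4)) (fun A => Isolates G {c 1} A ∧ c (m + 4) ∉ A) =
      X * (path m).polys.total := by
  have hreal := (h.mono (b' := 1 + (m + 2)) le_rfl (by lia)).realizes
  have hpoly : (path (m + 2)).polys.isolated = X * (path m).polys.total := by
    simp [path, polys, RootPolys.join]
  rw [← hpoly, ← hreal.rootPolys_eq, show 1 + (m + 2) = m + 3 by lia]
  refine genPoly_congr fun A => ?_
  rw [h.subset_image_pred_iff (by lia)]
  tauto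

theorem genPoly_isolates_right (h : InducedPath G c 1 (m + 4)) :
    genPoly (c '' Set.Icc 1 (m + 4)) (fun A => Isolates G {c (m + 4)} A ∧ c 1 ∉ A) =
      X * (path m).polys.total := by
  rw [← h.reverse.genPoly_isolates_left, image_reverse]
  simp

theorem genPoly_isolates (h : InducedPath G c 1 (m + 4)) :
    genPoly (c '' Set.Icc 1 (m + 4)) (Isolates G {c 1, c (m + 4)}) =
      2 * (X * (path m).polys.total) := by
  have hne : c 1 ≠ c (m + 4) := fun hc => by
    have := h.injOn (by simp) (by simp) hc
    lia
  rw [two_mul]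
  nth_rewrite 1 [← h.genPoly_isolates_left]
  rw [← h.genPoly_isolates_right]
  refine genPoly_add (fun A => ?_) fun A => ?_ <;>
    simp only [Isolates, Set.mem_insert_iff, Set.mem_singleton_iff] <;> grind

end InducedPath

end InducedPath

section CycleWithTree

variable {V : Type u} {G : SimpleGraph V} {T : BranchTree} {S : Set V} {r : V} {c : ℕ → V}
  {m s : ℕ}

/-- `G` consists of a cycle with vertices `r, c 1, …, c m` and a tree on `S` described by `T` and
rooted at `r`. -/
structure CycleWithTree (G : SimpleGraph V) (m : ℕ) (T : BranchTree) (S : Set V) (r : V)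
    (c : ℕ → V) : Prop where
  realizes : Realizes G T S r
  inducedPath : InducedPath G c 1 m
  attached : Attached G S (c '' Set.Icc 1 m) r {c 1, c m}
  union_eq : S ∪ c '' Set.Icc 1 m = Set.univ

theorem CycleWithTree.genPoly_eq [Fintype V] (h : CycleWithTree G (m + 4) T S r c) :
    genPoly Set.univ (IsDissociationSet G) = T.polys.avoiding * (path (m + 3)).polys.total +
      (T.polys.isolated + T.polys.matched) * (path (m + 1)).polys.total +
      2 * (T.polys.isolated * (X * (path m).polys.total)) := by
  have hcycle : InducedPath G c 1 (1 + (m + 3)) := add_comm 1 (m + 3) ▸ h.inducedPath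
  have hpath := hcycle.genPoly_eq
  rw [show 1 + (m + 3) = m + 4 by lia] at hpath
  rw [← h.union_eq, h.attached.genPoly_union, hpath, h.inducedPath.genPoly_avoids,
    h.inducedPath.genPoly_isolates, h.realizes.rootPolys_eq]
  ring

theorem BranchTree.pottedCount_pos (T : BranchTree) (t : ℕ) : 0 < T.counts.pottedCount t := by
  have hb := T.bounds
  unfold Bounds at hb
  rcases hT : T.counts with ⟨b, c, d⟩ | ⟨o, c, d⟩ | ⟨o, e, d⟩ <;> rw [hT] at hb <;>
    obtain ⟨j, -, h⟩ := hb <;> simp only [RootCounts.pottedCount]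
  · exact Nat.mul_pos (Nat.succ_pos t) h.pos
  · have := Nat.mul_pos (Nat.succ_pos t) h.avoiding_pos
    lia
  · have := h.matched_pos
    lia

theorem CycleWithTree.numMaxDissociationSets_eq [Finite V]
    (h : CycleWithTree G (3 * s + 4) T S r c) :
    numMaxDissociationSets G = T.counts.pottedCount (s + 1) := by
  have := Fintype.ofFinite V
  obtain ⟨a, ha⟩ := T.exists_hasTop_potted s
  rw [← h.genPoly_eq] at ha
  exact numMaxDissociationSets_eq_of_hasTop ha (T.pottedCount_pos _)

end CycleWithTree

end Polynomial

/-! ### Potted graphs as cycles with a tree -/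

section IsoOn

variable {V : Type u} {W : Type v} {G : SimpleGraph V} {H : SimpleGraph W} {f f₁ f₂ : V → W}
  {S S₁ S₂ N : Set V} {T T₁ T₂ M : Set W} {r : V} {q : W} {c : ℕ → V} {d : ℕ → W}
  {a b : ℕ} {s t : BranchTree}

/-- `f` restricts to an isomorphism from `G[S]` to `H[T]`. -/
structure IsoOn (G : SimpleGraph V) (H : SimpleGraph W) (f : V → W) (S : Set V) (T : Set W) :
    Prop where
  bijOn : Set.BijOn f S T
  adj_iff : ∀ x ∈ S, ∀ y ∈ S, H.Adj (f x) (f y) ↔ G.Adj x y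

namespace IsoOn

theorem of_injOn (hf : Set.InjOn f S) (adj_iff : ∀ x ∈ S, ∀ y ∈ S, H.Adj (f x) (f y) ↔ G.Adj x y) :
    IsoOn G H f S (f '' S) :=
  ⟨hf.bijOn_image, adj_iff⟩

theorem of_iso (e : G ≃g H) : IsoOn G H e Set.univ Set.univ :=
  ⟨Set.bijOn_univ.2 e.bijective, fun _ _ _ _ => e.map_adj_iff⟩

theorem nonempty_iso (h : IsoOn G H f Set.univ Set.univ) : Nonempty (G ≃g H) :=
  ⟨⟨Equiv.ofBijective f (Set.bijOn_univ.1 h.bijOn), fun {x y} => h.adj_iff x trivial y trivial⟩⟩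

theorem mono (h : IsoOn G H f S T) (hS : S₁ ⊆ S) : IsoOn G H f S₁ (f '' S₁) :=
  of_injOn (h.bijOn.injOn.mono hS) fun x hx y hy => h.adj_iff x (hS hx) y (hS hy)

theorem union_of_attached (hS : Attached G S₁ S₂ r N) (hT : Attached H T₁ T₂ (f r) (f '' N))
    (h₁ : IsoOn G H f S₁ T₁) (h₂ : IsoOn G H f S₂ T₂) : IsoOn G H f (S₁ ∪ S₂) (T₁ ∪ T₂) := by
  have hcross : ∀ x ∈ S₁, ∀ y ∈ S₂, H.Adj (f x) (f y) ↔ G.Adj x y := fun x hx y hy => by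
    rw [hS.adj_iff x hx y hy, hT.adj_iff _ (h₁.bijOn.mapsTo hx) _ (h₂.bijOn.mapsTo hy),
      h₁.bijOn.injOn.eq_iff hx hS.root_mem, h₂.bijOn.injOn.mem_image_iff hS.subset hy]
  refine ⟨h₁.bijOn.union h₂.bijOn ((Set.injOn_union hS.disjoint).2 ⟨h₁.bijOn.injOn,
    h₂.bijOn.injOn, fun x hx y hy => hT.disjoint.ne_of_mem (h₁.bijOn.mapsTo hx)
      (h₂.bijOn.mapsTo hy)⟩), ?_⟩
  rintro x (hx | hx) y (hy | hy)
  · exact h₁.adj_iff x hx y hy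
  · exact hcross x hx y hy
  · rw [H.adj_comm, G.adj_comm, hcross y hy x hx]
  · exact h₂.adj_iff x hx y hy

theorem congr (h : IsoOn G H f S T) (hf : Set.EqOn f₁ f S) : IsoOn G H f₁ S T :=
  ⟨h.bijOn.congr hf.symm, fun x hx y hy => by rw [hf hx, hf hy, h.adj_iff x hx y hy]⟩

theorem exists_union (hS : Attached G S₁ S₂ r N) (hT : Attached H T₁ T₂ (f₁ r) (f₂ '' N))
    (h₁ : IsoOn G H f₁ S₁ T₁) (h₂ : IsoOn G H f₂ S₂ T₂) :
    ∃ f, f r = f₁ r ∧ IsoOn G H f (S₁ ∪ S₂) (T₁ ∪ T₂) := by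
  classical
  have hf₁ : Set.EqOn (S₁.piecewise f₁ f₂) f₁ S₁ := Set.piecewise_eqOn S₁ f₁ f₂
  have hf₂ : Set.EqOn (S₁.piecewise f₁ f₂) f₂ S₂ := fun x hx =>
    Set.piecewise_eq_of_notMem S₁ f₁ f₂ (Set.disjoint_right.1 hS.disjoint hx)
  refine ⟨S₁.piecewise f₁ f₂, hf₁ hS.root_mem,
    union_of_attached hS ?_ (h₁.congr hf₁) (h₂.congr hf₂)⟩
  rwa [hf₁ hS.root_mem, (hf₂.mono hS.subset).image_eq]

theorem attached (h : IsoOn G H f S T) (hS : Attached G S₁ S₂ r N) (h₁ : S₁ ⊆ S) (h₂ : S₂ ⊆ S) :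
    Attached H (f '' S₁) (f '' S₂) (f r) (f '' N) where
  disjoint := hS.disjoint.image h.bijOn.injOn h₁ h₂
  root_mem := Set.mem_image_of_mem f hS.root_mem
  subset := Set.image_mono hS.subset
  adj_iff := by
    rintro _ ⟨x, hx, rfl⟩ _ ⟨y, hy, rfl⟩
    rw [h.adj_iff x (h₁ hx) y (h₂ hy), hS.adj_iff x hx y hy,
      h.bijOn.injOn.eq_iff (h₁ hx) (h₁ hS.root_mem),
      h.bijOn.injOn.mem_image_iff (hS.subset.trans h₂) (h₂ hy)]

theorem realizes (h : IsoOn G H f S T) (ht : Realizes G t S r) : Realizes H t T (f r) := by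
  induction t generalizing S T r with
  | single =>
    obtain rfl : S = {r} := ht
    rw [← h.bijOn.image_eq, Set.image_singleton]
    rfl
  | join t s iht ihs =>
    obtain ⟨S₁, S₂, c, h₁, h₂, rfl, hS⟩ := ht
    refine ⟨f '' S₁, f '' S₂, f c, iht (h.mono Set.subset_union_left) h₁,
      ihs (h.mono Set.subset_union_right) h₂, by rw [← Set.image_union, h.bijOn.image_eq], ?_⟩
    rw [← Set.image_singleton]
    exact h.attached hS Set.subset_union_left Set.subset_union_right

theorem inducedPath (h : IsoOn G H f S T) (hc : InducedPath G c a b) (hS : c '' Set.Icc a b ⊆ S) :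
    InducedPath H (f ∘ c) a b where
  injOn := h.bijOn.injOn.comp hc.injOn (Set.mapsTo_iff_image_subset.2 hS)
  adj_iff i hi j hj := by
    rw [← hc.adj_iff i hi j hj]
    exact h.adj_iff _ (hS (Set.mem_image_of_mem c hi)) _ (hS (Set.mem_image_of_mem c hj))

end IsoOn

theorem Realizes.exists_isoOn (h : Realizes G t S r) (h' : Realizes H t T q) :
    ∃ f, f r = q ∧ IsoOn G H f S T := by
  induction t generalizing S r T q with
  | single =>
    obtain rfl : S = {r} := h
    obtain rfl : T = {q} := h'
    exact ⟨fun _ => q, rfl, by simp, by simp⟩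
  | join t s iht ihs =>
    obtain ⟨S₁, S₂, c, h₁, h₂, rfl, hS⟩ := h
    obtain ⟨T₁, T₂, d, h₁', h₂', rfl, hT⟩ := h'
    obtain ⟨f₁, rfl, hf₁⟩ := iht h₁ h₁'
    obtain ⟨f₂, rfl, hf₂⟩ := ihs h₂ h₂'
    exact hf₁.exists_union hS (by rwa [Set.image_singleton]) hf₂

theorem InducedPath.exists_isoOn (h : InducedPath G c a b) (h' : InducedPath H d a b) :
    ∃ f, (∀ i ∈ Set.Icc a b, f (c i) = d i) ∧
      IsoOn G H f (c '' Set.Icc a b) (d '' Set.Icc a b) := by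
  have hf : ∀ i ∈ Set.Icc a b, (d ∘ Function.invFunOn c (Set.Icc a b)) (c i) = d i :=
    fun i hi => congrArg d (h.injOn.leftInvOn_invFunOn hi)
  refine ⟨_, hf, ?_, ?_⟩
  · refine ⟨?_, ?_, ?_⟩
    · rintro _ ⟨i, hi, rfl⟩
      exact ⟨i, hi, (hf i hi).symm⟩
    · rintro _ ⟨i, hi, rfl⟩ _ ⟨j, hj, rfl⟩ hij
      rw [hf i hi, hf j hj] at hij
      rw [h'.injOn hi hj hij]
    · rintro _ ⟨i, hi, rfl⟩
      exact ⟨c i, Set.mem_image_of_mem c hi, hf i hi⟩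
  · rintro _ ⟨i, hi, rfl⟩ _ ⟨j, hj, rfl⟩
    rw [hf i hi, hf j hj, h.adj_iff i hi j hj, h'.adj_iff i hi j hj]

variable {k : ℕ}

theorem CycleWithTree.nonempty_iso (h : CycleWithTree G (k + 1) t S r c)
    (h' : CycleWithTree H (k + 1) t T q d) : Nonempty (G ≃g H) := by
  obtain ⟨f₁, rfl, hf₁⟩ := h.realizes.exists_isoOn h'.realizes
  obtain ⟨f₂, hf₂, hiso⟩ := h.inducedPath.exists_isoOn h'.inducedPath
  have hN : f₂ '' {c 1, c (k + 1)} = {d 1, d (k + 1)} := by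
    rw [Set.image_pair, hf₂ 1 (by simp), hf₂ (k + 1) (by simp)]
  obtain ⟨f, -, hf⟩ := hf₁.exists_union h.attached (hN ▸ h'.attached) hiso
  rw [h.union_eq, h'.union_eq] at hf
  exact hf.nonempty_iso

theorem CycleWithTree.map (h : CycleWithTree G k t S r c) (e : G ≃g H) :
    CycleWithTree H k t (e '' S) (e r) (e ∘ c) where
  realizes := ((IsoOn.of_iso e).mono (Set.subset_univ S)).realizes h.realizes
  inducedPath := (IsoOn.of_iso e).inducedPath h.inducedPath (Set.subset_univ _)
  attached := by
    have hS := (IsoOn.of_iso e).attached h.attached (Set.subset_univ _) (Set.subset_univ _)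
    rwa [← Set.image_comp, Set.image_pair] at hS
  union_eq := by
    rw [Set.image_comp, ← Set.image_union, h.union_eq, Set.image_univ, e.surjective.range_eq]

end IsoOn

section Branches

variable {V : Type u} {G G' : SimpleGraph V} {S S₁ S₂ S₃ : Set V} {r c d : V} {s t : BranchTree}

theorem Realizes.of_adj_iff (h : Realizes G t S r)
    (adj_iff : ∀ x ∈ S, ∀ y ∈ S, G'.Adj x y ↔ G.Adj x y) : Realizes G' t S r :=
  IsoOn.realizes (f := id) ⟨Set.bijOn_id S, adj_iff⟩ h

theorem Attached.right_comm (h : Attached G S₁ S₂ r {c}) (h' : Attached G (S₁ ∪ S₂) S₃ r {d}) :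
    Attached G S₁ S₃ r {d} ∧ Attached G (S₁ ∪ S₃) S₂ r {c} := by
  obtain ⟨h₁, h₂, h₃, h₄⟩ := h
  obtain ⟨h₁', h₂', h₃', h₄'⟩ := h'
  have hsymm : ∀ x y, G.Adj x y → G.Adj y x := fun x y h => h.symm
  simp only [Set.disjoint_left, Set.singleton_subset_iff, Set.mem_union,
    Set.mem_singleton_iff] at *
  constructor <;> constructor <;> try simp only [Set.disjoint_left,
    Set.singleton_subset_iff, Set.mem_union, Set.mem_singleton_iff]
  all_goals grind

theorem Realizes.of_perm {l l' : List BranchTree} (hl : l.Perm l')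
    (h : Realizes G (ofBranches l) S r) : Realizes G (ofBranches l') S r := by
  induction hl generalizing S r with
  | nil => exact h
  | cons x _ ih =>
    obtain ⟨S₁, S₂, c, h₁, h₂⟩ := h
    exact ⟨S₁, S₂, c, ih h₁, h₂⟩
  | swap x y l =>
    obtain ⟨_, S₂, c, ⟨S₁, S₃, d, h₁, h₃, rfl, hd⟩, h₂, rfl, hc⟩ := h
    obtain ⟨hc', hd'⟩ := hd.right_comm hc
    exact ⟨S₁ ∪ S₂, S₃, d, ⟨S₁, S₂, c, h₁, h₂, rfl, hc'⟩, h₃, Set.union_right_comm _ _ _, hd'⟩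
  | trans _ _ ih ih' => exact ih' (ih h)

theorem Realizes.of_branches_eq (h : Realizes G t S r) (hst : t.branches = s.branches) :
    Realizes G s S r := by
  obtain ⟨l, rfl⟩ := t.exists_eq_ofBranches
  obtain ⟨l', rfl⟩ := s.exists_eq_ofBranches
  rw [branches_ofBranches, branches_ofBranches, Multiset.coe_eq_coe] at hst
  exact h.of_perm hst

theorem Realizes.ncard_eq [Finite V] (h : Realizes G t S r) : S.ncard = t.order := by
  induction t generalizing S r with
  | single => rw [show S = {r} from h, Set.ncard_singleton, order]
  | join t s iht ihs =>
    obtain ⟨S₁, S₂, c, h₁, h₂, rfl, h⟩ := h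
    rw [Set.ncard_union_eq h.disjoint, iht h₁, ihs h₂, order]

theorem CycleWithTree.card_eq [Finite V] {k : ℕ} {c : ℕ → V} (h : CycleWithTree G k t S r c) :
    Nat.card V = t.order + k := by
  rw [← Set.ncard_univ, ← h.union_eq, Set.ncard_union_eq h.attached.disjoint, h.realizes.ncard_eq,
    h.inducedPath.injOn.ncard_image, ← Finset.coe_Icc, Set.ncard_coe_finset, Nat.card_Icc,
    Nat.add_sub_cancel]

end Branches

section Reachability

variable {V : Type u} {G : SimpleGraph V}

theorem mem_of_reachable {S : Set V} {x y : V} (h : G.Reachable x y) (hx : x ∈ S)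
    (hS : ∀ x ∈ S, ∀ y, G.Adj x y → y ∈ S) : y ∈ S := by
  obtain ⟨p⟩ := h
  induction p with
  | nil => exact hx
  | cons hadj _ ih => exact ih (hS _ hx _ hadj)

section IsBridge

variable {r c : V}

theorem setOf_reachable_eq_union (hrc : G.Adj r c) : {x | G.Reachable r x} =
    {x | (G.deleteEdges {s(r, c)}).Reachable r x} ∪
      {x | (G.deleteEdges {s(r, c)}).Reachable c x} := by
  have hle : G.deleteEdges {s(r, c)} ≤ G := SimpleGraph.deleteEdges_le _
  refine Set.Subset.antisymm (fun x hx => mem_of_reachable hx (.inl .rfl) fun u hu v huv => ?_)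
    (Set.union_subset (fun x hx => hx.mono hle) fun x hx => hrc.reachable.trans (hx.mono hle))
  by_cases h : s(u, v) = s(r, c)
  · obtain ⟨-, rfl⟩ | ⟨-, rfl⟩ := Sym2.eq_iff.1 h
    exacts [.inr .rfl, .inl .rfl]
  · have huv' : (G.deleteEdges {s(r, c)}).Adj u v := SimpleGraph.deleteEdges_adj.2 ⟨huv, h⟩
    exact hu.imp (·.trans huv'.reachable) (·.trans huv'.reachable)

theorem attached_of_isBridge (hb : G.IsBridge s(r, c)) (hrc : G.Adj r c) :
    Attached G {x | (G.deleteEdges {s(r, c)}).Reachable r x}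
      {x | (G.deleteEdges {s(r, c)}).Reachable c x} r {c} where
  disjoint := Set.disjoint_left.2 fun _ hx hy => hb (hx.trans hy.symm)
  root_mem := SimpleGraph.Reachable.rfl
  subset := Set.singleton_subset_iff.2 SimpleGraph.Reachable.rfl
  adj_iff x hx y hy := by
    refine ⟨fun hxy => ?_, ?_⟩
    · by_contra hne
      have hxy' : (G.deleteEdges {s(r, c)}).Adj x y := by
        refine SimpleGraph.deleteEdges_adj.2 ⟨hxy, fun he => ?_⟩
        obtain h | ⟨rfl, rfl⟩ := Sym2.eq_iff.1 he
        exacts [hne h, hb hx]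
      exact hb ((hx.trans hxy'.reachable).trans hy.symm)
    · rintro ⟨rfl, rfl⟩
      exact hrc

theorem Realizes.of_deleteEdges {S : Set V} {t : BranchTree} {q : V}
    (h : Realizes (G.deleteEdges {s(r, c)}) t S q) (hS : r ∈ S → c ∉ S) : Realizes G t S q := by
  refine h.of_adj_iff fun x hx y hy => ?_
  rw [SimpleGraph.deleteEdges_adj, iff_self_and]
  intro _ he
  obtain ⟨rfl, rfl⟩ | ⟨rfl, rfl⟩ := Sym2.eq_iff.1 he
  exacts [hS hx hy, hS hy hx]

end IsBridge

theorem exists_realizes [Finite V] (hG : G.IsAcyclic) (r : V) :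
    ∃ t, Realizes G t {x | G.Reachable r x} r := by
  induction hn : G.edgeSet.ncard using Nat.strong_induction_on generalizing G r with
  | _ n ih =>
  by_cases hr : ∃ c, G.Adj r c
  · obtain ⟨c, hc⟩ := hr
    have hb := SimpleGraph.isAcyclic_iff_forall_adj_isBridge.1 hG hc
    have hlt : (G.deleteEdges {s(r, c)}).edgeSet.ncard < n := by
      rw [SimpleGraph.edgeSet_deleteEdges, ← hn]
      exact Set.ncard_sdiff_singleton_lt_of_mem hc
    have hacyc := hG.anti (SimpleGraph.deleteEdges_le {s(r, c)})
    obtain ⟨t, ht⟩ := ih _ hlt hacyc r rfl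
    obtain ⟨s, hs⟩ := ih _ hlt hacyc c rfl
    exact ⟨.join t s, _, _, c, ht.of_deleteEdges fun _ => hb,
      hs.of_deleteEdges fun h => absurd h.symm hb, setOf_reachable_eq_union hc,
      attached_of_isBridge hb hc⟩
  · refine ⟨.single, Set.Subset.antisymm (fun x hx => ?_) ?_⟩
    · exact mem_of_reachable hx rfl (by rintro _ rfl y hy; exact absurd ⟨y, hy⟩ hr)
    · exact Set.singleton_subset_iff.2 .rfl

theorem isAcyclic_deleteEdges {C : G.Subgraph}
    (hC : ∀ (C' : G.Subgraph) (l : ℕ), IsCycleSubgraph C' l → C' = C) :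
    (G.deleteEdges C.edgeSet).IsAcyclic := by
  intro v q hq
  have hle : G.deleteEdges C.edgeSet ≤ G := SimpleGraph.deleteEdges_le _
  have heq : (q.mapLe hle).toSubgraph = C := hC _ _ ⟨v, q.mapLe hle, hq.mapLe hle, rfl, rfl⟩
  have hmem : s(v, q.snd) ∈ (q.mapLe hle).toSubgraph.edgeSet := by
    rw [SimpleGraph.Walk.mem_edges_toSubgraph, SimpleGraph.Walk.edges_mapLe_eq_edges]
    exact q.mk_start_snd_mem_edges hq.not_nil
  exact (SimpleGraph.deleteEdges_adj.1 (q.adj_snd hq.not_nil)).2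
    (SimpleGraph.Subgraph.edgeSet_mono heq.le hmem)

theorem IsPottedGraph.exists_isCycle [Finite V] {k : ℕ} (h : IsPottedGraph G k) :
    ∃ (w : V) (p : G.Walk w w), p.IsCycle ∧ p.length = k ∧
      (∀ (C : G.Subgraph) (l : ℕ), IsCycleSubgraph C l → C = p.toSubgraph) ∧
      ∀ v ∈ p.support, v ≠ w → ∀ x, G.Adj v x ↔ p.toSubgraph.Adj v x := by
  classical
  obtain ⟨-, C, ⟨v, p, hp, hpk, rfl⟩, huniq, w, ⟨hw, -⟩, hw'⟩ := h
  rw [SimpleGraph.Walk.mem_verts_toSubgraph] at hw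
  refine ⟨w, p.rotate w hw, hp.rotate hw, by rw [SimpleGraph.Walk.length_rotate, hpk], by
    rwa [SimpleGraph.Walk.toSubgraph_rotate], fun u hu hne x => ?_⟩
  rw [SimpleGraph.Walk.toSubgraph_rotate]
  rw [← SimpleGraph.Walk.mem_verts_toSubgraph, SimpleGraph.Walk.toSubgraph_rotate,
    SimpleGraph.Walk.mem_verts_toSubgraph] at hu
  have hdeg : (G.neighborSet u).ncard ≤ 2 := not_lt.1 fun hlt =>
    hne (hw' u ⟨p.mem_verts_toSubgraph.2 hu, hlt⟩)
  have heq : p.toSubgraph.neighborSet u = G.neighborSet u :=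
    Set.eq_of_subset_of_ncard_le (p.toSubgraph.neighborSet_subset u)
      (by rwa [hp.ncard_neighborSet_toSubgraph_eq_two hu])
  exact (Set.ext_iff.1 heq x).symm

section UniqueCycle

variable {w : V} {p : G.Walk w w} {m : ℕ}

theorem mem_image_getVert_or_eq (hm : p.length = m + 1) {v : V} (hv : v ∈ p.support) :
    v ∈ p.getVert '' Set.Icc 1 m ∨ v = w := by
  obtain ⟨i, rfl, hi⟩ := SimpleGraph.Walk.mem_support_iff_exists_getVert.1 hv
  rcases Nat.eq_zero_or_pos i with rfl | hpos
  · exact .inr p.getVert_zero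
  · rcases Nat.lt_or_ge m i with hlt | hle
    · exact .inr (p.getVert_of_length_le (by omega))
    · exact .inl ⟨i, ⟨hpos, hle⟩, rfl⟩

theorem mem_image_getVert_of_adj (hm : p.length = m + 1) {x y : V} (hxy : p.toSubgraph.Adj x y) :
    x ∈ p.getVert '' Set.Icc 1 m ∨ y ∈ p.getVert '' Set.Icc 1 m := by
  have hx := p.toSubgraph.edge_vert hxy
  have hy := p.toSubgraph.edge_vert hxy.symm
  rw [SimpleGraph.Walk.mem_verts_toSubgraph] at hx hy
  rcases mem_image_getVert_or_eq hm hx with h | rfl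
  · exact .inl h
  · exact .inr ((mem_image_getVert_or_eq hm hy).resolve_right (p.toSubgraph.adj_sub hxy).ne')

theorem notMem_image_getVert (hp : p.IsCycle) (hm : p.length = m + 1) :
    w ∉ p.getVert '' Set.Icc 1 m := by
  rintro ⟨i, ⟨hi, him⟩, h⟩
  have := hp.getVert_injOn (x₁ := i) (x₂ := p.length) ⟨hi, by omega⟩ ⟨by omega, le_rfl⟩
    (h.trans p.getVert_length.symm)
  omega

theorem adj_iff_toSubgraph_adj (hp : p.IsCycle) (hm : p.length = m + 1)
    (hadj : ∀ v ∈ p.support, v ≠ w → ∀ x, G.Adj v x ↔ p.toSubgraph.Adj v x)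
    {v : V} (hv : v ∈ p.getVert '' Set.Icc 1 m) (x : V) :
    G.Adj v x ↔ p.toSubgraph.Adj v x := by
  refine hadj v ?_ (fun h => notMem_image_getVert hp hm (h ▸ hv)) x
  obtain ⟨i, -, rfl⟩ := hv
  exact p.getVert_mem_support i

theorem adj_getVert_iff (hp : p.IsCycle) (hm : p.length = m + 1)
    (hadj : ∀ v ∈ p.support, v ≠ w → ∀ x, G.Adj v x ↔ p.toSubgraph.Adj v x)
    {i : ℕ} (hi : i ∈ Set.Icc 1 m) (x : V) :
    G.Adj (p.getVert i) x ↔ x = p.getVert (i - 1) ∨ x = p.getVert (i + 1) := by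
  rw [adj_iff_toSubgraph_adj hp hm hadj (Set.mem_image_of_mem _ hi)]
  have hnbr := hp.neighborSet_toSubgraph_internal (by grind) (show i < p.length by grind)
  exact Set.ext_iff.1 hnbr x

theorem inducedPath_getVert (hp : p.IsCycle) (hm : p.length = m + 1)
    (hadj : ∀ v ∈ p.support, v ≠ w → ∀ x, G.Adj v x ↔ p.toSubgraph.Adj v x) :
    InducedPath G p.getVert 1 m where
  injOn := hp.getVert_injOn.mono (Set.Icc_subset_Icc_right (by omega))
  adj_iff i hi j hj := by
    rw [adj_getVert_iff hp hm hadj hi]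
    have hinj : ∀ a, 1 ≤ a → a ≤ m + 1 → (p.getVert j = p.getVert a ↔ j = a) := fun a h1 h2 =>
      hp.getVert_injOn.eq_iff ⟨hj.1, by grind⟩ ⟨h1, by grind⟩
    have hlast : p.getVert 0 = p.getVert (m + 1) :=
      p.getVert_zero.trans (hm ▸ p.getVert_length).symm
    have hprev : p.getVert j = p.getVert (i - 1) ↔ i = j + 1 := by
      rcases hi.1.eq_or_lt with rfl | hlt
      · rw [Nat.sub_self, hlast, hinj (m + 1) (by omega) le_rfl]
        grind
      · rw [hinj (i - 1) (by omega) (by grind)]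
        omega
    rw [hprev, hinj (i + 1) (by omega) (by grind)]

theorem attached_getVert (hp : p.IsCycle) (hm : p.length = m + 1)
    (hadj : ∀ v ∈ p.support, v ≠ w → ∀ x, G.Adj v x ↔ p.toSubgraph.Adj v x)
    {S : Set V} (hw : w ∈ S) (hS : Disjoint S (p.getVert '' Set.Icc 1 m)) :
    Attached G S (p.getVert '' Set.Icc 1 m) w {p.getVert 1, p.getVert m} where
  disjoint := hS
  root_mem := hw
  subset := by
    have := hp.three_le_length
    exact Set.pair_subset ⟨1, ⟨le_rfl, by omega⟩, rfl⟩ ⟨m, ⟨by omega, le_rfl⟩, rfl⟩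
  adj_iff := by
    rintro x hx _ ⟨i, hi, rfl⟩
    have hlast : p.getVert (m + 1) = w := hm ▸ p.getVert_length
    have hinj := (inducedPath_getVert hp hm hadj).injOn
    have hxi : ∀ j ∈ Set.Icc 1 m, x ≠ p.getVert j := fun j hj =>
      hS.ne_of_mem hx (Set.mem_image_of_mem _ hj)
    have h1 : p.getVert i = p.getVert 1 ↔ i = 1 := hinj.eq_iff hi (by grind)
    have hm' : p.getVert i = p.getVert m ↔ i = m := hinj.eq_iff hi (by grind)
    rw [G.adj_comm, adj_getVert_iff hp hm hadj hi, Set.mem_insert_iff, Set.mem_singleton_iff, h1,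
      hm']
    have := p.getVert_zero
    grind

theorem disjoint_image_getVert (hp : p.IsCycle) (hm : p.length = m + 1)
    (hadj : ∀ v ∈ p.support, v ≠ w → ∀ x, G.Adj v x ↔ p.toSubgraph.Adj v x) {S : Set V}
    (hS : S = {x | (G.deleteEdges p.toSubgraph.edgeSet).Reachable w x}) :
    Disjoint S (p.getVert '' Set.Icc 1 m) := by
  refine Set.disjoint_left.2 fun x hx => ?_
  rw [hS] at hx
  refine mem_of_reachable (S := (p.getVert '' Set.Icc 1 m)ᶜ) hx (notMem_image_getVert hp hm) ?_
  intro x _ y hxy hy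
  rw [SimpleGraph.deleteEdges_adj, G.adj_comm, adj_iff_toSubgraph_adj hp hm hadj hy] at hxy
  exact hxy.2 hxy.1.symm

theorem union_image_getVert (hp : p.IsCycle) (hm : p.length = m + 1)
    (hadj : ∀ v ∈ p.support, v ≠ w → ∀ x, G.Adj v x ↔ p.toSubgraph.Adj v x)
    (hconn : G.Connected) {S : Set V}
    (hS : S = {x | (G.deleteEdges p.toSubgraph.edgeSet).Reachable w x}) :
    S ∪ p.getVert '' Set.Icc 1 m = Set.univ := by
  subst hS
  refine Set.eq_univ_of_forall fun x => mem_of_reachable (hconn.preconnected w x) (.inl .rfl) ?_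
  intro u hu v huv
  by_cases h : p.toSubgraph.Adj u v
  · have hv := p.toSubgraph.edge_vert h.symm
    rw [SimpleGraph.Walk.mem_verts_toSubgraph] at hv
    rcases mem_image_getVert_or_eq hm hv with hv | rfl
    exacts [.inr hv, .inl .rfl]
  · have huv' : (G.deleteEdges p.toSubgraph.edgeSet).Adj u v :=
      SimpleGraph.deleteEdges_adj.2 ⟨huv, h⟩
    rcases hu with hu | hu
    · exact .inl (hu.trans huv'.reachable)
    · exact absurd ((adj_iff_toSubgraph_adj hp hm hadj hu v).1 huv) h

end UniqueCycle

theorem IsPottedGraph.exists_cycleWithTree [Finite V] {m : ℕ} (h : IsPottedGraph G (m + 1)) :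
    ∃ t S r c, CycleWithTree G m t S r c := by
  obtain ⟨w, p, hp, hm, huniq, hadj⟩ := h.exists_isCycle
  obtain ⟨t, ht⟩ := exists_realizes (isAcyclic_deleteEdges huniq) w
  have hdisj := disjoint_image_getVert hp hm hadj rfl
  refine ⟨t, _, w, p.getVert, ht.of_adj_iff fun x hx y hy => ?_, inducedPath_getVert hp hm hadj,
    attached_getVert hp hm hadj .rfl hdisj, union_image_getVert hp hm hadj h.1 rfl⟩
  rw [SimpleGraph.deleteEdges_adj, iff_self_and]
  intro _ hxy
  rcases mem_image_getVert_of_adj hm hxy with h | h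
  exacts [Set.disjoint_left.1 hdisj hx h, Set.disjoint_left.1 hdisj hy h]

end Reachability

/-! ### The extremal families -/

theorem Attached.union_left {V : Type u} {G : SimpleGraph V} {S S₁ S₂ N : Set V} {r : V}
    (h : Attached G S₁ S₂ r N) (hd : Disjoint S S₂) (hadj : ∀ x ∈ S, ∀ y ∈ S₂, ¬G.Adj x y) :
    Attached G (S₁ ∪ S) S₂ r N where
  disjoint := Set.disjoint_union_left.2 ⟨h.disjoint, hd⟩
  root_mem := .inl h.root_mem
  subset := h.subset
  adj_iff := by
    rintro x (hx | hx) y hy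
    · exact h.adj_iff x hx y hy
    · refine iff_of_false (hadj x hx y hy) ?_
      rintro ⟨rfl, hyN⟩
      exact hadj x hx y hy ((h.adj_iff x h.root_mem y hy).2 ⟨rfl, hyN⟩)

section Glue

variable {ι : Type} (T : ι → PointedGraph) {i j : ι}

open Classical in
/-- The inclusion of `T i` in the glued graph. -/
noncomputable def glueIn (i : ι) (x : (T i).Vert) : (glue T).Vert :=
  if h : x = (T i).base then none else some ⟨i, x, h⟩

/-- The vertices of the glued graph that come from `T i`, without the identified vertex. -/
def glueComponent (i : ι) : Set (glue T).Vert :=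
  Set.range fun x : {x : (T i).Vert // x ≠ (T i).base} => some ⟨i, x⟩

theorem glueIn_base (i : ι) : glueIn T i (T i).base = (glue T).base := dif_pos rfl

theorem glueIn_of_ne {x : (T i).Vert} (h : x ≠ (T i).base) : glueIn T i x = some ⟨i, x, h⟩ :=
  dif_neg h

theorem glueIn_mem_glueComponent {x : (T i).Vert} (h : x ≠ (T i).base) :
    glueIn T i x ∈ glueComponent T i :=
  ⟨⟨x, h⟩, (glueIn_of_ne T h).symm⟩

theorem image_glueIn_compl (i : ι) : glueIn T i '' {(T i).base}ᶜ = glueComponent T i := by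
  refine Set.Subset.antisymm (Set.image_subset_iff.2 fun x hx => glueIn_mem_glueComponent T hx) ?_
  rintro _ ⟨x, rfl⟩
  exact ⟨x, x.2, glueIn_of_ne T x.2⟩

theorem range_glueIn (i : ι) : Set.range (glueIn T i) = {(glue T).base} ∪ glueComponent T i := by
  rw [← Set.image_univ, ← Set.union_compl_self {(T i).base}, Set.image_union, image_glueIn_compl,
    Set.image_singleton, glueIn_base]

theorem glueIn_injective (i : ι) : Function.Injective (glueIn T i) := by
  intro x y h
  unfold glueIn at h
  grind

theorem adj_glueIn_iff (i : ι) (x y : (T i).Vert) :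
    (glue T).graph.Adj (glueIn T i x) (glueIn T i y) ↔ (T i).graph.Adj x y := by
  change GlueAdj T _ _ ↔ _
  by_cases hx : x = (T i).base <;> by_cases hy : y = (T i).base
  · rw [hx, hy, glueIn_base]
    exact ⟨nofun, fun h => absurd rfl h.ne⟩
  · rw [hx, glueIn_base, glueIn_of_ne T hy]
    exact ⟨fun | .fromBase _ _ h => h, .fromBase i ⟨y, hy⟩⟩
  · rw [hy, glueIn_base, glueIn_of_ne T hx]
    exact ⟨fun | .toBase _ _ h => h, .toBase i ⟨x, hx⟩⟩
  · rw [glueIn_of_ne T hx, glueIn_of_ne T hy]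
    exact ⟨fun | .inner _ _ _ h => h, .inner i ⟨x, hx⟩ ⟨y, hy⟩⟩

theorem isoOn_glueIn (i : ι) :
    IsoOn (T i).graph (glue T).graph (glueIn T i) Set.univ (Set.range (glueIn T i)) := by
  rw [← Set.image_univ]
  exact .of_injOn (glueIn_injective T i).injOn fun x _ y _ => adj_glueIn_iff T i x y

theorem union_glueComponent_eq_univ {J : Set ι} (hJ : ∀ i, i ∈ J) :
    {(glue T).base} ∪ ⋃ i ∈ J, glueComponent T i = Set.univ := by
  refine Set.eq_univ_of_forall ?_
  rintro (_ | ⟨i, x⟩)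
  · exact .inl rfl
  · exact .inr (Set.mem_biUnion (hJ i) ⟨x, rfl⟩)

theorem disjoint_glueComponent (hij : i ≠ j) :
    Disjoint (glueComponent T i) (glueComponent T j) := by
  refine Set.disjoint_left.2 ?_
  rintro _ ⟨x, rfl⟩ ⟨y, h⟩
  cases h
  exact hij rfl

theorem not_adj_of_mem_glueComponent (hij : i ≠ j) {x y : (glue T).Vert}
    (hx : x ∈ glueComponent T i) (hy : y ∈ glueComponent T j) : ¬(glue T).graph.Adj x y := by
  obtain ⟨x, rfl⟩ := hx
  obtain ⟨y, rfl⟩ := hy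
  rintro ⟨⟩
  exact hij rfl

variable {T} in
theorem attached_image_glueIn {S N : Set (T i).Vert}
    (h : Attached (T i).graph {(T i).base} S (T i).base N) {J : Set ι} (hi : i ∉ J) :
    Attached (glue T).graph ({(glue T).base} ∪ ⋃ j ∈ J, glueComponent T j) (glueIn T i '' S)
      (glue T).base (glueIn T i '' N) := by
  have hS : glueIn T i '' S ⊆ glueComponent T i := by
    rw [← image_glueIn_compl]
    exact Set.image_mono fun x hx hxb => Set.disjoint_left.1 h.disjoint hxb hx
  have hne : ∀ j ∈ J, j ≠ i := fun j hj hji => hi (hji ▸ hj)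
  have hbase := (isoOn_glueIn T i).attached h (Set.subset_univ _) (Set.subset_univ _)
  rw [Set.image_singleton, glueIn_base] at hbase
  refine hbase.union_left (Set.disjoint_iUnion₂_left.2 fun j hj =>
    (disjoint_glueComponent T (hne j hj)).mono_right hS) fun x hx y hy => ?_
  obtain ⟨j, hj, hx⟩ := Set.mem_iUnion₂.1 hx
  exact not_adj_of_mem_glueComponent T (hne j hj) hx (hS hy)

end Glue

/-- The pointed graph `T` is the rooted tree `t`. -/
def HasShape (T : PointedGraph) (t : BranchTree) : Prop := Realizes T.graph t Set.univ T.base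

theorem HasShape.exists_branch {T : PointedGraph} {a : BranchTree}
    (h : HasShape T (join single a)) :
    ∃ c, Realizes T.graph a {T.base}ᶜ c ∧
      Attached T.graph {T.base} {T.base}ᶜ T.base {c} := by
  obtain ⟨_, S, c, rfl, ha, hS, hadj⟩ := h
  obtain rfl : S = {T.base}ᶜ :=
    (IsCompl.compl_eq ⟨hadj.disjoint, codisjoint_iff.2 hS.symm⟩).symm
  exact ⟨c, ha, hadj⟩

theorem realizes_glue {ι : Type} {T : ι → PointedGraph} {a : ι → BranchTree}
    (h : ∀ i, HasShape (T i) (join single (a i))) (l : List ι) (hl : l.Nodup) :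
    Realizes (glue T).graph (ofBranches (l.map a))
      ({(glue T).base} ∪ ⋃ i ∈ {i | i ∈ l}, glueComponent T i) (glue T).base := by
  induction l with
  | nil => simp [Realizes, ofBranches]
  | cons i l ih =>
    obtain ⟨hi, hl⟩ := List.nodup_cons.1 hl
    obtain ⟨c, ha, hadj⟩ := (h i).exists_branch
    have hunion : {(glue T).base} ∪ ⋃ j ∈ {j | j ∈ i :: l}, glueComponent T j =
        ({(glue T).base} ∪ ⋃ j ∈ {j | j ∈ l}, glueComponent T j) ∪ glueIn T i '' {(T i).base}ᶜ := by
      rw [image_glueIn_compl, Set.union_assoc, Set.union_comm _ (glueComponent T i),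
        ← Set.biUnion_insert]
      exact congrArg (_ ∪ ⋃ j ∈ ·, glueComponent T j) (Set.ext fun _ => List.mem_cons)
    have hbranch := attached_image_glueIn hadj (J := {j | j ∈ l}) hi
    rw [Set.image_singleton] at hbranch
    exact ⟨_, _, glueIn T i c, ih hl, ((isoOn_glueIn T i).mono (Set.subset_univ _)).realizes ha,
      hunion, hbranch⟩

/-- `T` has a single edge at its base, leading to the root of `a`. -/
def HasBranch (T : PointedGraph) (a : BranchTree) : Prop := HasShape T (join single a)

theorem hasShape_glueList {L : List PointedGraph} {A : List BranchTree}
    (h : List.Forall₂ HasBranch L A) : HasShape (glueList L) (ofBranches A) := by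
  obtain ⟨hlen, hget⟩ := List.forall₂_iff_get.1 h
  have hglue := realizes_glue (T := fun i : Fin L.length => L.get i)
    (a := fun i => A.get (i.cast hlen)) (fun i => hget i.1 i.2 _) (List.finRange L.length)
    (List.nodup_finRange _)
  have hA : (List.finRange L.length).map (fun i => A.get (i.cast hlen)) = A :=
    List.ext_get (by simp [hlen]) (by simp)
  rw [hA, union_glueComponent_eq_univ _ (J := {i | i ∈ List.finRange L.length})
    List.mem_finRange] at hglue
  exact hglue

section CycleWithTree

variable {m : ℕ}

theorem cycleWithTree_cycleGraph_zero (hm : 1 ≤ m) :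
    CycleWithTree (SimpleGraph.cycleGraph (m + 1)) m single {0} 0 (Fin.ofNat (m + 1)) := by
  have hval : ∀ i ≤ m, (Fin.ofNat (m + 1) i).val = i := fun i hi => Nat.mod_eq_of_lt (by omega)
  have hinj : ∀ i ≤ m, ∀ j ≤ m, Fin.ofNat (m + 1) i = Fin.ofNat (m + 1) j ↔ i = j :=
    fun i hi j hj => by rw [Fin.ext_iff, hval i hi, hval j hj]
  have hadj : ∀ i ≤ m, ∀ j ≤ m, (SimpleGraph.cycleGraph (m + 1)).Adj (Fin.ofNat (m + 1) i)
      (Fin.ofNat (m + 1) j) ↔ i = j + 1 ∨ j = i + 1 ∨ (i = 0 ∧ j = m) ∨ (i = m ∧ j = 0) := by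
    intro i hi j hj
    rw [SimpleGraph.cycleGraph_adj', Fin.sub_def, Fin.sub_def]
    simp only [hval i hi, hval j hj]
    rcases lt_trichotomy i j with h | rfl | h
    · rw [Nat.mod_eq_of_lt (by omega), Nat.mod_eq_sub_mod (by omega), Nat.mod_eq_of_lt (by omega)]
      omega
    · rw [Nat.sub_add_cancel (by omega), Nat.mod_self]
      omega
    · rw [Nat.mod_eq_sub_mod (by omega), Nat.mod_eq_of_lt (by omega), Nat.mod_eq_of_lt (by omega)]
      omega
  have h0 : (0 : Fin (m + 1)) = Fin.ofNat (m + 1) 0 := rfl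
  refine ⟨rfl, ⟨fun i hi j hj hij => (hinj i hi.2 j hj.2).1 hij, fun i hi j hj => ?_⟩,
    ⟨?_, rfl, Set.pair_subset ⟨1, by grind⟩ ⟨m, by grind⟩, ?_⟩, ?_⟩
  · rw [hadj i hi.2 j hj.2]
    grind
  · rw [Set.disjoint_singleton_left]
    rintro ⟨i, hi, h⟩
    have := (hinj i hi.2 0 (Nat.zero_le m)).1 h
    grind
  · rintro _ rfl _ ⟨i, hi, rfl⟩
    simp only [Set.mem_insert_iff, Set.mem_singleton_iff, hinj i hi.2 1 hm, hinj i hi.2 m le_rfl]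
    rw [h0, hadj 0 (Nat.zero_le m) i hi.2]
    grind
  · refine Set.eq_univ_of_forall fun x => ?_
    rcases Nat.eq_zero_or_pos x.val with h | h
    · exact .inl (Fin.ext h)
    · exact .inr ⟨x, ⟨h, x.is_le⟩, Fin.ext (hval x x.is_le)⟩

theorem exists_cycleWithTree_cycleGraph (hm : 1 ≤ m) (r : Fin (m + 1)) :
    ∃ c, CycleWithTree (SimpleGraph.cycleGraph (m + 1)) m single {r} r c := by
  let e : SimpleGraph.cycleGraph (m + 1) ≃g SimpleGraph.cycleGraph (m + 1) :=
    ⟨Equiv.addLeft r, by simp [SimpleGraph.cycleGraph_adj']⟩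
  have he : e 0 = r := add_zero r
  have h := (cycleWithTree_cycleGraph_zero hm).map e
  rw [Set.image_singleton, he] at h
  exact ⟨_, h⟩

theorem CycleWithTree.range_eq {V : Type u} {G : SimpleGraph V} {r : V} {c : ℕ → V}
    (h : CycleWithTree G m single {r} r c) : c '' Set.Icc 1 m = {r}ᶜ :=
  (IsCompl.compl_eq ⟨h.attached.disjoint, codisjoint_iff.2 h.union_eq⟩).symm

theorem CycleWithTree.glue {ι : Type} {T : ι → PointedGraph} {i j : ι} (hij : i ≠ j)
    (hι : ∀ a, a = i ∨ a = j) {t : BranchTree} {c : ℕ → (T i).Vert}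
    (hc : CycleWithTree (T i).graph m single {(T i).base} (T i).base c) (ht : HasShape (T j) t) :
    CycleWithTree (glue T).graph m t (Set.range (glueIn T j)) (glue T).base
      (glueIn T i ∘ c) where
  realizes := glueIn_base T j ▸ (isoOn_glueIn T j).realizes ht
  inducedPath := (isoOn_glueIn T i).inducedPath hc.inducedPath (Set.subset_univ _)
  attached := by
    have h := attached_image_glueIn hc.attached (J := {j}) hij
    rwa [Set.biUnion_singleton, ← range_glueIn, Set.image_pair, ← Set.image_comp] at h
  union_eq := by
    rw [Set.image_comp, hc.range_eq, image_glueIn_compl, range_glueIn]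
    refine Set.eq_univ_of_forall ?_
    rintro (_ | ⟨a, x⟩)
    · exact .inl (.inl rfl)
    · obtain rfl | rfl := hι a
      exacts [.inr ⟨x, rfl⟩, .inl (.inr ⟨x, rfl⟩)]

theorem CycleWithTree.sum {W X : Type} {C : SimpleGraph W} {H : SimpleGraph X} {w : W} {x : X}
    {t : BranchTree} {c : ℕ → W} (hc : CycleWithTree C m single {w} w c)
    (ht : Realizes H t Set.univ x) :
    CycleWithTree (SimpleGraph.sum C H ⊔ SimpleGraph.edge (Sum.inl w) (Sum.inr x)) m
      (join single t) ({Sum.inl w} ∪ Set.range Sum.inr) (Sum.inl w) (Sum.inl ∘ c) := by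
  set K := SimpleGraph.sum C H ⊔ SimpleGraph.edge (Sum.inl w) (Sum.inr x) with hK
  have hadj : ∀ a b, K.Adj (Sum.inl a) (Sum.inr b) ↔ a = w ∧ b = x := by
    simp [hK, SimpleGraph.edge_adj]
  have hl : IsoOn C K Sum.inl Set.univ (Sum.inl '' Set.univ) :=
    .of_injOn Sum.inl_injective.injOn (by simp [hK, SimpleGraph.edge_adj])
  have hr : IsoOn H K Sum.inr Set.univ (Sum.inr '' Set.univ) :=
    .of_injOn Sum.inr_injective.injOn (by simp [hK, SimpleGraph.edge_adj])
  have hcycle := hl.attached hc.attached (Set.subset_univ _) (Set.subset_univ _)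
  rw [Set.image_singleton, Set.image_pair, ← Set.image_comp] at hcycle
  refine ⟨⟨{Sum.inl w}, Set.range Sum.inr, Sum.inr x, rfl, Set.image_univ ▸ hr.realizes ht, rfl,
    by simp, rfl, by simp, ?_⟩, hl.inducedPath hc.inducedPath (Set.subset_univ _),
    hcycle.union_left ?_ ?_, ?_⟩
  · rintro _ rfl _ ⟨b, rfl⟩
    simp [hadj]
  · rw [Set.disjoint_left]
    rintro _ ⟨b, rfl⟩ ⟨i, -, h⟩
    cases h
  · rintro _ ⟨b, rfl⟩ _ ⟨i, hi, rfl⟩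
    rw [K.adj_comm, Function.comp_apply, hadj]
    rintro ⟨h, -⟩
    exact Set.disjoint_left.1 hc.attached.disjoint rfl (h ▸ Set.mem_image_of_mem c hi)
  · rw [Set.image_comp, hc.range_eq]
    refine Set.eq_univ_of_forall ?_
    rintro (a | b)
    · by_cases h : a = w
      exacts [.inl (.inl (congrArg _ h)), .inr ⟨a, h, rfl⟩]
    · exact .inl (.inr ⟨b, rfl⟩)

variable {V : Type u} {G : SimpleGraph V} {T : PointedGraph} {t : BranchTree}

theorem isCycleGlue_iff (hm : 1 ≤ m) (hT : HasShape T t) :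
    IsCycleGlue G (m + 1) T ↔ ∃ S r c, CycleWithTree G m t S r c := by
  have hglue : ∀ r : Fin (m + 1), ∃ S q c, CycleWithTree
      (glueList [⟨Fin (m + 1), SimpleGraph.cycleGraph (m + 1), r⟩, T]).graph m t S q c := by
    intro r
    obtain ⟨c, hc⟩ := exists_cycleWithTree_cycleGraph hm r
    let F : Fin 2 → PointedGraph := [⟨Fin (m + 1), SimpleGraph.cycleGraph (m + 1), r⟩, T].get
    exact ⟨_, _, _, CycleWithTree.glue (T := F) (i := 0) (j := 1) (by decide) (by decide) hc hT⟩
  constructor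
  · rintro ⟨r, ⟨e⟩⟩
    obtain ⟨S, q, c, h⟩ := hglue r
    exact ⟨_, _, _, h.map e.symm⟩
  · rintro ⟨S, r, c, h⟩
    obtain ⟨S', q, c', h'⟩ := hglue 0
    obtain ⟨m, rfl⟩ := Nat.exists_eq_add_of_le' hm
    exact ⟨0, h.nonempty_iso h'⟩

theorem isCycleJoin_iff (hm : 1 ≤ m) (hT : HasShape T t) :
    IsCycleJoin G (m + 1) T ↔ ∃ S r c, CycleWithTree G m (join single t) S r c := by
  constructor
  · rintro ⟨r, ⟨e⟩⟩
    obtain ⟨c, hc⟩ := exists_cycleWithTree_cycleGraph hm r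
    exact ⟨_, _, _, (hc.sum hT).map e.symm⟩
  · rintro ⟨S, r, c, h⟩
    obtain ⟨d, hd⟩ := exists_cycleWithTree_cycleGraph hm 0
    obtain ⟨m, rfl⟩ := Nat.exists_eq_add_of_le' hm
    exact ⟨0, h.nonempty_iso (hd.sum hT)⟩

end CycleWithTree

theorem hasShape_pathGraph (m : ℕ) :
    HasShape ⟨Fin (m + 1), SimpleGraph.pathGraph (m + 1), 0⟩ (path m) := by
  have hval : ∀ i ≤ m, (Fin.ofNat (m + 1) i).val = i := fun i hi => Nat.mod_eq_of_lt (by lia)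
  have h : InducedPath (SimpleGraph.pathGraph (m + 1)) (Fin.ofNat (m + 1)) 0 (0 + m) := by
    constructor
    · intro i hi j hj hij
      rw [← hval i (by grind), ← hval j (by grind), hij]
    · intro i hi j hj
      rw [SimpleGraph.pathGraph_adj, hval i (by grind), hval j (by grind)]
      lia
  have huniv : Fin.ofNat (m + 1) '' Set.Icc 0 (0 + m) = Set.univ :=
    Set.eq_univ_of_forall fun x => ⟨x, by grind, Fin.ext (hval x x.is_le)⟩
  have hpath := h.realizes
  rwa [huniv] at hpath

theorem hasBranch_P2 : HasBranch P2 single := hasShape_pathGraph 1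

theorem hasBranch_P3 : HasBranch P3 edge := hasShape_pathGraph 2

theorem hasBranch_P4 : HasBranch P4 pathEnd := hasShape_pathGraph 3

theorem hasBranch_K13 : HasBranch K13 pathMid := by
  suffices Realizes (completeBipartiteGraph (Fin 1) (Fin 3)) (join single pathMid) Set.univ
    (Sum.inr 0) from this
  refine ⟨{Sum.inr 0}, {Sum.inl 0, Sum.inr 1, Sum.inr 2}, Sum.inl 0, rfl,
    ⟨{Sum.inl 0, Sum.inr 1}, {Sum.inr 2}, Sum.inr 2,
      ⟨{Sum.inl 0}, {Sum.inr 1}, Sum.inr 1, rfl, rfl, ?_, ?_, ?_, ?_, ?_⟩,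
      rfl, ?_, ?_, ?_, ?_, ?_⟩, ?_, ?_, ?_, ?_, ?_⟩
  all_goals simp [Set.ext_iff, Fin.forall_fin_succ]

section Lists

variable {L₀ L : List PointedGraph} {B : List BranchTree}

theorem IsP4K13List.exists_perm (hL : IsP4K13List L) :
    ∃ e p, L.Perm (List.replicate e P4 ++ List.replicate p K13) := by
  induction L with
  | nil => exact ⟨0, 0, .nil⟩
  | cons T L ih =>
    obtain ⟨e, p, h⟩ := ih fun T hT => hL T (List.mem_cons_of_mem _ hT)
    rcases hL T List.mem_cons_self with rfl | rfl
    · exact ⟨e + 1, p, h.cons P4⟩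
    · exact ⟨e, p + 1, (h.cons K13).trans List.perm_middle.symm⟩

theorem isP4K13List_replicate (e p : ℕ) :
    IsP4K13List (List.replicate e P4 ++ List.replicate p K13) := by
  intro T hT
  exact (List.mem_append.1 hT).imp List.eq_of_mem_replicate List.eq_of_mem_replicate

theorem forall₂_hasBranch_replicate (e p : ℕ) :
    List.Forall₂ HasBranch (List.replicate e P4 ++ List.replicate p K13)
      (List.replicate e pathEnd ++ List.replicate p pathMid) :=
  List.rel_append (by induction e <;> simp_all [List.replicate_succ, hasBranch_P4])
    (by induction p <;> simp_all [List.replicate_succ, hasBranch_K13])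

theorem hasShape_bouquet (h : List.Forall₂ HasBranch L₀ B) (e p : ℕ) :
    HasShape (glueList (L₀ ++ (List.replicate e P4 ++ List.replicate p K13)))
      (bouquet B e p) :=
  hasShape_glueList (List.rel_append h (forall₂_hasBranch_replicate e p))

theorem hasShape_bouquet_replicate (h : List.Forall₂ HasBranch L₀ B) (e : ℕ) :
    HasShape (glueList (L₀ ++ List.replicate e P4)) (bouquet B e 0) := by
  simpa using hasShape_bouquet h e 0

theorem IsP4K13List.exists_hasShape_bouquet (hL : IsP4K13List L)
    (h : List.Forall₂ HasBranch L₀ B) :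
    ∃ e p, HasShape (glueList (L₀ ++ L)) (bouquet B e p) := by
  obtain ⟨e, p, hperm⟩ := hL.exists_perm
  obtain ⟨l, hLl, hl⟩ := List.perm_comp_forall₂ hperm (forall₂_hasBranch_replicate e p)
  refine ⟨e, p, (hasShape_glueList (List.rel_append h hLl)).of_branches_eq ?_⟩
  rw [branches_ofBranches, bouquet, branches_ofBranches]
  exact Multiset.coe_eq_coe.2 (hl.append_left B)

theorem exists_isP4K13List_iff (h : List.Forall₂ HasBranch L₀ B) {Q : PointedGraph → Prop}
    {P : BranchTree → Prop} (hQP : ∀ {T t}, HasShape T t → (Q T ↔ P t)) :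
    (∃ L, IsP4K13List L ∧ Q (glueList (L₀ ++ L))) ↔ ∃ e p, P (bouquet B e p) := by
  constructor
  · rintro ⟨L, hL, hQ⟩
    obtain ⟨e, p, hT⟩ := hL.exists_hasShape_bouquet h
    exact ⟨e, p, (hQP hT).1 hQ⟩
  · rintro ⟨e, p, hP⟩
    exact ⟨_, isP4K13List_replicate e p, (hQP (hasShape_bouquet h e p)).2 hP⟩

end Lists

section Families

variable {V : Type u} {G : SimpleGraph V} {m : ℕ}

theorem inG1_iff (hm : 1 ≤ m) : InG1 G (m + 1) ↔
    ∃ e S r c, CycleWithTree G m (join single (bouquet [edge] e 0)) S r c :=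
  exists_congr fun e => isCycleJoin_iff hm (hasShape_bouquet_replicate (.cons hasBranch_P3 .nil) e)

theorem inG2_iff (hm : 1 ≤ m) : InG2 G (m + 1) ↔
    ∃ e p S r c, CycleWithTree G m (join single (bouquet [single, edge] e p)) S r c :=
  exists_isP4K13List_iff (.cons hasBranch_P2 (.cons hasBranch_P3 .nil)) (isCycleJoin_iff hm)

theorem inG6_iff (hm : 1 ≤ m) : InG6 G (m + 1) ↔
    ∃ e p S r c, CycleWithTree G m (bouquet [edge] e p) S r c :=
  exists_isP4K13List_iff (.cons hasBranch_P3 .nil) (isCycleGlue_iff hm)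

theorem inG7_iff (hm : 1 ≤ m) : InG7 G (m + 1) ↔
    ∃ e p S r c, CycleWithTree G m (bouquet [single, single] e p) S r c :=
  exists_isP4K13List_iff (.cons hasBranch_P2 (.cons hasBranch_P2 .nil)) (isCycleGlue_iff hm)

theorem inG8_iff (hm : 1 ≤ m) : InG8 G (m + 1) ↔
    ∃ e, 1 ≤ e ∧ ∃ S r c, CycleWithTree G m (bouquet [] e 0) S r c :=
  exists_congr fun e => and_congr_right fun _ =>
    isCycleGlue_iff hm (hasShape_bouquet_replicate .nil e)

theorem inG9_iff (hm : 1 ≤ m) : InG9 G (m + 1) ↔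
    ∃ e p S r c, CycleWithTree G m (bouquet [single] e p) S r c :=
  exists_isP4K13List_iff (.cons hasBranch_P2 .nil) (isCycleGlue_iff hm)

end Families

namespace BranchTree

theorem order_bouquet (B : List BranchTree) (e p : ℕ) :
    (bouquet B e p).order = (B.map order).sum + 3 * (e + p) + 1 := by
  have h : ∀ l, (ofBranches l).order = (l.map order).sum + 1 := by
    intro l
    induction l with
    | nil => rfl
    | cons s l ih => rw [ofBranches, order, ih, List.map_cons, List.sum_cons]; ring
  simp only [bouquet, h, List.map_append, List.map_replicate, List.sum_append, List.sum_replicate,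
    pathEnd, pathMid, edge, order, smul_eq_mul]
  ring

theorem bouquet_cons (s : BranchTree) (B : List BranchTree) (e p : ℕ) :
    bouquet (s :: B) e p = join (bouquet B e p) s := rfl

theorem counts_bouquet_nil (e p : ℕ) : (bouquet [] e p).counts = .forced (3 ^ (e + p)) 1 e := by
  have hmid : (bouquet [] 0 p).counts = .forced (3 ^ p) 1 0 := by
    induction p with
    | zero => rfl
    | succ p ih =>
      have h : bouquet [] 0 (p + 1) = join (bouquet [] 0 p) pathMid := rfl
      simp [h, counts, ih, RootCounts.join, pathMid, edge, pow_succ]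
  induction e with
  | zero => rw [hmid, zero_add]
  | succ e ih =>
    have h : bouquet [] (e + 1) p = join (bouquet [] e p) pathEnd := rfl
    simp [h, counts, ih, RootCounts.join, pathEnd, edge, pow_succ, add_right_comm]

variable (t e p : ℕ)

theorem pottedCount_bouquet_nil :
    (bouquet [] e p).counts.pottedCount t = (t + 1) * 3 ^ (e + p) + (2 * t + 1) + e := by
  simp [counts_bouquet_nil, RootCounts.pottedCount]

theorem pottedCount_bouquet_single :
    (bouquet [single] e p).counts.pottedCount t = (t + 1) * 3 ^ (e + p) + 1 := by
  simp [bouquet_cons, counts, counts_bouquet_nil, RootCounts.join, RootCounts.pottedCount]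

theorem pottedCount_bouquet_edge :
    (bouquet [edge] e p).counts.pottedCount t = (t + 1) * 3 ^ (e + p) := by
  simp [bouquet_cons, counts, counts_bouquet_nil, RootCounts.join, RootCounts.pottedCount, edge]

theorem pottedCount_bouquet_single_single :
    (bouquet [single, single] e p).counts.pottedCount t = (t + 1) * 3 ^ (e + p) := by
  simp [bouquet_cons, counts, counts_bouquet_nil, RootCounts.join, RootCounts.pottedCount]

theorem pottedCount_join_bouquet_edge :
    (join single (bouquet [edge] e p)).counts.pottedCount t =
      (t + 1) * (3 ^ (e + p) + e + 2) + (2 * t + 1) * 3 ^ (e + p) + 1 := by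
  simp [bouquet_cons, counts, counts_bouquet_nil, RootCounts.join, RootCounts.pottedCount, edge]
  ring

theorem pottedCount_join_bouquet_single_edge :
    (join single (bouquet [single, edge] e p)).counts.pottedCount t =
      (3 * t + 2) * 3 ^ (e + p) + (t + 1) := by
  simp [bouquet_cons, counts, counts_bouquet_nil, RootCounts.join, RootCounts.pottedCount, edge]
  ring

end BranchTree

theorem le_max_and_eq_iff {α : Type*} [LinearOrder α] {w a b : α} {P Q : Prop}
    (h : (w = b ∧ Q) ∨ (w = a ∧ P) ∨ w < b ∨ w < a) (hP : P → w = a) (hQ : Q → w = b) :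
    w ≤ max a b ∧ (w = max a b ↔ (P ∧ a = max a b) ∨ (Q ∧ b = max a b)) := by
  refine ⟨?_, fun hw => ?_, ?_⟩
  · rcases h with h | h | h | h
    exacts [le_max_of_le_right h.1.le, le_max_of_le_left h.1.le, le_max_of_le_right h.le,
      le_max_of_le_left h.le]
  · rcases h with h | h | h | h
    · exact .inr ⟨h.2, h.1 ▸ hw⟩
    · exact .inl ⟨h.2, h.1 ▸ hw⟩
    · exact absurd hw (lt_max_of_lt_right h).ne
    · exact absurd hw (lt_max_of_lt_left h).ne
  · rintro (⟨hp, h⟩ | ⟨hq, h⟩)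
    · rw [hP hp, ← h]
    · rw [hQ hq, ← h]

theorem three_zpow_sub_one {a : ℤ} {q : ℕ} (h : a = q) : (3 : ℚ) ^ (a - 1) = 3 ^ q / 3 := by
  rw [h, zpow_sub_one₀ three_ne_zero, zpow_natCast, div_eq_mul_inv]

/-- The bound in the case `n ≡ 1 (mod 3)`. -/
def boundOfModOne (n k : ℕ) : ℚ := (k + 1) * (3 : ℚ) ^ (((n : ℤ) - k - 2) / 3 - 1)

section Bounds

variable {n : ℕ} (m q : ℕ)

theorem x1_eq (hn : n = 3 * m + 3 * q + 9) :
    x1 n (3 * m + 5) = ((3 * (m + 1) + 2) * 3 ^ q + (m + 1 + 1) : ℕ) := by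
  rw [x1, three_zpow_sub_one (q := q + 1) (by push_cast; lia)]
  push_cast
  ring

theorem x2_eq (hn : n = 3 * m + 3 * q + 6) :
    x2 n (3 * m + 5) = ((m + 1 + 1) * 3 ^ q + 1 : ℕ) := by
  rw [x2, three_zpow_sub_one (q := q) (by push_cast; lia)]
  push_cast
  ring

theorem x3_eq (hn : n = 3 * m + 3 * q + 8) :
    x3 n (3 * m + 5) =
      ((m + 1 + 1) * (3 ^ q + q + 2) + (2 * (m + 1) + 1) * 3 ^ q + 1 : ℕ) := by
  rw [x3, three_zpow_sub_one (q := q + 1) (by push_cast; lia), hn]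
  push_cast
  ring

theorem x4_eq (hn : n = 3 * m + 3 * q + 5) :
    x4 n (3 * m + 5) = ((m + 1 + 1) * 3 ^ q + (2 * (m + 1) + 1) + q : ℕ) := by
  rw [x4, three_zpow_sub_one (q := q) (by push_cast; lia), hn]
  push_cast
  ring

theorem boundOfModOne_eq (hn : n = 3 * m + 3 * q + 7) :
    boundOfModOne n (3 * m + 5) = ((m + 1 + 1) * 3 ^ q : ℕ) := by
  rw [boundOfModOne, three_zpow_sub_one (q := q) (by push_cast; lia)]
  push_cast
  ring

end Bounds

section Extremal

variable {V : Type u} [Finite V] {G : SimpleGraph V} {m : ℕ}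

theorem InG1.numMaxDissociationSets_eq (hG : InG1 G (3 * m + 5)) :
    (numMaxDissociationSets G : ℚ) = x3 (Nat.card V) (3 * m + 5) := by
  obtain ⟨e, S, r, c, h⟩ := (inG1_iff (by lia)).1 hG
  rw [h.numMaxDissociationSets_eq, pottedCount_join_bouquet_edge, x3_eq m e]
  · simp
  · rw [h.card_eq]
    simp [order, order_bouquet, edge]
    ring

theorem InG2.numMaxDissociationSets_eq (hG : InG2 G (3 * m + 5)) :
    (numMaxDissociationSets G : ℚ) = x1 (Nat.card V) (3 * m + 5) := by
  obtain ⟨e, p, S, r, c, h⟩ := (inG2_iff (by lia)).1 hG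
  rw [h.numMaxDissociationSets_eq, pottedCount_join_bouquet_single_edge, x1_eq m (e + p)]
  rw [h.card_eq]
  simp [order, order_bouquet, edge]
  ring

theorem InG6.numMaxDissociationSets_eq (hG : InG6 G (3 * m + 5)) :
    (numMaxDissociationSets G : ℚ) = boundOfModOne (Nat.card V) (3 * m + 5) := by
  obtain ⟨e, p, S, r, c, h⟩ := (inG6_iff (by lia)).1 hG
  rw [h.numMaxDissociationSets_eq, pottedCount_bouquet_edge, boundOfModOne_eq m (e + p)]
  rw [h.card_eq]
  simp [order, order_bouquet, edge]
  ring

theorem InG7.numMaxDissociationSets_eq (hG : InG7 G (3 * m + 5)) :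
    (numMaxDissociationSets G : ℚ) = boundOfModOne (Nat.card V) (3 * m + 5) := by
  obtain ⟨e, p, S, r, c, h⟩ := (inG7_iff (by lia)).1 hG
  rw [h.numMaxDissociationSets_eq, pottedCount_bouquet_single_single, boundOfModOne_eq m (e + p)]
  rw [h.card_eq]
  simp [order, order_bouquet]
  ring

theorem InG8.numMaxDissociationSets_eq (hG : InG8 G (3 * m + 5)) :
    (numMaxDissociationSets G : ℚ) = x4 (Nat.card V) (3 * m + 5) := by
  obtain ⟨e, -, S, r, c, h⟩ := (inG8_iff (by lia)).1 hG
  rw [h.numMaxDissociationSets_eq, pottedCount_bouquet_nil, x4_eq m e]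
  · simp
  · rw [h.card_eq]
    simp [order_bouquet]
    ring

theorem InG9.numMaxDissociationSets_eq (hG : InG9 G (3 * m + 5)) :
    (numMaxDissociationSets G : ℚ) = x2 (Nat.card V) (3 * m + 5) := by
  obtain ⟨e, p, S, r, c, h⟩ := (inG9_iff (by lia)).1 hG
  rw [h.numMaxDissociationSets_eq, pottedCount_bouquet_single, x2_eq m (e + p)]
  rw [h.card_eq]
  simp [order, order_bouquet]
  ring

end Extremal

namespace CycleWithTree

variable {V : Type u} {G : SimpleGraph V} {k m s : ℕ} {T a : BranchTree} {S : Set V}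
  {r : V} {c : ℕ → V}

theorem bouquet {B : List BranchTree} {e p : ℕ} (h : CycleWithTree G k T S r c)
    (hT : IsBouquet B e p T) : CycleWithTree G k (bouquet B e p) S r c where
  __ := h
  realizes := h.realizes.of_branches_eq (hT.trans (isBouquet_bouquet B e p).symm)

theorem join_bouquet {B : List BranchTree} {e p : ℕ}
    (h : CycleWithTree G k (join single a) S r c) (ha : IsBouquet B e p a) :
    CycleWithTree G k (join single (BranchTree.bouquet B e p)) S r c where
  __ := h
  realizes := by
    obtain ⟨S₁, S₂, d, h₁, h₂, h₃⟩ := h.realizes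
    exact ⟨S₁, S₂, d, h₁, h₂.of_branches_eq (ha.trans (isBouquet_bouquet B e p).symm), h₃⟩

variable [Finite V]

theorem extremal_or_lt_of_mod_zero (h : CycleWithTree G (3 * m + 4) T S r c)
    (hT : T.order = 3 * s + 5) :
    ((numMaxDissociationSets G : ℚ) = x2 (Nat.card V) (3 * m + 5) ∧ InG9 G (3 * m + 5)) ∨
    ((numMaxDissociationSets G : ℚ) = x1 (Nat.card V) (3 * m + 5) ∧ InG2 G (3 * m + 5)) ∨
    (numMaxDissociationSets G : ℚ) < x2 (Nat.card V) (3 * m + 5) ∨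
    (numMaxDissociationSets G : ℚ) < x1 (Nat.card V) (3 * m + 5) := by
  have hcard := h.card_eq
  rw [inG2_iff (by lia), inG9_iff (by lia), x1_eq m s (by lia), x2_eq m (s + 1) (by lia),
    h.numMaxDissociationSets_eq]
  norm_cast
  rcases T.pottedCount_of_mod_one (t := m + 1) (by lia) hT with
    ⟨hw, e, p, hT⟩ | ⟨hw, a, e, p, rfl, ha⟩ | hw | hw
  · exact .inl ⟨hw, e, p, S, r, c, h.bouquet hT⟩
  · exact .inr (.inl ⟨hw, e, p, S, r, c, h.join_bouquet ha⟩)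
  · exact .inr (.inr (.inl hw))
  · exact .inr (.inr (.inr hw))

theorem le_and_eq_iff_of_mod_one (h : CycleWithTree G (3 * m + 4) T S r c)
    (hT : T.order = 3 * s + 3) :
    (numMaxDissociationSets G : ℚ) ≤ boundOfModOne (Nat.card V) (3 * m + 5) ∧
    ((numMaxDissociationSets G : ℚ) = boundOfModOne (Nat.card V) (3 * m + 5) ↔
      InG6 G (3 * m + 5) ∨ InG7 G (3 * m + 5)) := by
  have hcard := h.card_eq
  obtain ⟨hle, heq⟩ := T.pottedCount_le_of_mod_two (t := m + 1) (by lia) hT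
  rw [← h.numMaxDissociationSets_eq] at hle heq
  refine ⟨?_, fun hw => ?_, fun hG => hG.elim (·.numMaxDissociationSets_eq)
    (·.numMaxDissociationSets_eq)⟩
  · rw [boundOfModOne_eq m s (by lia)]
    exact_mod_cast hle
  · rw [boundOfModOne_eq m s (by lia)] at hw
    rw [inG6_iff (by lia), inG7_iff (by lia)]
    obtain ⟨e, p, hT | hT⟩ := heq (by exact_mod_cast hw)
    · exact .inl ⟨e, p, S, r, c, h.bouquet hT⟩
    · exact .inr ⟨e, p, S, r, c, h.bouquet hT⟩

theorem extremal_or_lt_of_mod_two (h : CycleWithTree G (3 * m + 4) T S r c)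
    (hT : T.order = 3 * s + 4) :
    ((numMaxDissociationSets G : ℚ) = x4 (Nat.card V) (3 * m + 5) ∧ InG8 G (3 * m + 5)) ∨
    ((numMaxDissociationSets G : ℚ) = x3 (Nat.card V) (3 * m + 5) ∧ InG1 G (3 * m + 5)) ∨
    (numMaxDissociationSets G : ℚ) < x4 (Nat.card V) (3 * m + 5) ∨
    (numMaxDissociationSets G : ℚ) < x3 (Nat.card V) (3 * m + 5) := by
  have hcard := h.card_eq
  rw [inG1_iff (by lia), inG8_iff (by lia), x3_eq m s (by lia), x4_eq m (s + 1) (by lia),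
    h.numMaxDissociationSets_eq]
  norm_cast
  rcases T.pottedCount_of_mod_zero (t := m + 1) (by lia) hT with
    ⟨hw, hT⟩ | ⟨hw, a, rfl, ha⟩ | hw | hw
  · exact .inl ⟨hw, s + 1, by lia, S, r, c, h.bouquet hT⟩
  · exact .inr (.inl ⟨hw, s, S, r, c, h.join_bouquet ha⟩)
  · exact .inr (.inr (.inl hw))
  · exact .inr (.inr (.inr hw))

end CycleWithTree

theorem IsPottedGraph.three_le {V : Type u} [Finite V] {G : SimpleGraph V} {k : ℕ}
    (h : IsPottedGraph G k) : 3 ≤ k := by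
  obtain ⟨w, p, hp, rfl, -⟩ := h.exists_isCycle
  exact hp.three_le_length

end Potted

theorem theorem1p2 {V : Type*} [Fintype V] (G : SimpleGraph V) (n k : ℕ)
    (hk : k ≡ 2 [MOD 3]) (hnk : k + 3 ≤ n)
    (hn : Fintype.card V = n) (hG : Potted.IsPottedGraph G k) :
    (n ≡ 0 [MOD 3] →
      (Potted.numMaxDissociationSets G : ℚ) ≤ max (Potted.x1 n k) (Potted.x2 n k) ∧
      ((Potted.numMaxDissociationSets G : ℚ) = max (Potted.x1 n k) (Potted.x2 n k) ↔
        (Potted.InG2 G k ∧ Potted.x1 n k = max (Potted.x1 n k) (Potted.x2 n k)) ∨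
        (Potted.InG9 G k ∧ Potted.x2 n k = max (Potted.x1 n k) (Potted.x2 n k)))) ∧
    (n ≡ 1 [MOD 3] →
      (Potted.numMaxDissociationSets G : ℚ) ≤
        (k + 1) * (3 : ℚ) ^ (((n : ℤ) - k - 2) / 3 - 1) ∧
      ((Potted.numMaxDissociationSets G : ℚ) =
          (k + 1) * (3 : ℚ) ^ (((n : ℤ) - k - 2) / 3 - 1) ↔
        Potted.InG6 G k ∨ Potted.InG7 G k)) ∧
    (n ≡ 2 [MOD 3] →
      (Potted.numMaxDissociationSets G : ℚ) ≤ max (Potted.x3 n k) (Potted.x4 n k) ∧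
      ((Potted.numMaxDissociationSets G : ℚ) = max (Potted.x3 n k) (Potted.x4 n k) ↔
        (Potted.InG1 G k ∧ Potted.x3 n k = max (Potted.x3 n k) (Potted.x4 n k)) ∨
        (Potted.InG8 G k ∧ Potted.x4 n k = max (Potted.x3 n k) (Potted.x4 n k)))) := by
  obtain ⟨m, rfl⟩ : ∃ m, k = 3 * m + 5 := ⟨(k - 5) / 3, by have := hG.three_le; grind [Nat.ModEq]⟩
  obtain ⟨T, S, r, c, h⟩ := hG.exists_cycleWithTree
  rw [← Nat.card_eq_fintype_card] at hn
  have hcard : n = T.order + (3 * m + 4) := hn.symm.trans h.card_eq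
  subst hn
  refine ⟨fun hmod => ?_, fun hmod => ?_, fun hmod => ?_⟩ <;> unfold Nat.ModEq at hmod
  · obtain ⟨s, hs⟩ : ∃ s, T.order = 3 * s + 5 := ⟨(T.order - 5) / 3, by lia⟩
    exact Potted.le_max_and_eq_iff (h.extremal_or_lt_of_mod_zero hs)
      (·.numMaxDissociationSets_eq) (·.numMaxDissociationSets_eq)
  · obtain ⟨s, hs⟩ : ∃ s, T.order = 3 * s + 3 := ⟨(T.order - 3) / 3, by lia⟩
    exact h.le_and_eq_iff_of_mod_one hs
  · obtain ⟨s, hs⟩ : ∃ s, T.order = 3 * s + 4 := ⟨(T.order - 4) / 3, by lia⟩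
    exact Potted.le_max_and_eq_iff (h.extremal_or_lt_of_mod_two hs)
      (·.numMaxDissociationSets_eq) (·.numMaxDissociationSets_eq)
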